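/- A \emph{complete, convex, connected $C^2$ surface} in $\mathbb{R}^3$ is a connected embedded $C^2$ surface that is the boundary of a closed convex set with non-empty interior. A \emph{geodesic} of such a surface $K$ is any curve $\gamma\circ s$ on an open interval, where $\gamma$ is a unit speed $C^2$ curve in $K$ whose acceleration is everywhere normal to $K$, and $s$ is a $C^1$ change of parameter with nowhere vanishing derivative. Let $r>0$ and let $K_0$ and $K_r$ be complete, convex, connected $C^2$ surfaces in $\mathbb{R}^3$ that are regular constant distance surfaces at distance $r$: every point $x$ of $K_r$ has Euclidean distance exactly $r$ from $K_0$, and the point $\Pi(x)$ of $K_0$ nearest to $x$ is unique. Assume that $K_0$ is not a plane. Then the projection $\Pi:K_r\to K_0$ preserves geodesics (that is, $\Pi\circ c$ is a geodesic of $K_0$ for every geodesic $c$ of $K_r$) if and only if $K_0$ and $K_r$ are two concentric spheres or two coaxial infinite round cylinders (of finite positive radii). -/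

import Mathlib

open Set Filter Topology

/-- Euclidean three-space. -/
abbrev E3 : Type := EuclideanSpace ℝ (Fin 3)

/-- A regular (embedded) `C^2` surface in `ℝ^3`: near each of its points it is the zero set of a
`C^2` function with non-vanishing differential. -/
def IsC2Surface (S : Set E3) : Prop :=
  ∀ p ∈ S, ∃ U : Set E3, IsOpen U ∧ p ∈ U ∧ ∃ f : E3 → ℝ,
    ContDiffOn ℝ 2 f U ∧ fderiv ℝ f p ≠ 0 ∧ S ∩ U = {x | x ∈ U ∧ f x = 0}

/-- A complete, convex, connected `C^2` surface: a connected `C^2` surface that is the boundary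
of a closed convex set with non-empty interior. -/
structure IsConvexC2Surface (S : Set E3) : Prop where
  c2 : IsC2Surface S
  complete : IsComplete S
  connected : IsConnected S
  convex : ∃ B : Set E3, IsClosed B ∧ Convex ℝ B ∧ (interior B).Nonempty ∧ S = frontier B

/-- `v` is tangent to `S` at `p`: it is the velocity at `p` of a curve that runs in `S`. -/
def IsTangentVector (S : Set E3) (p v : E3) : Prop :=
  ∃ c : ℝ → E3, c 0 = p ∧ (∀ᶠ t in 𝓝 (0 : ℝ), c t ∈ S) ∧ HasDerivAt c v 0

/-- `γ`, restricted to the open interval `I`, is a unit speed geodesic of `S`: a `C^2` curve in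
`S` of unit speed whose acceleration is everywhere normal to `S`. -/
structure IsUnitSpeedGeodesicOn (S : Set E3) (γ : ℝ → E3) (I : Set ℝ) : Prop where
  contDiffOn : ContDiffOn ℝ 2 γ I
  mem : ∀ t ∈ I, γ t ∈ S
  unit_speed : ∀ t ∈ I, ‖deriv γ t‖ = 1
  normal : ∀ t ∈ I, ∀ v : E3, IsTangentVector S (γ t) v → inner ℝ (deriv (deriv γ) t) v = 0

/-- `c`, restricted to the open interval `I`, is a geodesic of `S` up to parametrization: a
non-singular `C^1` reparametrization of a unit speed geodesic. -/
def IsGeodesicOn (S : Set E3) (c : ℝ → E3) (I : Set ℝ) : Prop :=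
  ∃ (J : Set ℝ) (γ : ℝ → E3) (s : ℝ → ℝ), IsOpen J ∧ J.OrdConnected ∧
    IsUnitSpeedGeodesicOn S γ J ∧ ContDiffOn ℝ 1 s I ∧ (∀ t ∈ I, deriv s t ≠ 0) ∧
    MapsTo s I J ∧ EqOn c (γ ∘ s) I

/-- The set of the points of `S` nearest to `x`. -/
def nearestPoints (S : Set E3) (x : E3) : Set E3 :=
  {y | y ∈ S ∧ ∀ z ∈ S, dist x y ≤ dist x z}

/-- Every point of `S₁` has distance `r` from `S₂` and a unique nearest point in `S₂`. -/
def IsRegularConstantDistance (S₁ S₂ : Set E3) (r : ℝ) : Prop :=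
  ∀ x ∈ S₁, Metric.infDist x S₂ = r ∧ ∃! y, y ∈ nearestPoints S₂ x

/-- The projection to `S`: the nearest point of `S` (meaningful where it exists uniquely). -/
noncomputable def surfaceProj (S : Set E3) (x : E3) : E3 :=
  Classical.epsilon (fun y => y ∈ nearestPoints S x)

/-- The projection from `S₁` to `S₂` carries every geodesic of `S₁` to a geodesic of `S₂`, where
geodesics are curves on open intervals, up to non-singular reparametrization. -/
def ProjPreservesGeodesics (S₁ S₂ : Set E3) : Prop :=
  ∀ (I : Set ℝ) (c : ℝ → E3), IsOpen I → I.OrdConnected →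
    IsGeodesicOn S₁ c I → IsGeodesicOn S₂ (fun t => surfaceProj S₂ (c t)) I

/-- The infinite round cylinder of radius `R` whose axis is the line through `p` in the direction
of the unit vector `u`. -/
def roundCylinder (p u : E3) (R : ℝ) : Set E3 :=
  {x | ‖(x - p) - (inner ℝ u (x - p) : ℝ) • u‖ = R}

/-- `S` is an affine plane. -/
def IsAffinePlane (S : Set E3) : Prop :=
  ∃ p u : E3, u ≠ 0 ∧ S = {x | (inner ℝ u (x - p) : ℝ) = 0}

/-!
Write `K` for `Kᵣ`, let `n x = r⁻¹ (x - Π x)` and let `P` denote the orthogonal projection along a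
direction `d` (`P = id` if `d = 0`). The vector `n x` is a unit normal of `K` at `x` and a unit
normal of `K₀` at `Π x`, so that `Π x = x - r n x`. If `Π` preserves geodesics, then along a
geodesic `γ` of `K` with velocity `T` the unit tangent `u` of `Π ∘ γ` is orthogonal to `n ∘ γ` and
has derivative parallel to `n ∘ γ`, just as `T` has: both are parallel fields along `γ`
(`parallelTangents_projNormal`), and the angle between them is constant.

If `γ` starts in a principal direction, that angle is `0` or `π`, hence `γ` is a line of curvature
and lies in a plane together with its normals (`NormalGeodesic.inner_binormal`). At an elliptic
point the Gauss map is locally injective, and one can travel along two such planar geodesics, one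
after the other, to a nearby point with prescribed normal. This yields two principal directions
there that are not orthogonal, and in the limit the elliptic point is umbilic
(`NormalChart.umbilic_of_isEllipticAt`). Umbilic regions have an affine Gauss map `n x = k x + w`,
and this spreads over `K` by connectedness (`exists_gauss_eq_of_isEllipticAt`). If on the other hand
`K` contains lines of direction `d`, then comparing `T` and `u` along geodesics oblique to `d` shows
that the curvature of the cross section is constant, and `n x = k P x + w`
(`exists_gauss_eq_of_line`).

The convex body bounded by `K` decides between these cases: if its recession cone contains a line,
so does `K` through each of its points, and otherwise the body has bounded caps, on which the
distance from a suitable centre attains a maximum at an elliptic point of `K` (`exists_gauss_eq`).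
From `n x = k P x + w` one reads off that `K` lies in a plane (`k = 0`), in a sphere or in a round
cylinder, and that `Π` scales the orthogonal complement of the axis by `1 - r k`. Because the
surfaces are boundaries of closed convex bodies, these inclusions are equalities
(`exists_roundCylinder`); the case of a plane is excluded since `K₀` is not a plane.

Conversely, `Π` between concentric spheres or coaxial cylinders is a linear stretching orthogonal to
the axis. Accelerations of geodesics are orthogonal to the axis and to the surface, and therefore
the stretching maps unit speed geodesics to geodesics of constant speed
(`IsUnitSpeedGeodesicOn.axisStretch`).

The shape operator of a `C²` surface is only continuous. Geodesics are therefore obtained from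
Peano's theorem (`exists_integralCurve_of_hasCompactSupport`), and no argument relies on their
uniqueness.
-/

/-! ### Peano's existence theorem -/

/-- Peano's theorem for a continuous, compactly supported vector field: the field is approximated
uniformly by `C¹` fields, whose integral curves are provided by the Picard–Lindelöf theorem and are
equi-Lipschitz; their limit along an ultrafilter is an integral curve. -/
theorem exists_integralCurve_of_hasCompactSupport {E : Type*} [NormedAddCommGroup E]
    [NormedSpace ℝ E] [FiniteDimensional ℝ E] {F : E → E} (hF : Continuous F)
    (hc : HasCompactSupport F) (z₀ : E) :
    ∃ x : ℝ → E, x 0 = z₀ ∧ ∀ t ∈ Ioo (-1 : ℝ) 1, HasDerivAt x (F (x t)) t := by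
  have hcomplete : CompleteSpace E := FiniteDimensional.complete ℝ E
  have hproper : ProperSpace E := FiniteDimensional.proper ℝ E
  have huc := hc.uniformContinuous_of_continuous hF
  obtain ⟨M, hM⟩ := hc.exists_bound_of_continuous hF
  have hM0 : 0 ≤ M := (norm_nonneg _).trans (hM z₀)
  have happrox : ∀ n : ℕ, ∃ G : E → E, ContDiff ℝ 1 G ∧
      (∀ z, dist (G z) (F z) < 1 / ((n : ℝ) + 1)) ∧ Function.support G ⊆ Function.support F := by
    intro n
    exact_mod_cast hF.exists_contDiff_approx (ε := fun _ => 1 / ((n : ℝ) + 1)) 1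
      continuous_const (fun _ => by positivity)
  choose G hG1 hG2 hG3 using happrox
  have hGL : ∀ n z, ‖G n z‖ ≤ M + 1 := by
    intro n z
    have h1 := hG2 n z
    rw [dist_eq_norm] at h1
    have h2 : 1 / ((n : ℝ) + 1) ≤ 1 := by
      rw [div_le_one (by positivity)]; linarith [n.cast_nonneg (α := ℝ)]
    have h3 := norm_add_le (G n z - F z) (F z)
    rw [sub_add_cancel] at h3
    linarith [hM z]
  have hsol : ∀ n, ∃ x : ℝ → E, x 0 = z₀ ∧ ∀ t ∈ Ioo (-1 : ℝ) 1, HasDerivAt x (G n (x t)) t := by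
    intro n
    have hGc : HasCompactSupport (G n) := hc.mono (hG3 n)
    obtain ⟨C, hC⟩ := (hG1 n).lipschitzWith_of_hasCompactSupport hGc one_ne_zero
    have hPL : IsPicardLindelof (fun _ : ℝ => G n) (tmin := -1) (tmax := 1)
        ⟨0, by norm_num, by norm_num⟩ z₀ (Real.toNNReal (M + 1)) 0 (Real.toNNReal (M + 1)) C := by
      refine ⟨fun _ _ => hC.lipschitzOnWith, fun _ _ => continuousOn_const, fun _ _ z _ => ?_, ?_⟩
      · rw [Real.coe_toNNReal _ (by linarith)]; exact hGL n z
      · simp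
    obtain ⟨x, hx0, hx⟩ := hPL.exists_eq_forall_mem_Icc_hasDerivWithinAt₀
    exact ⟨x, hx0, fun t ht => (hx t (Ioo_subset_Icc_self ht)).hasDerivAt (Icc_mem_nhds ht.1 ht.2)⟩
  choose x hx0 hx using hsol
  have hlip : ∀ n, ∀ s ∈ Ioo (-1 : ℝ) 1, ∀ t ∈ Ioo (-1 : ℝ) 1,
      ‖x n t - x n s‖ ≤ (M + 1) * ‖t - s‖ := fun n s hs t ht =>
    (convex_Ioo (-1 : ℝ) 1).norm_image_sub_le_of_norm_hasDerivWithin_le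
      (fun τ hτ => (hx n τ hτ).hasDerivWithinAt) (fun τ _ => hGL n _) hs ht
  have h0 : (0 : ℝ) ∈ Ioo (-1 : ℝ) 1 := by constructor <;> norm_num
  let u : Ultrafilter ℕ := hyperfilter ℕ
  have hu : (u : Filter ℕ) ≤ atTop := Nat.hyperfilter_le_atTop
  have hlim : ∀ t, ∃ y : E, t ∈ Ioo (-1 : ℝ) 1 → Tendsto (fun n => x n t) u (𝓝 y) := by
    intro t
    by_cases ht : t ∈ Ioo (-1 : ℝ) 1
    · have hmem : ∀ n, x n t ∈ Metric.closedBall z₀ (M + 1) := by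
        intro n
        rw [mem_closedBall_iff_norm, ← hx0 n]
        refine (hlip n 0 h0 t ht).trans ?_
        have : ‖t - 0‖ ≤ 1 := by
          rw [sub_zero, Real.norm_eq_abs, abs_le]; exact ⟨ht.1.le, ht.2.le⟩
        nlinarith
      obtain ⟨y, -, hy⟩ := (isCompact_closedBall z₀ (M + 1)).ultrafilter_le_nhds'
        (u.map fun n => x n t) (Ultrafilter.mem_map.2 (Filter.univ_mem' hmem))
      exact ⟨y, fun _ => hy⟩
    · exact ⟨z₀, fun h => absurd h ht⟩
  choose X hX using hlim
  refine ⟨X, ?_, fun s hs => ?_⟩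
  · have h1 := hX 0 h0
    simp only [hx0] at h1
    exact tendsto_nhds_unique h1 tendsto_const_nhds
  rw [hasDerivAt_iff_isLittleO, Asymptotics.isLittleO_iff]
  intro ε hε
  obtain ⟨δ, hδ, hFδ⟩ := Metric.uniformContinuous_iff.1 huc (ε / 2) (by positivity)
  have hev : ∀ᶠ t in 𝓝 s, (M + 1) * ‖t - s‖ < δ / 2 := by
    have : Tendsto (fun t => (M + 1) * ‖t - s‖) (𝓝 s) (𝓝 ((M + 1) * ‖s - s‖)) := by
      apply Continuous.tendsto; fun_prop
    rw [sub_self, norm_zero, mul_zero] at this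
    exact this.eventually_lt_const (by positivity)
  filter_upwards [hev, isOpen_Ioo.mem_nhds hs] with t htδ ht
  have hlimit : Tendsto (fun n => ‖x n t - x n s - (t - s) • F (X s)‖) u
      (𝓝 ‖X t - X s - (t - s) • F (X s)‖) :=
    (((hX t ht).sub (hX s hs)).sub_const _).norm
  refine le_of_tendsto hlimit ?_
  have hclose : ∀ᶠ n in (u : Filter ℕ), dist (x n s) (X s) < δ / 2 :=
    (hX s hs).eventually (Metric.ball_mem_nhds _ (by positivity))
  have hsmall : ∀ᶠ n : ℕ in (u : Filter ℕ), 1 / ((n : ℝ) + 1) < ε / 2 :=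
    hu ((tendsto_one_div_add_atTop_nhds_zero_nat (𝕜 := ℝ)).eventually_lt_const (by positivity))
  filter_upwards [hclose, hsmall] with n hn1 hn2
  have hsub : uIcc s t ⊆ Ioo (-1 : ℝ) 1 := ordConnected_Ioo.uIcc_subset hs ht
  have hmv := (convex_uIcc s t).norm_image_sub_le_of_norm_hasDerivWithin_le
    (f := fun τ => x n τ - τ • F (X s)) (f' := fun τ => G n (x n τ) - F (X s)) (C := ε)
    (fun τ hτ => by
      have := (hx n τ (hsub hτ)).sub ((hasDerivAt_id τ).smul_const (F (X s)))
      rw [one_smul] at this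
      exact this.hasDerivWithinAt)
    (fun τ hτ => by
      have h1 : dist (x n τ) (X s) < δ := by
        have h2 := hlip n s hs τ (hsub hτ)
        have h3 : ‖τ - s‖ ≤ ‖t - s‖ := by
          simpa [Real.norm_eq_abs] using abs_sub_left_of_mem_uIcc hτ
        have h4 : dist (x n τ) (x n s) ≤ (M + 1) * ‖t - s‖ := by
          rw [dist_eq_norm]
          exact h2.trans (by gcongr)
        linarith [dist_triangle (x n τ) (x n s) (X s)]
      have h5 := hFδ h1
      have h6 := hG2 n (x n τ)
      rw [← dist_eq_norm]
      linarith [dist_triangle (G n (x n τ)) (F (x n τ)) (F (X s))])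
    left_mem_uIcc right_mem_uIcc
  have hrw : x n t - x n s - (t - s) • F (X s)
      = (x n t - t • F (X s)) - (x n s - s • F (X s)) := by
    rw [sub_smul]; abel
  rw [hrw]
  exact hmv

/-- Peano's theorem on an open set, with an existence time that is uniform for starting points in a
compact set. -/
theorem exists_uniform_integralCurve {E : Type*} [NormedAddCommGroup E]
    [NormedSpace ℝ E] [FiniteDimensional ℝ E] {F : E → E} {Ω C : Set E} (hΩ : IsOpen Ω)
    (hF : ContinuousOn F Ω) (hC : IsCompact C) (hCΩ : C ⊆ Ω) :
    ∃ ε > 0, ∀ z₀ ∈ C, ∃ x : ℝ → E, x 0 = z₀ ∧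
      ∀ t ∈ Ioo (-ε) ε, x t ∈ Ω ∧ HasDerivAt x (F (x t)) t := by
  have hproper : ProperSpace E := FiniteDimensional.proper ℝ E
  obtain ⟨C', hC', hCC', hC'Ω⟩ := exists_compact_between hC hΩ hCΩ
  obtain ⟨k, hk, hC'k, hkΩ⟩ := exists_compact_between hC' hΩ hC'Ω
  obtain ⟨χ, hχ1, hχ0, hχc, -⟩ := exists_continuous_one_zero_of_isCompact hC'
    isOpen_interior.isClosed_compl (disjoint_compl_right_iff_subset.mpr hC'k)
  have hGc : Continuous fun z => χ z • F z := by
    rw [continuous_iff_continuousAt]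
    intro z
    by_cases hz : z ∈ Ω
    · exact χ.continuous.continuousAt.smul (hF.continuousAt (hΩ.mem_nhds hz))
    · have hzk : kᶜ ∈ 𝓝 z := hk.isClosed.isOpen_compl.mem_nhds fun h => hz (hkΩ h)
      have : (fun z => χ z • F z) =ᶠ[𝓝 z] fun _ => 0 := by
        filter_upwards [hzk] with y hy
        have : χ y = 0 := hχ0 (fun h => hy (interior_subset h))
        simp [this]
      exact continuousAt_const.congr this.symm
  have hGs : HasCompactSupport fun z => χ z • F z := hχc.smul_right
  obtain ⟨M, hM⟩ := hGs.exists_bound_of_continuous hGc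
  obtain ⟨δ, hδ, hδC⟩ := hC.exists_thickening_subset_open isOpen_interior hCC'
  have hpos : 0 < |M| + 1 := by positivity
  refine ⟨min 1 (δ / (|M| + 1)), by positivity, fun z₀ hz₀ => ?_⟩
  obtain ⟨x, hx0, hx⟩ := exists_integralCurve_of_hasCompactSupport hGc hGs z₀
  refine ⟨x, hx0, fun t ht => ?_⟩
  have h1 : t ∈ Ioo (-1 : ℝ) 1 :=
    ⟨by linarith [ht.1, min_le_left 1 (δ / (|M| + 1))], by
      linarith [ht.2, min_le_left 1 (δ / (|M| + 1))]⟩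
  have h0 : (0 : ℝ) ∈ Ioo (-1 : ℝ) 1 := by constructor <;> norm_num
  have hd : ‖x t - x 0‖ ≤ (|M| + 1) * ‖t - 0‖ :=
    (convex_Ioo (-1 : ℝ) 1).norm_image_sub_le_of_norm_hasDerivWithin_le
      (fun τ hτ => (hx τ hτ).hasDerivWithinAt)
      (fun τ _ => (hM _).trans (by linarith [le_abs_self M])) h0 h1
  have ht' : |t| < δ / (|M| + 1) :=
    abs_lt.2 ⟨by linarith [ht.1, min_le_right 1 (δ / (|M| + 1))], by
      linarith [ht.2, min_le_right 1 (δ / (|M| + 1))]⟩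
  rw [lt_div_iff₀ hpos] at ht'
  have hmem : x t ∈ C' := interior_subset (hδC (Metric.mem_thickening_iff.2 ⟨z₀, hz₀, by
    rw [dist_eq_norm, ← hx0]
    refine hd.trans_lt ?_
    rw [sub_zero, Real.norm_eq_abs, mul_comm]; exact ht'⟩))
  refine ⟨hC'Ω hmem, ?_⟩
  have := hx t h1
  rwa [hχ1 hmem, Pi.one_apply, one_smul] at this

section

/-! ### Charts of a surface with a unit normal field -/

/-- A curve with vanishing velocity on a symmetric interval is constant there. -/
theorem eq_of_hasDerivAt_zero_Ioo {F : Type*} [NormedAddCommGroup F] [NormedSpace ℝ F]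
    {g : ℝ → F} {ε t : ℝ} (hg : ∀ s ∈ Ioo (-ε) ε, HasDerivAt g 0 s) (ht : t ∈ Ioo (-ε) ε) :
    g t = g 0 := by
  have h0 : (0 : ℝ) ∈ Ioo (-ε) ε := by
    constructor <;> linarith [ht.1, ht.2]
  have := (convex_Ioo (-ε) ε).norm_image_sub_le_of_norm_hasDerivWithin_le (C := 0)
    (fun s hs => (hg s hs).hasDerivWithinAt) (fun _ _ => by simp) h0 ht
  rw [zero_mul, norm_le_zero_iff, sub_eq_zero] at this
  exact this

/-- A local description of `K` in `U` as a regular level set `f = 0`, together with a `C¹` unit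
field `N`, parallel to the gradient of `f`, that extends the normal field `n` of `K`. -/
structure NormalChart (K : Set E3) (n : E3 → E3) (U : Set E3) (f : E3 → ℝ) (N : E3 → E3) :
    Prop where
  isOpen : IsOpen U
  contDiff_f : ContDiffOn ℝ 2 f U
  contDiff_N : ContDiffOn ℝ 1 N U
  norm_N : ∀ x ∈ U, ‖N x‖ = 1
  fderiv_f : ∀ x ∈ U, ∃ c : ℝ, c ≠ 0 ∧ ∀ v, fderiv ℝ f x v = c * inner ℝ (N x) v
  zero_set : K ∩ U = {x | x ∈ U ∧ f x = 0}
  eq_n : ∀ x ∈ K ∩ U, n x = N x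

/-- `K` is covered by charts that are adapted to the normal field `n`. -/
def HasNormalCharts (K : Set E3) (n : E3 → E3) : Prop :=
  ∀ x ∈ K, ∃ U f N, NormalChart K n U f N ∧ x ∈ U

namespace NormalChart

variable {K U : Set E3} {n N : E3 → E3} {f : E3 → ℝ}

theorem differentiableAt_N (h : NormalChart K n U f N) {x : E3} (hx : x ∈ U) :
    DifferentiableAt ℝ N x :=
  (h.contDiff_N.contDiffAt (h.isOpen.mem_nhds hx)).differentiableAt one_ne_zero

theorem hasFDerivAt_N (h : NormalChart K n U f N) {x : E3} (hx : x ∈ U) :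
    HasFDerivAt N (fderiv ℝ N x) x :=
  (h.differentiableAt_N hx).hasFDerivAt

theorem hasFDerivAt_f (h : NormalChart K n U f N) {x : E3} (hx : x ∈ U) :
    HasFDerivAt f (fderiv ℝ f x) x :=
  ((h.contDiff_f.contDiffAt (h.isOpen.mem_nhds hx)).differentiableAt two_ne_zero).hasFDerivAt

theorem continuousOn_fderiv (h : NormalChart K n U f N) :
    ContinuousOn (fun x => fderiv ℝ N x) U :=
  h.contDiff_N.continuousOn_fderiv_of_isOpen h.isOpen le_rfl

theorem inner_self (h : NormalChart K n U f N) {x : E3} (hx : x ∈ U) :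
    inner ℝ (N x) (N x) = 1 := by
  rw [real_inner_self_eq_norm_sq, h.norm_N x hx, one_pow]

theorem f_eq_zero (h : NormalChart K n U f N) {x : E3} (hx : x ∈ U) (hK : x ∈ K) : f x = 0 := by
  have : x ∈ K ∩ U := ⟨hK, hx⟩
  rw [h.zero_set] at this
  exact this.2

theorem mem_of_f_eq_zero (h : NormalChart K n U f N) {x : E3} (hx : x ∈ U) (hf : f x = 0) :
    x ∈ K := by
  have : x ∈ {x | x ∈ U ∧ f x = 0} := ⟨hx, hf⟩
  rw [← h.zero_set] at this
  exact this.1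

theorem inner_fderiv (h : NormalChart K n U f N) {x : E3} (hx : x ∈ U) (v : E3) :
    inner ℝ (N x) (fderiv ℝ N x v) = 0 := by
  have h1 : HasFDerivAt (fun y => inner ℝ (N y) (N y)) _ x :=
    (h.hasFDerivAt_N hx).inner ℝ (h.hasFDerivAt_N hx)
  have h2 : (fun y => inner ℝ (N y) (N y)) =ᶠ[𝓝 x] fun _ => (1 : ℝ) := by
    filter_upwards [h.isOpen.mem_nhds hx] with y hy using h.inner_self hy
  have h3 := h1.unique ((hasFDerivAt_const (1 : ℝ) x).congr_of_eventuallyEq h2)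
  have h4 := congrArg (fun L : E3 →L[ℝ] ℝ => L v) h3
  simpa [real_inner_comm] using h4

/-- The shape operator is symmetric: it is a multiple of the Hessian of `f` on tangent vectors. -/
theorem fderiv_symm (h : NormalChart K n U f N) {x v w : E3} (hx : x ∈ U)
    (hv : inner ℝ (N x) v = 0) (hw : inner ℝ (N x) w = 0) :
    inner ℝ (fderiv ℝ N x v) w = inner ℝ v (fderiv ℝ N x w) := by
  have hfx : ContDiffAt ℝ 2 f x := h.contDiff_f.contDiffAt (h.isOpen.mem_nhds hx)
  have hsymm : IsSymmSndFDerivAt ℝ f x := hfx.isSymmSndFDerivAt (by simp)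
  have hd : DifferentiableAt ℝ (fderiv ℝ f) x :=
    (hfx.fderiv_right (m := 1) (by norm_num)).differentiableAt one_ne_zero
  have hfN : ∀ y ∈ U, ∀ w, fderiv ℝ f y w = fderiv ℝ f y (N y) * inner ℝ (N y) w := by
    intro y hy w
    obtain ⟨c, -, hc⟩ := h.fderiv_f y hy
    rw [hc, hc (N y), h.inner_self hy, mul_one]
  have key : ∀ v w, inner ℝ (N x) w = 0 → fderiv ℝ (fderiv ℝ f) x v w
      = fderiv ℝ f x (N x) * inner ℝ (fderiv ℝ N x v) w := by
    intro v w hw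
    have h1 : HasFDerivAt (fun y => fderiv ℝ f y w) _ x :=
      hd.hasFDerivAt.clm_apply (hasFDerivAt_const w x)
    have h2 : HasFDerivAt (fun y => fderiv ℝ f y (N y) * inner ℝ (N y) w) _ x :=
      (hd.hasFDerivAt.clm_apply (h.hasFDerivAt_N hx)).mul
        ((h.hasFDerivAt_N hx).inner ℝ (hasFDerivAt_const w x))
    have h3 : (fun y => fderiv ℝ f y w) =ᶠ[𝓝 x]
        fun y => fderiv ℝ f y (N y) * inner ℝ (N y) w := by
      filter_upwards [h.isOpen.mem_nhds hx] with y hy using hfN y hy w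
    have h4 := congrArg (fun L : E3 →L[ℝ] ℝ => L v) (h1.unique (h2.congr_of_eventuallyEq h3))
    simpa [hw] using h4
  have h5 := hsymm v w
  rw [key v w hw, key w v hv] at h5
  obtain ⟨c, hc0, hc⟩ := h.fderiv_f x hx
  rw [hc (N x), h.inner_self hx, mul_one] at h5
  rw [mul_left_cancel₀ hc0 h5, real_inner_comm]

theorem inner_velocity (h : NormalChart K n U f N) {c : ℝ → E3} {v : E3} {t : ℝ}
    (hx : c t ∈ U) (hc : ∀ᶠ s in 𝓝 t, c s ∈ K) (hd : HasDerivAt c v t) :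
    inner ℝ (N (c t)) v = 0 := by
  have h1 : HasDerivAt (f ∘ c) (fderiv ℝ f (c t) v) t :=
    (h.hasFDerivAt_f hx).comp_hasDerivAt t hd
  have h2 : f ∘ c =ᶠ[𝓝 t] fun _ => (0 : ℝ) := by
    filter_upwards [hc, hd.continuousAt.eventually (h.isOpen.mem_nhds hx)] with s hs hs'
    exact h.f_eq_zero hs' hs
  have h3 := h1.unique ((hasDerivAt_const t (0 : ℝ)).congr_of_eventuallyEq h2)
  obtain ⟨a, ha0, ha⟩ := h.fderiv_f _ hx
  rw [ha] at h3
  exact (mul_eq_zero.1 h3).resolve_left ha0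

theorem hasDerivAt_normal (h : NormalChart K n U f N) {c : ℝ → E3} {v : E3} {t : ℝ}
    (hx : c t ∈ U) (hc : ∀ᶠ s in 𝓝 t, c s ∈ K) (hd : HasDerivAt c v t) :
    HasDerivAt (fun s => n (c s)) (fderiv ℝ N (c t) v) t := by
  have h1 : HasDerivAt (N ∘ c) (fderiv ℝ N (c t) v) t :=
    (h.hasFDerivAt_N hx).comp_hasDerivAt t hd
  refine h1.congr_of_eventuallyEq ?_
  filter_upwards [hc, hd.continuousAt.eventually (h.isOpen.mem_nhds hx)] with s hs hs'
  exact h.eq_n _ ⟨hs, hs'⟩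

end NormalChart

/-! ### Geodesics -/

/-- A unit speed curve `γ` in `K`, defined on `(-ε, ε)`, with velocity `T` and with acceleration
`-κ n`; that is, a unit speed geodesic of a surface `K` with unit normal field `n`. -/
structure NormalGeodesic (K : Set E3) (n : E3 → E3) (γ T : ℝ → E3) (κ : ℝ → ℝ) (ε : ℝ) :
    Prop where
  mem : ∀ t ∈ Ioo (-ε) ε, γ t ∈ K
  hasDerivAt : ∀ t ∈ Ioo (-ε) ε, HasDerivAt γ (T t) t
  hasDerivAt_velocity : ∀ t ∈ Ioo (-ε) ε, HasDerivAt T (-(κ t) • n (γ t)) t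
  norm_velocity : ∀ t ∈ Ioo (-ε) ε, ‖T t‖ = 1
  continuousOn : ContinuousOn κ (Ioo (-ε) ε)

namespace NormalGeodesic

theorem mono {K : Set E3} {n : E3 → E3} {γ T : ℝ → E3} {κ : ℝ → ℝ} {ε ε' : ℝ}
    (h : NormalGeodesic K n γ T κ ε) (hε : ε' ≤ ε) : NormalGeodesic K n γ T κ ε' := by
  have hsub : Ioo (-ε') ε' ⊆ Ioo (-ε) ε := Ioo_subset_Ioo (by linarith) hε
  exact ⟨fun t ht => h.mem t (hsub ht), fun t ht => h.hasDerivAt t (hsub ht),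
    fun t ht => h.hasDerivAt_velocity t (hsub ht), fun t ht => h.norm_velocity t (hsub ht),
    h.continuousOn.mono hsub⟩

theorem eventually_mem {K : Set E3} {n : E3 → E3} {γ T : ℝ → E3} {κ : ℝ → ℝ} {ε t : ℝ}
    (h : NormalGeodesic K n γ T κ ε) (ht : t ∈ Ioo (-ε) ε) : ∀ᶠ s in 𝓝 t, γ s ∈ K := by
  filter_upwards [isOpen_Ioo.mem_nhds ht] with s hs using h.mem s hs

theorem dist_le {K : Set E3} {n : E3 → E3} {γ T : ℝ → E3} {κ : ℝ → ℝ} {ε t : ℝ}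
    (h : NormalGeodesic K n γ T κ ε) (ht : t ∈ Ioo (-ε) ε) : dist (γ t) (γ 0) ≤ |t| := by
  have h0 : (0 : ℝ) ∈ Ioo (-ε) ε := by constructor <;> linarith [ht.1, ht.2]
  have := (convex_Ioo (-ε) ε).norm_image_sub_le_of_norm_hasDerivWithin_le (C := 1)
    (fun s hs => (h.hasDerivAt s hs).hasDerivWithinAt) (fun s hs => (h.norm_velocity s hs).le) h0 ht
  rw [dist_eq_norm]
  simpa using this

theorem inner_normal {K : Set E3} {n : E3 → E3} {γ T : ℝ → E3} {κ : ℝ → ℝ} {ε t : ℝ}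
    (hK : HasNormalCharts K n)
    (h : NormalGeodesic K n γ T κ ε) (ht : t ∈ Ioo (-ε) ε) : inner ℝ (n (γ t)) (T t) = 0 := by
  obtain ⟨U, f, N, hc, hx⟩ := hK (γ t) (h.mem t ht)
  rw [hc.eq_n _ ⟨h.mem t ht, hx⟩]
  exact hc.inner_velocity hx (h.eventually_mem ht) (h.hasDerivAt t ht)

theorem norm_normal {K : Set E3} {n : E3 → E3} {γ T : ℝ → E3} {κ : ℝ → ℝ} {ε t : ℝ}
    (hK : HasNormalCharts K n)
    (h : NormalGeodesic K n γ T κ ε) (ht : t ∈ Ioo (-ε) ε) : ‖n (γ t)‖ = 1 := by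
  obtain ⟨U, f, N, hc, hx⟩ := hK (γ t) (h.mem t ht)
  rw [hc.eq_n _ ⟨h.mem t ht, hx⟩]
  exact hc.norm_N _ hx

theorem inner_deriv_normal {K : Set E3} {n : E3 → E3} {γ T : ℝ → E3} {κ : ℝ → ℝ} {ε t : ℝ}
    (hK : HasNormalCharts K n) (h : NormalGeodesic K n γ T κ ε) (ht : t ∈ Ioo (-ε) ε) {m : E3}
    (hm : HasDerivAt (fun s => n (γ s)) m t) : inner ℝ m (T t) = κ t := by
  have h1 := hm.inner ℝ (h.hasDerivAt_velocity t ht)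
  have h2 : (fun s => inner ℝ (n (γ s)) (T s)) =ᶠ[𝓝 t] fun _ => (0 : ℝ) := by
    filter_upwards [isOpen_Ioo.mem_nhds ht] with s hs using h.inner_normal hK hs
  have h3 := h1.unique ((hasDerivAt_const t (0 : ℝ)).congr_of_eventuallyEq h2)
  rw [inner_smul_right, real_inner_self_eq_norm_sq, h.norm_normal hK ht] at h3
  linarith

/-- The normal curvature of a geodesic is the second fundamental form of its velocity. -/
theorem curvature_eq {K U : Set E3} {n N : E3 → E3} {f : E3 → ℝ} {γ T : ℝ → E3} {κ : ℝ → ℝ}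
    {ε t : ℝ} (hK : HasNormalCharts K n) (hc : NormalChart K n U f N)
    (h : NormalGeodesic K n γ T κ ε) (ht : t ∈ Ioo (-ε) ε) (hx : γ t ∈ U) :
    κ t = inner ℝ (fderiv ℝ N (γ t) (T t)) (T t) :=
  (inner_deriv_normal hK h ht
    (hc.hasDerivAt_normal hx (h.eventually_mem ht) (h.hasDerivAt t ht))).symm

end NormalGeodesic

/-- Geodesics exist for every initial point and direction, on an interval whose length is locally
uniform. The geodesic equation has only continuous coefficients, hence the appeal to Peano's
theorem; its solutions stay on the surface since they conserve `⟪N, γ'⟫`. -/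
theorem NormalChart.exists_geodesic {K U : Set E3} {n N : E3 → E3} {f : E3 → ℝ}
    (h : NormalChart K n U f N) {x₀ : E3} (hx₀ : x₀ ∈ U) :
    ∃ ρ > 0, ∀ x ∈ K ∩ Metric.ball x₀ ρ, ∀ v : E3, ‖v‖ = 1 → inner ℝ (N x) v = 0 →
      ∃ γ T κ, NormalGeodesic K n γ T κ ρ ∧ γ 0 = x ∧ T 0 = v ∧ ∀ t ∈ Ioo (-ρ) ρ, γ t ∈ U := by
  obtain ⟨ρ₁, hρ₁, hball⟩ := Metric.nhds_basis_closedBall.mem_iff.1 (h.isOpen.mem_nhds hx₀)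
  let k : E3 × E3 → ℝ := fun z => inner ℝ (fderiv ℝ N z.1 z.2) z.2
  let F : E3 × E3 → E3 × E3 := fun z => (z.2, -(k z) • N z.1)
  have hmaps : MapsTo (Prod.fst : E3 × E3 → E3) (U ×ˢ univ) U := fun z hz => hz.1
  have hk : ContinuousOn k (U ×ˢ univ) :=
    ((h.continuousOn_fderiv.comp continuousOn_fst hmaps).clm_apply continuousOn_snd).inner
      continuousOn_snd
  have hF : ContinuousOn F (U ×ˢ univ) :=
    continuousOn_snd.prodMk (hk.neg.smul (h.contDiff_N.continuousOn.comp continuousOn_fst hmaps))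
  obtain ⟨ε, hε, hsol⟩ := exists_uniform_integralCurve (h.isOpen.prod isOpen_univ) hF
    ((isCompact_closedBall x₀ ρ₁).prod (isCompact_sphere (0 : E3) 1))
    (prod_mono hball (subset_univ _))
  refine ⟨min ε ρ₁, lt_min hε hρ₁, fun x hx v hv hxv => ?_⟩
  obtain ⟨z, hz0, hz⟩ := hsol (x, v) ⟨Metric.closedBall_subset_closedBall (min_le_right _ _)
    (Metric.ball_subset_closedBall hx.2), by simpa using hv⟩
  have hγ : ∀ t ∈ Ioo (-ε) ε, HasDerivAt (fun t => (z t).1) (z t).2 t := fun t ht =>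
    (hz t ht).2.fst
  have hT : ∀ t ∈ Ioo (-ε) ε, HasDerivAt (fun t => (z t).2) (-(k (z t)) • N (z t).1) t :=
    fun t ht => (hz t ht).2.snd
  have hU : ∀ t ∈ Ioo (-ε) ε, (z t).1 ∈ U := fun t ht => (hz t ht).1.1
  have hg : ∀ t ∈ Ioo (-ε) ε, inner ℝ (N (z t).1) (z t).2 = 0 := by
    intro t ht
    have h1 : ∀ s ∈ Ioo (-ε) ε, HasDerivAt (fun t => inner ℝ (N (z t).1) (z t).2) 0 s := by
      intro s hs
      have h2 := ((h.hasFDerivAt_N (hU s hs)).comp_hasDerivAt s (hγ s hs)).inner ℝ (hT s hs)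
      refine h2.congr_deriv ?_
      simp only [Function.comp, inner_smul_right, h.inner_self (hU s hs), k]
      ring
    rw [eq_of_hasDerivAt_zero_Ioo h1 ht, hz0]
    exact hxv
  have hn : ∀ t ∈ Ioo (-ε) ε, inner ℝ (z t).2 (z t).2 = 1 := by
    intro t ht
    have h1 : ∀ s ∈ Ioo (-ε) ε, HasDerivAt (fun t => inner ℝ (z t).2 (z t).2) 0 s := by
      intro s hs
      have h2 := (hT s hs).inner ℝ (hT s hs)
      refine h2.congr_deriv ?_
      rw [inner_smul_right, inner_smul_left, real_inner_comm, hg s hs]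
      simp
    rw [eq_of_hasDerivAt_zero_Ioo h1 ht, hz0, real_inner_self_eq_norm_sq, hv, one_pow]
  have hfz : ∀ t ∈ Ioo (-ε) ε, f (z t).1 = 0 := by
    intro t ht
    have h1 : ∀ s ∈ Ioo (-ε) ε, HasDerivAt (fun t => f (z t).1) 0 s := by
      intro s hs
      have h2 := (h.hasFDerivAt_f (hU s hs)).comp_hasDerivAt s (hγ s hs)
      obtain ⟨c, -, hc⟩ := h.fderiv_f _ (hU s hs)
      rw [hc, hg s hs, mul_zero] at h2
      exact h2
    have h0 : (0 : ℝ) ∈ Ioo (-ε) ε := by constructor <;> linarith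
    have hU0 := hU 0 h0
    rw [eq_of_hasDerivAt_zero_Ioo h1 ht]
    rw [hz0] at hU0 ⊢
    exact h.f_eq_zero hU0 hx.1
  have hKz : ∀ t ∈ Ioo (-ε) ε, (z t).1 ∈ K := fun t ht => h.mem_of_f_eq_zero (hU t ht) (hfz t ht)
  have hcont : ContinuousOn z (Ioo (-ε) ε) := fun t ht =>
    (hz t ht).2.continuousAt.continuousWithinAt
  have hgeo : NormalGeodesic K n (fun t => (z t).1) (fun t => (z t).2) (fun t => k (z t)) ε :=
    { mem := hKz
      hasDerivAt := hγ
      hasDerivAt_velocity := fun t ht => by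
        rw [h.eq_n _ ⟨hKz t ht, hU t ht⟩]
        exact hT t ht
      norm_velocity := fun t ht => by
        rw [norm_eq_sqrt_real_inner, hn t ht, Real.sqrt_one]
      continuousOn := hk.comp hcont fun t ht => (hz t ht).1 }
  exact ⟨_, _, _, hgeo.mono (min_le_left _ _), by rw [hz0], by rw [hz0],
    fun t ht => hU t (Ioo_subset_Ioo (neg_le_neg (min_le_left _ _)) (min_le_left _ _) ht)⟩

end

/-! ### The projection along the normals -/

/-- Along every geodesic of `K`, the map `x ↦ x - r n(x)` is immersive, and the unit tangent `u` of
the image curve moves parallel to the normal `n`: this is what remains of the condition that the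
image curve be a geodesic of the surface traced by `x - r n(x)`, which has the same normals. -/
def ParallelTangents (K : Set E3) (n : E3 → E3) (r : ℝ) : Prop :=
  ∀ (ε : ℝ) (γ T : ℝ → E3) (κ : ℝ → ℝ), NormalGeodesic K n γ T κ ε →
    ∃ (u : ℝ → E3) (σ μ : ℝ → ℝ), ∀ t ∈ Ioo (-ε) ε, ‖u t‖ = 1 ∧ σ t ≠ 0 ∧
      inner ℝ (n (γ t)) (u t) = 0 ∧ HasDerivAt u (μ t • n (γ t)) t ∧
      HasDerivAt (fun s => γ s - r • n (γ s)) (σ t • u t) t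

theorem eq_inner_smul_of_forall_inner_eq_zero {a b : E3} (ha : ‖a‖ = 1)
    (h : ∀ v : E3, ‖v‖ = 1 → inner ℝ a v = 0 → inner ℝ b v = 0) : b = (inner ℝ a b : ℝ) • a := by
  by_contra hne
  set w := b - (inner ℝ a b : ℝ) • a with hw
  have hw0 : w ≠ 0 := fun h0 => hne (sub_eq_zero.1 h0)
  have haw : inner ℝ a w = 0 := by
    rw [hw, inner_sub_right, inner_smul_right, real_inner_self_eq_norm_sq, ha]; ring
  have h1 := h (‖w‖⁻¹ • w) (norm_smul_inv_norm hw0) (by rw [inner_smul_right, haw, mul_zero])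
  rw [inner_smul_right] at h1
  have h2 : inner ℝ b w = 0 :=
    (mul_eq_zero.1 h1).resolve_left (inv_ne_zero (norm_ne_zero_iff.2 hw0))
  have h3 : inner ℝ w w = 0 := by
    nth_rewrite 1 [hw]
    rw [inner_sub_left, inner_smul_left, haw, h2]; simp
  exact hw0 (inner_self_eq_zero.1 h3)

theorem IsTangentVector.smul {S : Set E3} {p v : E3} (h : IsTangentVector S p v) (a : ℝ) :
    IsTangentVector S p (a • v) := by
  obtain ⟨c, hc0, hc, hd⟩ := h
  have ha : HasDerivAt (fun t : ℝ => a * t) a 0 := by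
    simpa using (hasDerivAt_id (0 : ℝ)).const_mul a
  refine ⟨fun t => c (a * t), by simpa using hc0, ?_, ?_⟩
  · have : Tendsto (fun t : ℝ => a * t) (𝓝 0) (𝓝 0) := by
      simpa using ha.continuousAt.tendsto
    exact this.eventually hc
  · have hd' : HasDerivAt c v (a * 0) := by simpa using hd
    exact hd'.scomp (0 : ℝ) ha

/-- Positions that are extremal for the distance to `y` see `y` in a normal direction. -/
theorem IsTangentVector.inner_eq_zero_of_forall_dist_le {S : Set E3} {p v y : E3}
    (h : IsTangentVector S p v) (hmin : ∀ q ∈ S, dist p y ≤ dist q y) :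
    inner ℝ (p - y) v = 0 := by
  obtain ⟨c, hc0, hc, hd⟩ := h
  have h1 : HasDerivAt (fun t => inner ℝ (c t - y) (c t - y)) _ 0 :=
    (hd.sub_const y).inner ℝ (hd.sub_const y)
  have h2 : IsLocalMin (fun t => inner ℝ (c t - y) (c t - y)) 0 := by
    filter_upwards [hc] with t ht
    have h3 := hmin _ ht
    rw [dist_eq_norm, dist_eq_norm] at h3
    rw [real_inner_self_eq_norm_sq, real_inner_self_eq_norm_sq, hc0]
    gcongr
  have h4 := h2.hasDerivAt_eq_zero h1
  rw [hc0] at h4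
  linarith [real_inner_comm (p - y) v]

theorem surfaceProj_mem {K K₀ : Set E3} {r : ℝ} (hdist : IsRegularConstantDistance K K₀ r) {x : E3}
    (hx : x ∈ K) : surfaceProj K₀ x ∈ nearestPoints K₀ x :=
  Classical.epsilon_spec (p := fun y => y ∈ nearestPoints K₀ x) (hdist x hx).2.exists

theorem dist_surfaceProj {K K₀ : Set E3} {r : ℝ} (hdist : IsRegularConstantDistance K K₀ r) {x : E3}
    (hx : x ∈ K) : dist x (surfaceProj K₀ x) = r := by
  obtain ⟨hmem, hle⟩ := surfaceProj_mem hdist hx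
  rw [← (hdist x hx).1]
  exact le_antisymm ((Metric.le_infDist ⟨_, hmem⟩).2 hle)
    (Metric.infDist_le_dist_of_mem hmem)

theorem continuousOn_surfaceProj {K K₀ : Set E3} {r : ℝ} (hK₀ : IsClosed K₀)
    (hdist : IsRegularConstantDistance K K₀ r) : ContinuousOn (surfaceProj K₀) K := by
  intro x hx
  have hcomp : IsCompact (K₀ ∩ Metric.closedBall x (r + 1)) :=
    (isCompact_closedBall x (r + 1)).inter_left hK₀
  refine hcomp.tendsto_nhds_of_unique_mapClusterPt ?_ ?_
  · have hball : Metric.ball x 1 ∈ 𝓝[K] x :=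
      mem_nhdsWithin_of_mem_nhds (Metric.ball_mem_nhds x one_pos)
    filter_upwards [self_mem_nhdsWithin, hball] with z hz hzx
    refine ⟨(surfaceProj_mem hdist hz).1, ?_⟩
    rw [Metric.mem_closedBall, dist_comm]
    rw [Metric.mem_ball, dist_comm] at hzx
    linarith [dist_triangle x z (surfaceProj K₀ z), dist_surfaceProj hdist hz]
  · intro y hy hcl
    have hmap : Tendsto (fun z => dist z (surfaceProj K₀ z)) (𝓝[K] x) (𝓝 r) :=
      tendsto_const_nhds.congr' (by
        filter_upwards [self_mem_nhdsWithin] with z hz using (dist_surfaceProj hdist hz).symm)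
    have hxy : dist x y = r := by
      rw [mapClusterPt_iff_ultrafilter] at hcl
      obtain ⟨u, hu, huy⟩ := hcl
      have h1 : Tendsto (fun z => dist z (surfaceProj K₀ z)) u (𝓝 (dist x y)) :=
        Tendsto.dist (tendsto_id.mono_left (hu.trans nhdsWithin_le_nhds)) huy
      exact tendsto_nhds_unique h1 (hmap.mono_left hu)
    have hy' : y ∈ nearestPoints K₀ x := by
      refine ⟨hy.1, fun z hz => ?_⟩
      rw [hxy, ← (hdist x hx).1]
      exact Metric.infDist_le_dist_of_mem hz
    exact (hdist x hx).2.unique hy' (surfaceProj_mem hdist hx)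

/-- The unit normal of `K` that points away from the projection to `K₀`. -/
noncomputable def projNormal (K₀ : Set E3) (r : ℝ) (x : E3) : E3 := r⁻¹ • (x - surfaceProj K₀ x)

theorem surfaceProj_eq {K₀ : Set E3} {r : ℝ} (hr : 0 < r) (x : E3) :
    x - r • projNormal K₀ r x = surfaceProj K₀ x := by
  rw [projNormal, smul_inv_smul₀ hr.ne', sub_sub_cancel]

theorem norm_projNormal {K K₀ : Set E3} {r : ℝ} (hr : 0 < r)
    (hdist : IsRegularConstantDistance K K₀ r) {x : E3} (hx : x ∈ K) : ‖projNormal K₀ r x‖ = 1 := by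
  rw [projNormal, norm_smul, ← dist_eq_norm, dist_surfaceProj hdist hx, norm_inv,
    Real.norm_of_nonneg hr.le, inv_mul_cancel₀ hr.ne']

theorem inner_projNormal_of_isTangentVector {K K₀ : Set E3} {r : ℝ}
    (hdist : IsRegularConstantDistance K K₀ r) {x v : E3} (hx : x ∈ K)
    (hv : IsTangentVector K x v) : inner ℝ (projNormal K₀ r x) v = 0 := by
  rw [projNormal, inner_smul_left, hv.inner_eq_zero_of_forall_dist_le, mul_zero]
  intro q hq
  rw [dist_surfaceProj hdist hx, ← (hdist q hq).1]
  exact Metric.infDist_le_dist_of_mem (surfaceProj_mem hdist hx).1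

theorem inner_projNormal_of_isTangentVector' {K K₀ : Set E3} {r : ℝ}
    (hdist : IsRegularConstantDistance K K₀ r) {x v : E3} (hx : x ∈ K)
    (hv : IsTangentVector K₀ (surfaceProj K₀ x) v) : inner ℝ (projNormal K₀ r x) v = 0 := by
  have h1 := hv.inner_eq_zero_of_forall_dist_le (y := x) fun q hq => by
    rw [dist_comm, dist_comm q]
    exact (surfaceProj_mem hdist hx).2 q hq
  rw [projNormal, inner_smul_left, ← neg_sub, inner_neg_left, h1, neg_zero, mul_zero]

/-- A `C²` surface has charts adapted to the normalized gradient of a defining function. -/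
theorem IsC2Surface.exists_chart {K : Set E3} (hK : IsC2Surface K) {p : E3} (hp : p ∈ K) :
    ∃ U f N, NormalChart K N U f N ∧ p ∈ U := by
  obtain ⟨U, hU, hpU, f, hf, hfp, hKU⟩ := hK p hp
  have hcont : ContinuousOn (fderiv ℝ f) U := hf.continuousOn_fderiv_of_isOpen hU (by norm_num)
  let V : Set E3 := U ∩ fderiv ℝ f ⁻¹' {0}ᶜ
  have hV : IsOpen V := hcont.isOpen_inter_preimage hU isOpen_compl_singleton
  let g : E3 → E3 := fun x => (InnerProductSpace.toDual ℝ E3).symm (fderiv ℝ f x)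
  have hg0 : ∀ x ∈ V, g x ≠ 0 := fun x hx h0 => hx.2 (by simpa [g] using h0)
  have hg : ContDiffOn ℝ 1 g V :=
    ((InnerProductSpace.toDual ℝ E3).symm.contDiff.comp_contDiffOn
      (hf.fderiv_of_isOpen hU (m := 1) (by norm_num))).mono inter_subset_left
  refine ⟨V, f, fun x => ‖g x‖⁻¹ • g x, ⟨hV, hf.mono inter_subset_left, ?_, ?_, ?_, ?_, ?_⟩,
    hpU, hfp⟩
  · exact ((hg.norm ℝ hg0).inv fun x hx => norm_ne_zero_iff.2 (hg0 x hx)).smul hg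
  · exact fun x hx => norm_smul_inv_norm (hg0 x hx)
  · intro x hx
    refine ⟨‖g x‖, norm_ne_zero_iff.2 (hg0 x hx), fun v => ?_⟩
    rw [real_inner_smul_left, mul_inv_cancel_left₀ (norm_ne_zero_iff.2 (hg0 x hx))]
    simp [g]
  · ext x
    constructor
    · rintro ⟨hxK, hxV⟩
      have : x ∈ K ∩ U := ⟨hxK, hxV.1⟩
      rw [hKU] at this
      exact ⟨hxV, this.2⟩
    · rintro ⟨hxV, hfx⟩
      have : x ∈ {x | x ∈ U ∧ f x = 0} := ⟨hxV.1, hfx⟩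
      rw [← hKU] at this
      exact ⟨this.1, hxV⟩
  · exact fun _ _ => rfl

/-- Every vector orthogonal to the normal is tangent to the surface. -/
theorem NormalChart.exists_curve {K U : Set E3} {n N : E3 → E3} {f : E3 → ℝ}
    (h : NormalChart K n U f N) {x v : E3} (hx : x ∈ U) (hxK : x ∈ K) (hv : ‖v‖ = 1)
    (hxv : inner ℝ (N x) v = 0) :
    ∃ γ T κ ε, 0 < ε ∧ NormalGeodesic K n γ T κ ε ∧ γ 0 = x ∧ T 0 = v := by
  obtain ⟨ρ, hρ, hgeo⟩ := h.exists_geodesic hx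
  obtain ⟨γ, T, κ, hγ, h0, h1, -⟩ := hgeo x ⟨hxK, Metric.mem_ball_self hρ⟩ v hv hxv
  exact ⟨γ, T, κ, ρ, hρ, hγ, h0, h1⟩

theorem NormalGeodesic.isTangentVector {K : Set E3} {γ T : ℝ → E3} {n : E3 → E3} {κ : ℝ → ℝ}
    {ε : ℝ} (h : NormalGeodesic K n γ T κ ε) (hε : 0 < ε) : IsTangentVector K (γ 0) (T 0) := by
  have h0 : (0 : ℝ) ∈ Ioo (-ε) ε := ⟨by linarith, hε⟩
  exact ⟨γ, rfl, h.eventually_mem h0, h.hasDerivAt 0 h0⟩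

theorem hasNormalCharts_projNormal {K K₀ : Set E3} {r : ℝ} (hr : 0 < r) (hK : IsC2Surface K)
    (hK₀ : IsClosed K₀) (hdist : IsRegularConstantDistance K K₀ r) :
    HasNormalCharts K (projNormal K₀ r) := by
  intro p hp
  obtain ⟨U, f, N, hc, hpU⟩ := hK.exists_chart hp
  set n := projNormal K₀ r with hn
  have hncont : ContinuousOn n K :=
    (continuousOn_id.sub (continuousOn_surfaceProj hK₀ hdist)).const_smul r⁻¹
  have hpar : ∀ x ∈ K ∩ U, n x = (inner ℝ (N x) (n x) : ℝ) • N x := by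
    intro x hx
    refine eq_inner_smul_of_forall_inner_eq_zero (hc.norm_N x hx.2) fun v hv hxv => ?_
    obtain ⟨γ, T, κ, ε, hε, hγ, rfl, rfl⟩ := hc.exists_curve hx.2 hx.1 hv hxv
    exact inner_projNormal_of_isTangentVector hdist hx.1 (hγ.isTangentVector hε)
  set s : ℝ := inner ℝ (N p) (n p) with hs
  have habs : ∀ x ∈ K ∩ U, |inner ℝ (N x) (n x)| = 1 := by
    intro x hx
    have h1 := congrArg norm (hpar x hx)
    rw [norm_smul, hc.norm_N x hx.2, mul_one, norm_projNormal hr hdist hx.1] at h1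
    exact h1.symm
  have hs1 : |s| = 1 := habs p ⟨hp, hpU⟩
  have hss : s * s = 1 := by rw [← abs_mul_abs_self, hs1, one_mul]
  have hev : ∀ᶠ x in 𝓝[K] p, 0 < s * inner ℝ (N x) (n x) := by
    have hNc : ContinuousWithinAt N K p :=
      (hc.differentiableAt_N hpU).continuousAt.continuousWithinAt
    have h1 : ContinuousWithinAt (fun x => s * inner ℝ (N x) (n x)) K p :=
      (hNc.inner (hncont p hp)).const_mul s
    refine h1.eventually_const_lt ?_
    change 0 < s * s
    rw [hss]; exact one_pos
  obtain ⟨V, hV, hpV, hVs⟩ := mem_nhdsWithin.1 hev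
  refine ⟨U ∩ V, f, fun x => s • N x, ⟨hc.isOpen.inter hV, hc.contDiff_f.mono inter_subset_left,
    (contDiff_const_smul s).comp_contDiffOn (hc.contDiff_N.mono inter_subset_left), fun x hx => ?_,
    fun x hx => ?_, ?_, fun x hx => ?_⟩, hpU, hpV⟩
  · rw [norm_smul, hc.norm_N x hx.1, Real.norm_eq_abs, hs1, one_mul]
  · obtain ⟨c, hc0, hcv⟩ := hc.fderiv_f x hx.1
    have hs0 : s ≠ 0 := fun h0 => by simp [h0] at hss
    refine ⟨c * s, mul_ne_zero hc0 hs0, fun v => ?_⟩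
    rw [hcv, real_inner_smul_left]
    linear_combination (- c * inner ℝ (N x) v) * hss
  · rw [← inter_assoc, hc.zero_set]
    ext x
    simp only [mem_inter_iff, mem_ofPred_eq]
    tauto
  · rw [hpar x ⟨hx.1, hx.2.1⟩]
    congr 1
    have h1 := habs x ⟨hx.1, hx.2.1⟩
    have h2 : 0 < s * inner ℝ (N x) (n x) := hVs ⟨hx.2.2, hx.1⟩
    rcases eq_or_eq_neg_of_abs_eq h1 with h3 | h3 <;>
      rcases eq_or_eq_neg_of_abs_eq hs1 with h4 | h4 <;>
      first | exact h3.trans h4.symm | (rw [h3, h4] at h2; norm_num at h2)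

theorem NormalGeodesic.isUnitSpeedGeodesicOn {K : Set E3} {n : E3 → E3}
    {γ T : ℝ → E3} {κ : ℝ → ℝ} {ε : ℝ} (hK : HasNormalCharts K n)
    (hn : ∀ x ∈ K, ∀ v, IsTangentVector K x v → inner ℝ (n x) v = 0)
    (h : NormalGeodesic K n γ T κ ε) : IsUnitSpeedGeodesicOn K γ (Ioo (-ε) ε) := by
  have hd : ∀ t ∈ Ioo (-ε) ε, deriv γ t = T t := fun t ht => (h.hasDerivAt t ht).deriv
  have hdd : ∀ t ∈ Ioo (-ε) ε, HasDerivAt (deriv γ) (-(κ t) • n (γ t)) t := fun t ht =>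
    (h.hasDerivAt_velocity t ht).congr_of_eventuallyEq (by
      filter_upwards [isOpen_Ioo.mem_nhds ht] with s hs using hd s hs)
  have hnγ : ContinuousOn (fun t => n (γ t)) (Ioo (-ε) ε) := by
    intro t ht
    obtain ⟨U, f, N, hc, hx⟩ := hK (γ t) (h.mem t ht)
    exact (hc.hasDerivAt_normal hx (h.eventually_mem ht)
      (h.hasDerivAt t ht)).continuousAt.continuousWithinAt
  refine ⟨?_, h.mem, fun t ht => by rw [hd t ht, h.norm_velocity t ht], fun t ht v hv => ?_⟩
  · rw [show (2 : WithTop ℕ∞) = 1 + 1 by norm_num,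
      contDiffOn_succ_iff_deriv_of_isOpen isOpen_Ioo]
    refine ⟨fun t ht => (h.hasDerivAt t ht).differentiableAt.differentiableWithinAt,
      by simp, ?_⟩
    rw [show (1 : WithTop ℕ∞) = 0 + 1 by norm_num,
      contDiffOn_succ_iff_deriv_of_isOpen isOpen_Ioo]
    refine ⟨fun t ht => (hdd t ht).differentiableAt.differentiableWithinAt, by simp, ?_⟩
    rw [contDiffOn_zero]
    exact (h.continuousOn.neg.smul hnγ).congr fun t ht => (hdd t ht).deriv
  · rw [(hdd t ht).deriv, inner_smul_left, hn _ (h.mem t ht) v hv, mul_zero]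

theorem IsUnitSpeedGeodesicOn.hasDerivAt {S : Set E3} {γ : ℝ → E3} {J : Set ℝ}
    (h : IsUnitSpeedGeodesicOn S γ J) (hJ : IsOpen J) {t : ℝ} (ht : t ∈ J) :
    HasDerivAt γ (deriv γ t) t :=
  ((h.contDiffOn.contDiffAt (hJ.mem_nhds ht)).differentiableAt two_ne_zero).hasDerivAt

theorem IsUnitSpeedGeodesicOn.hasDerivAt_deriv {S : Set E3} {γ : ℝ → E3} {J : Set ℝ}
    (h : IsUnitSpeedGeodesicOn S γ J) (hJ : IsOpen J) {t : ℝ} (ht : t ∈ J) :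
    HasDerivAt (deriv γ) (deriv (deriv γ) t) t :=
  (((contDiffOn_succ_iff_deriv_of_isOpen (n := 1) hJ).1 h.contDiffOn).2.2.differentiableOn
    one_ne_zero |>.differentiableAt (hJ.mem_nhds ht)).hasDerivAt

theorem IsUnitSpeedGeodesicOn.isTangentVector {S : Set E3} {γ : ℝ → E3} {J : Set ℝ}
    (h : IsUnitSpeedGeodesicOn S γ J) (hJ : IsOpen J) {t : ℝ} (ht : t ∈ J) :
    IsTangentVector S (γ t) (deriv γ t) := by
  have hcont : Tendsto (fun s => t + s) (𝓝 0) (𝓝 t) := by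
    have : Continuous fun s : ℝ => t + s := by fun_prop
    simpa using this.tendsto 0
  refine ⟨fun s => γ (t + s), by beta_reduce; rw [add_zero], ?_, ?_⟩
  · filter_upwards [hcont.eventually (hJ.mem_nhds ht)] with s hs using h.mem _ hs
  · have := h.hasDerivAt hJ ht
    rw [← add_zero t] at this
    simpa using this.comp_const_add t 0

/-- The projected geodesic is a reparametrization of a unit speed geodesic of the other surface. -/
theorem NormalGeodesic.exists_image {K K₀ : Set E3} {r : ℝ} (hr : 0 < r) (hK : IsC2Surface K)
    (hK₀ : IsClosed K₀) (hdist : IsRegularConstantDistance K K₀ r)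
    (hproj : ProjPreservesGeodesics K K₀) {γ T : ℝ → E3} {κ : ℝ → ℝ} {ε : ℝ}
    (h : NormalGeodesic K (projNormal K₀ r) γ T κ ε) :
    ∃ (J : Set ℝ) (η : ℝ → E3) (s : ℝ → ℝ), IsOpen J ∧ IsUnitSpeedGeodesicOn K₀ η J ∧
      ∀ t ∈ Ioo (-ε) ε, s t ∈ J ∧ surfaceProj K₀ (γ t) = η (s t) ∧ deriv s t ≠ 0 ∧
        HasDerivAt s (deriv s t) t ∧
        HasDerivAt (fun τ => γ τ - r • projNormal K₀ r (γ τ)) (deriv s t • deriv η (s t)) t := by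
  have hgeo := h.isUnitSpeedGeodesicOn (hasNormalCharts_projNormal hr hK hK₀ hdist)
    fun x hx v hv => inner_projNormal_of_isTangentVector hdist hx hv
  obtain ⟨J, η, s, hJ, -, hη, hs, hs0, hmaps, heq⟩ := hproj (Ioo (-ε) ε) γ isOpen_Ioo
    ordConnected_Ioo ⟨Ioo (-ε) ε, γ, id, isOpen_Ioo, ordConnected_Ioo, hgeo, contDiffOn_id,
      fun t _ => by simp, mapsTo_id _, fun _ _ => rfl⟩
  refine ⟨J, η, s, hJ, hη, fun t ht => ?_⟩
  have hst : HasDerivAt s (deriv s t) t :=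
    ((hs.contDiffAt (isOpen_Ioo.mem_nhds ht)).differentiableAt one_ne_zero).hasDerivAt
  refine ⟨hmaps ht, heq ht, hs0 t ht, hst,
    ((hη.hasDerivAt hJ (hmaps ht)).scomp t hst).congr_of_eventuallyEq ?_⟩
  filter_upwards [isOpen_Ioo.mem_nhds ht] with τ hτ
  rw [surfaceProj_eq hr]
  exact heq hτ

/-- The projection is immersive, and so the tangent plane of `K₀` at the projection of `x` contains
every vector orthogonal to the normal at `x`. -/
theorem isTangentVector_surfaceProj {K K₀ : Set E3} {r : ℝ} (hr : 0 < r) (hK : IsC2Surface K)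
    (hK₀ : IsClosed K₀) (hdist : IsRegularConstantDistance K K₀ r)
    (hproj : ProjPreservesGeodesics K K₀) {x w : E3} (hx : x ∈ K)
    (hw : inner ℝ (projNormal K₀ r x) w = 0) : IsTangentVector K₀ (surfaceProj K₀ x) w := by
  have hch := hasNormalCharts_projNormal hr hK hK₀ hdist
  obtain ⟨U, f, N, hc, hxU⟩ := hch x hx
  have hnx := hc.eq_n x ⟨hx, hxU⟩
  have hunit : ∀ v : E3, ‖v‖ = 1 → inner ℝ (N x) v = 0 →
      IsTangentVector K₀ (surfaceProj K₀ x) (v - r • fderiv ℝ N x v) ∧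
        v - r • fderiv ℝ N x v ≠ 0 := by
    intro v hv hxv
    obtain ⟨γ, T, κ, ε, hε, hγ, rfl, rfl⟩ := hc.exists_curve hxU hx hv hxv
    have h0 : (0 : ℝ) ∈ Ioo (-ε) ε := ⟨by linarith, hε⟩
    have hd : HasDerivAt (fun τ => γ τ - r • projNormal K₀ r (γ τ))
        (T 0 - r • fderiv ℝ N (γ 0) (T 0)) 0 :=
      (hγ.hasDerivAt 0 h0).sub ((hc.hasDerivAt_normal hxU (hγ.eventually_mem h0)
        (hγ.hasDerivAt 0 h0)).const_smul r)
    refine ⟨⟨_, surfaceProj_eq hr _, ?_, hd⟩, ?_⟩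
    · filter_upwards [hγ.eventually_mem h0] with t ht
      rw [surfaceProj_eq hr]
      exact (surfaceProj_mem hdist ht).1
    · obtain ⟨J, η, s, hJ, hη, h⟩ := hγ.exists_image hr hK hK₀ hdist hproj
      obtain ⟨hsJ, -, hs0, -, hd'⟩ := h 0 h0
      rw [hd.unique hd']
      refine smul_ne_zero hs0 fun h0 => ?_
      have := hη.unit_speed _ hsJ
      rw [h0, norm_zero] at this
      exact zero_ne_one this
  have hall : ∀ v : E3, inner ℝ (N x) v = 0 →
      IsTangentVector K₀ (surfaceProj K₀ x) (v - r • fderiv ℝ N x v) ∧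
        (v - r • fderiv ℝ N x v = 0 → v = 0) := by
    intro v hxv
    by_cases hv : v = 0
    · subst hv
      refine ⟨?_, fun _ => rfl⟩
      rw [map_zero, smul_zero, sub_zero]
      refine ⟨fun _ => surfaceProj K₀ x, rfl, ?_, hasDerivAt_const _ _⟩
      exact Eventually.of_forall fun _ => (surfaceProj_mem hdist hx).1
    · obtain ⟨h1, h2⟩ := hunit (‖v‖⁻¹ • v) (norm_smul_inv_norm hv)
        (by rw [inner_smul_right, hxv, mul_zero])
      rw [map_smul, smul_comm, ← smul_sub] at h1 h2
      refine ⟨?_, fun h3 => absurd (by rw [h3, smul_zero]) h2⟩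
      have := h1.smul ‖v‖
      rwa [smul_inv_smul₀ (norm_ne_zero_iff.2 hv)] at this
  -- `L` is the differential of the projection on the tangent plane and the identity on the normal.
  let P : E3 →ₗ[ℝ] E3 :=
    LinearMap.id - ((innerSL ℝ (N x)).smulRight (N x) : E3 →L[ℝ] E3).toLinearMap
  have hP : ∀ v, P v = v - (inner ℝ (N x) v : ℝ) • N x := fun v => rfl
  let L : E3 →ₗ[ℝ] E3 := LinearMap.id - r • (fderiv ℝ N x).toLinearMap ∘ₗ P
  have hL : ∀ v, L v = v - r • fderiv ℝ N x (P v) := fun v => rfl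
  have hNL : ∀ v, inner ℝ (N x) (L v) = (inner ℝ (N x) v : ℝ) := by
    intro v
    rw [hL, inner_sub_right, inner_smul_right, hc.inner_fderiv hxU, mul_zero, sub_zero]
  have hP' : ∀ v, inner ℝ (N x) v = 0 → P v = v := by
    intro v hv
    rw [hP, hv, zero_smul, sub_zero]
  have hinj : Function.Injective L := by
    rw [← LinearMap.ker_eq_bot, LinearMap.ker_eq_bot']
    intro v hv
    have h1 : inner ℝ (N x) v = (0 : ℝ) := by rw [← hNL, hv, inner_zero_right]
    rw [hL, hP' v h1] at hv
    exact (hall v h1).2 hv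
  obtain ⟨v, hv⟩ := LinearMap.injective_iff_surjective.1 hinj w
  rw [hnx, ← hv, hNL] at hw
  rw [← hv, hL, hP' v hw]
  exact (hall v hw).1

theorem parallelTangents_projNormal {K K₀ : Set E3} {r : ℝ} (hr : 0 < r) (hK : IsC2Surface K)
    (hK₀ : IsClosed K₀) (hdist : IsRegularConstantDistance K K₀ r)
    (hproj : ProjPreservesGeodesics K K₀) : ParallelTangents K (projNormal K₀ r) r := by
  intro ε γ T κ hγ
  obtain ⟨J, η, s, hJ, hη, h⟩ := hγ.exists_image hr hK hK₀ hdist hproj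
  refine ⟨fun t => deriv η (s t), fun t => deriv s t,
    fun t => inner ℝ (projNormal K₀ r (γ t)) (deriv s t • deriv (deriv η) (s t)), fun t ht => ?_⟩
  obtain ⟨hsJ, heq, hs0, hst, hd⟩ := h t ht
  have hγK := hγ.mem t ht
  refine ⟨hη.unit_speed _ hsJ, hs0, ?_, ?_, hd⟩
  · refine inner_projNormal_of_isTangentVector' hdist hγK ?_
    rw [heq]
    exact hη.isTangentVector hJ hsJ
  · have h2 := (hη.hasDerivAt_deriv hJ hsJ).scomp t hst
    have h3 : deriv s t • deriv (deriv η) (s t) =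
        (inner ℝ (projNormal K₀ r (γ t)) (deriv s t • deriv (deriv η) (s t)) : ℝ) •
          projNormal K₀ r (γ t) := by
      refine eq_inner_smul_of_forall_inner_eq_zero (norm_projNormal hr hdist hγK) fun v _ hv => ?_
      rw [inner_smul_left, hη.normal _ hsJ v, mul_zero]
      rw [← heq]
      exact isTangentVector_surfaceProj hr hK hK₀ hdist hproj hγK hv
    rw [h3] at h2
    exact h2

section

/-! ### Principal directions along geodesics -/

theorem eq_sum_of_orthonormal {a b c : E3} (ha : ‖a‖ = 1) (hb : ‖b‖ = 1) (hc : ‖c‖ = 1)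
    (hab : inner ℝ a b = 0) (hac : inner ℝ a c = 0) (hbc : inner ℝ b c = 0) (x : E3) :
    x = (inner ℝ a x : ℝ) • a + (inner ℝ b x : ℝ) • b + (inner ℝ c x : ℝ) • c := by
  have hon : Orthonormal ℝ ![a, b, c] := by
    refine ⟨fun i => ?_, fun i j hij => ?_⟩
    · fin_cases i <;> simpa
    · fin_cases i <;> fin_cases j <;> simp_all [real_inner_comm]
  have hcard : Fintype.card (Fin 3) = Module.finrank ℝ E3 := by simp
  let B := (basisOfOrthonormalOfCardEqFinrank hon hcard).toOrthonormalBasis (by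
    rw [coe_basisOfOrthonormalOfCardEqFinrank]; exact hon)
  have hB : ⇑B = ![a, b, c] := by simp [B]
  have := B.sum_repr' x
  rw [Fin.sum_univ_three, hB] at this
  simpa using this.symm

theorem exists_unit_orthogonal (a b : E3) :
    ∃ e : E3, ‖e‖ = 1 ∧ inner ℝ a e = 0 ∧ inner ℝ b e = 0 := by
  classical
  have hne : (Submodule.span ℝ (({a, b} : Finset E3) : Set E3))ᗮ ≠ ⊥ := by
    intro hbot
    have h1 := Submodule.finrank_add_finrank_orthogonal
      (Submodule.span ℝ (({a, b} : Finset E3) : Set E3))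
    have h2 := (finrank_span_finset_le_card (R := ℝ) ({a, b} : Finset E3)).trans Finset.card_le_two
    rw [hbot, finrank_bot, finrank_euclideanSpace_fin] at h1
    rw [Set.finrank] at h2
    omega
  obtain ⟨e, he, he0⟩ := Submodule.exists_mem_ne_zero_of_ne_bot hne
  rw [Submodule.mem_orthogonal] at he
  refine ⟨‖e‖⁻¹ • e, norm_smul_inv_norm he0, ?_, ?_⟩
  · rw [inner_smul_right, he a (Submodule.subset_span (by simp)), mul_zero]
  · rw [inner_smul_right, he b (Submodule.subset_span (by simp)), mul_zero]

variable {K U : Set E3} {n N : E3 → E3} {f : E3 → ℝ} {r : ℝ} {γ T : ℝ → E3} {κ : ℝ → ℝ} {ε : ℝ}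

namespace NormalGeodesic

/-- A geodesic that starts in a principal direction is a line of curvature: its unit tangent and
that of the projected curve are both parallel along it, so they stay equal up to sign. -/
theorem hasDerivAt_normal_of_principal (hr : r ≠ 0) (hK : HasNormalCharts K n)
    (hP : ParallelTangents K n r) (h : NormalGeodesic K n γ T κ ε) {k : ℝ}
    (hk : HasDerivAt (fun s => n (γ s)) (k • T 0) 0) {t : ℝ} (ht : t ∈ Ioo (-ε) ε) :
    HasDerivAt (fun s => n (γ s)) (κ t • T t) t := by
  obtain ⟨u, σ, μ, hu⟩ := hP ε γ T κ h
  have h0 : (0 : ℝ) ∈ Ioo (-ε) ε := by constructor <;> linarith [ht.1, ht.2]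
  have hconst : inner ℝ (T t) (u t) = (inner ℝ (T 0) (u 0) : ℝ) := by
    refine eq_of_hasDerivAt_zero_Ioo (g := fun s => inner ℝ (T s) (u s)) (fun s hs => ?_) ht
    obtain ⟨-, -, hnu, hdu, -⟩ := hu s hs
    refine ((h.hasDerivAt_velocity s hs).inner ℝ hdu).congr_deriv ?_
    rw [inner_smul_right, inner_smul_left, hnu, real_inner_comm, h.inner_normal hK hs]
    simp
  obtain ⟨hu0, hσ0, -, -, hd0⟩ := hu 0 h0
  obtain ⟨hut, -, -, -, hdt⟩ := hu t ht
  have h1 : σ 0 • u 0 = (1 - r * k) • T 0 := by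
    rw [hd0.unique ((h.hasDerivAt 0 h0).sub (hk.const_smul r)), sub_smul, one_smul, smul_smul]
  obtain ⟨a, ha⟩ : ∃ a : ℝ, u 0 = a • T 0 := ⟨(σ 0)⁻¹ * (1 - r * k), by
    rw [mul_smul, ← h1, inv_smul_smul₀ hσ0]⟩
  have hT0 := h.norm_velocity 0 h0
  have haa : a * a = 1 := by
    have h2 := congrArg norm ha
    rw [hu0, norm_smul, hT0, mul_one, Real.norm_eq_abs] at h2
    rw [← abs_mul_abs_self, ← h2, one_mul]
  have hTu : inner ℝ (T t) (u t) = a := by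
    rw [hconst, ha, inner_smul_right, real_inner_self_eq_norm_sq, hT0]; simp
  have hua : u t = a • T t := by
    rw [← sub_eq_zero, ← norm_eq_zero, ← sq_eq_zero_iff, norm_sub_sq_real, inner_smul_right,
      real_inner_comm, hTu, hut, norm_smul, h.norm_velocity t ht, Real.norm_eq_abs, mul_one, sq_abs]
    linarith
  have hd : HasDerivAt (fun s => n (γ s)) ((r⁻¹ * (1 - σ t * a)) • T t) t := by
    have h2 := ((h.hasDerivAt t ht).sub hdt).const_smul r⁻¹
    refine (h2.congr_deriv ?_).congr_of_eventuallyEq (Eventually.of_forall fun s => ?_)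
    · rw [hua, mul_smul, sub_smul, one_smul, smul_smul (σ t)]
    · simp [smul_smul, inv_mul_cancel₀ hr]
  have h3 := h.inner_deriv_normal hK ht hd
  rw [inner_smul_left, real_inner_self_eq_norm_sq, h.norm_velocity t ht] at h3
  simp only [conj_trivial, one_pow, mul_one] at h3
  rwa [h3] at hd

/-- A geodesic line of curvature stays in a plane, in which its normals are contained too. -/
theorem inner_binormal (hr : r ≠ 0) (hK : HasNormalCharts K n)
    (hP : ParallelTangents K n r) (h : NormalGeodesic K n γ T κ ε) {k : ℝ}
    (hk : HasDerivAt (fun s => n (γ s)) (k • T 0) 0) {w : E3} (hTw : inner ℝ (T 0) w = 0)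
    (hnw : inner ℝ (n (γ 0)) w = 0) {t : ℝ} (ht : t ∈ Ioo (-ε) ε) :
    inner ℝ (T t) w = 0 ∧ inner ℝ (n (γ t)) w = 0 := by
  have hconst := eq_of_hasDerivAt_zero_Ioo (t := t) (ε := ε)
    (g := fun s => (inner ℝ (T s) w : ℝ) ^ 2 + (inner ℝ (n (γ s)) w : ℝ) ^ 2) (fun s hs => by
      have h1 := (h.hasDerivAt_velocity s hs).inner ℝ (hasDerivAt_const s w)
      have h2 := (h.hasDerivAt_normal_of_principal hr hK hP hk hs).inner ℝ (hasDerivAt_const s w)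
      refine ((h1.pow 2).add (h2.pow 2)).congr_deriv ?_
      simp only [inner_zero_right, inner_smul_left, conj_trivial]
      ring) ht
  simp only [hTw, hnw] at hconst
  constructor <;> nlinarith [sq_nonneg (inner ℝ (T t) w : ℝ), sq_nonneg (inner ℝ (n (γ t)) w : ℝ)]

theorem fderiv_velocity_of_principal (hr : r ≠ 0) (hK : HasNormalCharts K n)
    (hP : ParallelTangents K n r) (hc : NormalChart K n U f N) (h : NormalGeodesic K n γ T κ ε)
    {k : ℝ} (hk : HasDerivAt (fun s => n (γ s)) (k • T 0) 0) {t : ℝ} (ht : t ∈ Ioo (-ε) ε)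
    (hU : γ t ∈ U) : fderiv ℝ N (γ t) (T t) = κ t • T t :=
  (hc.hasDerivAt_normal hU (h.eventually_mem ht) (h.hasDerivAt t ht)).unique
    (h.hasDerivAt_normal_of_principal hr hK hP hk ht)

theorem fderiv_binormal (hr : r ≠ 0) (hK : HasNormalCharts K n)
    (hP : ParallelTangents K n r) (hc : NormalChart K n U f N) (h : NormalGeodesic K n γ T κ ε)
    {k : ℝ} (hk : HasDerivAt (fun s => n (γ s)) (k • T 0) 0) {w : E3} (hw : ‖w‖ = 1)
    (hTw : inner ℝ (T 0) w = 0) (hnw : inner ℝ (n (γ 0)) w = 0) {t : ℝ} (ht : t ∈ Ioo (-ε) ε)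
    (hU : γ t ∈ U) : ∃ m : ℝ, fderiv ℝ N (γ t) w = m • w := by
  obtain ⟨h1, h2⟩ := h.inner_binormal hr hK hP hk hTw hnw ht
  have h3 := h.inner_normal hK ht
  rw [hc.eq_n _ ⟨h.mem t ht, hU⟩] at h2 h3
  have h4 : inner ℝ (T t) (fderiv ℝ N (γ t) w) = 0 := by
    rw [← hc.fderiv_symm hU h3 h2, h.fderiv_velocity_of_principal hr hK hP hc hk ht hU,
      inner_smul_left, h1, mul_zero]
  have h5 := eq_sum_of_orthonormal (h.norm_velocity t ht) (hc.norm_N _ hU) hw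
    (by rw [real_inner_comm]; exact h3) h1 h2 (fderiv ℝ N (γ t) w)
  rw [h4, hc.inner_fderiv hU, zero_smul, zero_smul, zero_add, zero_add] at h5
  exact ⟨_, h5⟩

/-- Along a line of curvature of curvature bounded away from zero, the normal rotates in a plane
at a definite speed and attains all values close to its initial value. -/
theorem exists_normal_eq (hr : r ≠ 0) (hK : HasNormalCharts K n)
    (hP : ParallelTangents K n r) (h : NormalGeodesic K n γ T κ ε) (hε : 0 < ε) {k : ℝ}
    (hk : HasDerivAt (fun s => n (γ s)) (k • T 0) 0) {w : E3} (hw : ‖w‖ = 1)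
    (hTw : inner ℝ (T 0) w = 0) (hnw : inner ℝ (n (γ 0)) w = 0) {c σ : ℝ} (hc : 0 < c)
    (hκ : ∀ t ∈ Ioo (-ε) ε, c ≤ σ * κ t) {ν : E3} (hν : ‖ν‖ = 1) (hwν : inner ℝ w ν = 0)
    (hnν : ∀ t ∈ Ioo (-ε) ε, 1 / 4 ≤ (inner ℝ (n (γ t)) ν : ℝ))
    (hsmall : |σ * inner ℝ (T 0) ν| < c / 4 * (ε / 2)) :
    ∃ t ∈ Ioo (-ε) ε, n (γ t) = ν := by
  let g : ℝ → ℝ := fun t => σ * inner ℝ (T t) ν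
  have hg : ∀ t ∈ Ioo (-ε) ε, HasDerivAt g (-(σ * κ t * inner ℝ (n (γ t)) ν)) t := by
    intro t ht
    refine (((h.hasDerivAt_velocity t ht).inner ℝ (hasDerivAt_const t ν)).const_mul σ).congr_deriv
      ?_
    simp only [inner_zero_right, inner_smul_left, conj_trivial]
    ring
  have hsub : Icc (-(ε / 2)) (ε / 2) ⊆ Ioo (-ε) ε := fun t ht =>
    ⟨by linarith [ht.1], by linarith [ht.2]⟩
  -- `g` decreases with slope at least `c / 4`, so it vanishes somewhere, and there `ν ⟂ T`.
  have hanti : AntitoneOn (fun t => g t + c / 4 * t) (Icc (-(ε / 2)) (ε / 2)) := by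
    have hd : ∀ t ∈ Ioo (-ε) ε, HasDerivAt (fun t => g t + c / 4 * t)
        (-(σ * κ t * inner ℝ (n (γ t)) ν) + c / 4) t := fun t ht => by
      have := (hg t ht).add ((hasDerivAt_id t).const_mul (c / 4))
      rw [mul_one] at this
      exact this
    refine antitoneOn_of_deriv_nonpos (convex_Icc _ _)
      (fun t ht => (hd t (hsub ht)).continuousAt.continuousWithinAt)
      (fun t ht => (hd t (hsub (interior_subset ht))).differentiableAt.differentiableWithinAt)
      fun t ht => ?_
    have ht' := hsub (interior_subset ht)
    rw [(hd t ht').deriv]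
    nlinarith [hκ t ht', hnν t ht']
  have hm0 : (0 : ℝ) ∈ Icc (-(ε / 2)) (ε / 2) := ⟨by linarith, by linarith⟩
  have hm1 : ε / 2 ∈ Icc (-(ε / 2)) (ε / 2) := ⟨by linarith, le_rfl⟩
  have hm2 : -(ε / 2) ∈ Icc (-(ε / 2)) (ε / 2) := ⟨le_rfl, by linarith⟩
  have h1 := hanti hm0 hm1 hm0.2
  have h2 := hanti hm2 hm0 hm0.1
  simp only [mul_zero, add_zero] at h1 h2
  obtain ⟨hs1, hs2⟩ := abs_lt.1 hsmall
  have hgc : ContinuousOn g (Icc (-(ε / 2)) (ε / 2)) := fun t ht =>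
    (hg t (hsub ht)).continuousAt.continuousWithinAt
  obtain ⟨t, ht, hgt⟩ := intermediate_value_Icc' (by linarith : -(ε / 2) ≤ ε / 2) hgc
    (show (0 : ℝ) ∈ Icc (g (ε / 2)) (g (-(ε / 2))) from
      ⟨by simp only [g] at *; linarith, by simp only [g] at *; linarith⟩)
  have ht' := hsub ht
  refine ⟨t, ht', ?_⟩
  have hσ : σ ≠ 0 := fun h0 => by
    have := hκ t ht'
    rw [h0, zero_mul] at this
    linarith
  have hTν : inner ℝ (T t) ν = 0 := (mul_eq_zero.1 hgt).resolve_left hσ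
  obtain ⟨h3, h4⟩ := h.inner_binormal hr hK hP hk hTw hnw ht'
  have h5 := eq_sum_of_orthonormal (h.norm_velocity t ht') hw (h.norm_normal hK ht') h3
    (by rw [real_inner_comm]; exact h.inner_normal hK ht') (by rw [real_inner_comm]; exact h4) ν
  rw [hTν, hwν, zero_smul, zero_smul, zero_add, zero_add] at h5
  have h6 := congrArg norm h5
  rw [hν, norm_smul, h.norm_normal hK ht', mul_one,
    Real.norm_of_nonneg (by linarith [hnν t ht'])] at h6
  rw [h5, ← h6, one_smul]

end NormalGeodesic

end

section

variable {K U : Set E3} {n N : E3 → E3} {f : E3 → ℝ} {r : ℝ}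

/-! ### Elliptic points -/

/-- The form `σ II` is positive definite at `x`, where `II` is the second fundamental form with
respect to the unit normal field `N`. -/
def IsEllipticAt (N : E3 → E3) (σ : ℝ) (x : E3) : Prop :=
  ∀ v : E3, v ≠ 0 → inner ℝ (N x) v = 0 → 0 < σ * inner ℝ (fderiv ℝ N x v) v

namespace NormalChart

theorem eventually_le_of_isEllipticAt (h : NormalChart K n U f N) {σ : ℝ} {x₀ : E3} (hx₀ : x₀ ∈ U)
    (hell : IsEllipticAt N σ x₀) :
    ∃ c > 0, ∀ᶠ x in 𝓝 x₀, ∀ v : E3, ‖v‖ = 1 → inner ℝ (N x) v = 0 →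
      c ≤ σ * inner ℝ (fderiv ℝ N x v) v := by
  let P : E3 × E3 → E3 := fun z => z.2 - (inner ℝ (N z.1) z.2 : ℝ) • N z.1
  let Q : E3 × E3 → ℝ := fun z => σ * inner ℝ (fderiv ℝ N z.1 (P z)) (P z) +
    (inner ℝ (N z.1) z.2 : ℝ) ^ 2
  have hmaps : MapsTo (Prod.fst : E3 × E3 → E3) (U ×ˢ univ) U := fun z hz => hz.1
  have hN : ContinuousOn (fun z : E3 × E3 => N z.1) (U ×ˢ univ) :=
    h.contDiff_N.continuousOn.comp continuousOn_fst hmaps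
  have hNv : ContinuousOn (fun z : E3 × E3 => (inner ℝ (N z.1) z.2 : ℝ)) (U ×ˢ univ) :=
    hN.inner continuousOn_snd
  have hP : ContinuousOn P (U ×ˢ univ) := continuousOn_snd.sub (hNv.smul hN)
  have hQ : ContinuousOn Q (U ×ˢ univ) :=
    (continuousOn_const.mul (((h.continuousOn_fderiv.comp continuousOn_fst hmaps).clm_apply
      hP).inner hP)).add (hNv.pow 2)
  have hpos : ∀ v ∈ Metric.sphere (0 : E3) 1, 0 < Q (x₀, v) := by
    intro v hv
    have hv0 : v ≠ 0 := fun h0 => by simp [h0] at hv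
    by_cases hP0 : P (x₀, v) = 0
    · have hne : inner ℝ (N x₀) v ≠ (0 : ℝ) := by
        intro h0
        simp only [P, h0, zero_smul, sub_zero] at hP0
        exact hv0 hP0
      simp only [Q, hP0, map_zero, inner_zero_right, mul_zero, zero_add]
      positivity
    · have h1 : inner ℝ (N x₀) (P (x₀, v)) = 0 := by
        simp only [P, inner_sub_right, inner_smul_right, h.inner_self hx₀]; ring
      have h2 := hell _ hP0 h1
      simp only [Q]
      positivity
  have hQ0 : ContinuousOn (fun v => Q (x₀, v)) (Metric.sphere (0 : E3) 1) :=
    hQ.comp (by fun_prop) fun v _ => ⟨hx₀, mem_univ _⟩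
  have hne : (Metric.sphere (0 : E3) 1).Nonempty := NormedSpace.sphere_nonempty.2 zero_le_one
  obtain ⟨v₀, hv₀, hmin⟩ := (isCompact_sphere (0 : E3) 1).exists_isMinOn hne hQ0
  refine ⟨Q (x₀, v₀) / 2, half_pos (hpos v₀ hv₀), ?_⟩
  have hev : ∀ᶠ x in 𝓝 x₀, ∀ v ∈ Metric.sphere (0 : E3) 1, Q (x₀, v₀) / 2 < Q (x, v) := by
    refine (isCompact_sphere (0 : E3) 1).eventually_forall_of_forall_eventually fun v hv => ?_
    have hcont : ContinuousAt Q (x₀, v) :=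
      hQ.continuousAt ((h.isOpen.prod isOpen_univ).mem_nhds ⟨hx₀, mem_univ _⟩)
    have hle : Q (x₀, v₀) ≤ Q (x₀, v) := hmin hv
    exact hcont.eventually_const_lt (by linarith [hpos v₀ hv₀])
  filter_upwards [hev] with x hx v hv hxv
  have := hx v (by simpa using hv)
  simp only [Q, P, hxv, zero_smul, sub_zero] at this ⊢
  linarith

theorem eventually_isEllipticAt (h : NormalChart K n U f N) {σ : ℝ} {x₀ : E3} (hx₀ : x₀ ∈ U)
    (hell : IsEllipticAt N σ x₀) : ∀ᶠ x in 𝓝 x₀, IsEllipticAt N σ x := by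
  obtain ⟨c, hc, hev⟩ := h.eventually_le_of_isEllipticAt hx₀ hell
  filter_upwards [hev] with x hx v hv hxv
  have h1 := hx (‖v‖⁻¹ • v) (norm_smul_inv_norm hv) (by rw [inner_smul_right, hxv, mul_zero])
  rw [map_smul, inner_smul_left, inner_smul_right, conj_trivial] at h1
  have h2 : 0 < ‖v‖⁻¹ * ‖v‖⁻¹ := by positivity
  have h3 : σ * (‖v‖⁻¹ * (‖v‖⁻¹ * inner ℝ (fderiv ℝ N x v) v)) =
    (‖v‖⁻¹ * ‖v‖⁻¹) * (σ * inner ℝ (fderiv ℝ N x v) v) := by ring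
  rw [h3] at h1
  exact (mul_pos_iff_of_pos_left h2).1 (hc.trans_le h1)

/-- The Gauss map is injective near an elliptic point, since `N + f N(x₀)` is a local
diffeomorphism there. -/
theorem eventually_injOn_of_isEllipticAt (h : NormalChart K n U f N) {σ : ℝ} {x₀ : E3}
    (hx₀ : x₀ ∈ U) (hell : IsEllipticAt N σ x₀) :
    ∃ V ∈ 𝓝 x₀, V ⊆ U ∧ ∀ x ∈ K ∩ V, ∀ y ∈ K ∩ V, N x = N y → x = y := by
  obtain ⟨c, hc0, hc⟩ := h.fderiv_f x₀ hx₀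
  have hUx := h.isOpen.mem_nhds hx₀
  let G : E3 → E3 := fun x => N x + f x • N x₀
  have hG : ContDiffAt ℝ 1 G x₀ :=
    (h.contDiff_N.contDiffAt hUx).add
      (((h.contDiff_f.contDiffAt hUx).of_le (by norm_num)).smul contDiffAt_const)
  have hd : HasFDerivAt G (fderiv ℝ N x₀ + (fderiv ℝ f x₀).smulRight (N x₀)) x₀ :=
    (h.hasFDerivAt_N hx₀).add ((h.hasFDerivAt_f hx₀).smul_const (N x₀))
  have hker : LinearMap.ker (fderiv ℝ N x₀ + (fderiv ℝ f x₀).smulRight (N x₀)).toLinearMap = ⊥ := by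
    rw [LinearMap.ker_eq_bot']
    intro v hv
    have hv' : fderiv ℝ N x₀ v + (c * inner ℝ (N x₀) v : ℝ) • N x₀ = 0 := by
      rw [← hc]; exact hv
    have h1 : inner ℝ (N x₀) v = 0 := by
      have := congrArg (fun z => (inner ℝ (N x₀) z : ℝ)) hv'
      simp only [inner_add_right, h.inner_fderiv hx₀, inner_smul_right, h.inner_self hx₀,
        inner_zero_right, zero_add, mul_one] at this
      exact (mul_eq_zero.1 this).resolve_left hc0
    rw [h1, mul_zero, zero_smul, add_zero] at hv'
    by_contra hne
    have := hell v hne h1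
    rw [hv', inner_zero_left, mul_zero] at this
    exact lt_irrefl _ this
  let e : E3 ≃L[ℝ] E3 := (LinearEquiv.ofInjectiveEndo _
    (LinearMap.ker_eq_bot.1 hker)).toContinuousLinearEquiv
  have he : (e : E3 →L[ℝ] E3) = fderiv ℝ N x₀ + (fderiv ℝ f x₀).smulRight (N x₀) := by
    ext v; rfl
  have hs : HasStrictFDerivAt G (e : E3 →L[ℝ] E3) x₀ :=
    hG.hasStrictFDerivAt' (by rw [he]; exact hd) one_ne_zero
  let Φ := hs.toOpenPartialHomeomorph G
  refine ⟨Φ.source ∩ U, inter_mem (Φ.open_source.mem_nhds hs.mem_toOpenPartialHomeomorph_source)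
    hUx, inter_subset_right, fun x hx y hy hxy => ?_⟩
  refine Φ.injOn hx.2.1 hy.2.1 ?_
  rw [HasStrictFDerivAt.toOpenPartialHomeomorph_coe]
  simp only [G, h.f_eq_zero hx.2.2 hx.1, h.f_eq_zero hy.2.2 hy.1, hxy]

/-- The principal directions at a point. -/
theorem exists_principal (h : NormalChart K n U f N) {x : E3} (hx : x ∈ U) :
    ∃ (e₁ e₂ : E3) (k₁ k₂ : ℝ), ‖e₁‖ = 1 ∧ ‖e₂‖ = 1 ∧ inner ℝ e₁ e₂ = 0 ∧
      inner ℝ (N x) e₁ = 0 ∧ inner ℝ (N x) e₂ = 0 ∧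
      fderiv ℝ N x e₁ = k₁ • e₁ ∧ fderiv ℝ N x e₂ = k₂ • e₂ := by
  have hN0 : N x ≠ 0 := fun h0 => by
    have := h.norm_N x hx
    rw [h0, norm_zero] at this
    exact zero_ne_one this
  let W : Submodule ℝ E3 := (ℝ ∙ N x)ᗮ
  have hW : ∀ v, v ∈ W ↔ inner ℝ (N x) v = 0 := fun v =>
    Submodule.mem_orthogonal_singleton_iff_inner_right
  have hfin : Module.finrank ℝ W = 2 := by
    have : Fact (Module.finrank ℝ E3 = 2 + 1) := ⟨by simp⟩
    exact Submodule.finrank_orthogonal_span_singleton hN0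
  let S : W →ₗ[ℝ] W := ((fderiv ℝ N x).toLinearMap.domRestrict W).codRestrict W
    fun v => (hW _).2 (h.inner_fderiv hx _)
  have hS : S.IsSymmetric := fun v w => h.fderiv_symm hx ((hW _).1 v.2) ((hW _).1 w.2)
  let b := hS.eigenvectorBasis hfin
  have hb : ∀ i, fderiv ℝ N x (b i) = hS.eigenvalues hfin i • (b i : E3) := fun i =>
    congrArg Subtype.val (hS.apply_eigenvectorBasis hfin i)
  refine ⟨b 0, b 1, _, _, b.orthonormal.1 0, b.orthonormal.1 1, ?_, (hW _).1 (b 0).2,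
    (hW _).1 (b 1).2, hb 0, hb 1⟩
  exact b.orthonormal.2 (by norm_num : (0 : Fin 2) ≠ 1)

/-- Two geodesic lines of curvature in succession, the first one in the direction `e₁` and the
second one in the direction `e₂`, lead from an elliptic point `x₀` to a point whose normal is
parallel to `N(x₀) + s e₁ + s e₂`; the binormal of the second one, parallel to `e₁ - s N(x₀)`, is a
principal direction there. -/
theorem exists_principal_of_normal (hr : r ≠ 0) (hK : HasNormalCharts K n)
    (hP : ParallelTangents K n r) (h : NormalChart K n U f N) {σ : ℝ} {x₀ : E3} (hx₀ : x₀ ∈ U)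
    (hxK : x₀ ∈ K) (hell : IsEllipticAt N σ x₀) {e₁ e₂ : E3} (he₁ : ‖e₁‖ = 1) (he₂ : ‖e₂‖ = 1)
    (he : inner ℝ e₁ e₂ = 0) (hN₁ : inner ℝ (N x₀) e₁ = 0) (hN₂ : inner ℝ (N x₀) e₂ = 0) {k : ℝ}
    (hk : fderiv ℝ N x₀ e₁ = k • e₁) {V : Set E3} (hV : V ∈ 𝓝 x₀) :
    ∀ᶠ s : ℝ in 𝓝 0, ∃ z ∈ K ∩ V, z ∈ U ∧
      N z = ‖N x₀ + s • (e₁ + e₂)‖⁻¹ • (N x₀ + s • (e₁ + e₂)) ∧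
      ∃ m : ℝ, fderiv ℝ N z (e₁ - s • N x₀) = m • (e₁ - s • N x₀) := by
  obtain ⟨c, hc, hev⟩ := h.eventually_le_of_isEllipticAt hx₀ hell
  obtain ⟨ρ, hρ, hgeo⟩ := h.exists_geodesic hx₀
  have hNc : ContinuousAt N x₀ := (h.differentiableAt_N hx₀).continuousAt
  have hNnear : ∀ᶠ x in 𝓝 x₀, dist (N x) (N x₀) < 1 / 4 :=
    hNc.eventually (Metric.ball_mem_nhds _ (by norm_num))
  obtain ⟨δ, hδ, hball⟩ := Metric.eventually_nhds_iff_ball.1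
    (hev.and (hNnear.and ((eventually_mem_set.2 hV).and (h.isOpen.eventually_mem hx₀))))
  set ε := min ρ (δ / 2) with hε
  have hε0 : 0 < ε := lt_min hρ (half_pos hδ)
  have hερ : ε ≤ ρ := min_le_left _ _
  have hεδ : ε ≤ δ / 2 := min_le_right _ _
  let ν₁ : ℝ → E3 := fun s => ‖N x₀ + s • e₁‖⁻¹ • (N x₀ + s • e₁)
  let ν : ℝ → E3 := fun s => ‖N x₀ + s • (e₁ + e₂)‖⁻¹ • (N x₀ + s • (e₁ + e₂))
  have hne : ∀ a : E3, inner ℝ (N x₀) a = 0 → ∀ s : ℝ, N x₀ + s • a ≠ 0 := by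
    intro a ha s h0
    have := congrArg (fun z => (inner ℝ (N x₀) z : ℝ)) h0
    simp [inner_add_right, inner_smul_right, ha, h.norm_N x₀ hx₀] at this
  have hN12 : inner ℝ (N x₀) (e₁ + e₂) = 0 := by rw [inner_add_right, hN₁, hN₂, add_zero]
  have hνtend : ∀ a : E3, inner ℝ (N x₀) a = 0 →
      Tendsto (fun s : ℝ => ‖N x₀ + s • a‖⁻¹ • (N x₀ + s • a)) (𝓝 0) (𝓝 (N x₀)) := by
    intro a ha
    have hcont : Continuous fun s : ℝ => ‖N x₀ + s • a‖⁻¹ • (N x₀ + s • a) := by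
      have h1 : Continuous fun s : ℝ => N x₀ + s • a := by fun_prop
      exact (h1.norm.inv₀ fun s => norm_ne_zero_iff.2 (hne a ha s)).smul h1
    have := hcont.tendsto 0
    simpa [h.norm_N x₀ hx₀] using this
  have hclose : ∀ a : E3, inner ℝ (N x₀) a = 0 → ∀ᶠ s : ℝ in 𝓝 0,
      dist (‖N x₀ + s • a‖⁻¹ • (N x₀ + s • a)) (N x₀) < 1 / 4 := fun a ha =>
    (hνtend a ha).eventually (Metric.ball_mem_nhds _ (by norm_num))
  have hsmall : ∀ a e : E3, inner ℝ (N x₀) a = 0 → inner ℝ (N x₀) e = 0 → ∀ᶠ s : ℝ in 𝓝 0,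
      |σ * inner ℝ e (‖N x₀ + s • a‖⁻¹ • (N x₀ + s • a))| < c / 4 * (ε / 2) := by
    intro a e ha hae
    have h1 : Tendsto (fun s : ℝ => |σ * inner ℝ e (‖N x₀ + s • a‖⁻¹ • (N x₀ + s • a))|) (𝓝 0)
        (𝓝 |σ * inner ℝ e (N x₀)|) := ((tendsto_const_nhds.inner (hνtend a ha)).const_mul σ).abs
    rw [real_inner_comm, hae, mul_zero, abs_zero] at h1
    exact h1.eventually_lt_const (by positivity)
  have hinner : ∀ x ∈ Metric.ball x₀ δ, ∀ μ : E3, ‖μ‖ = 1 → dist μ (N x₀) < 1 / 4 →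
      1 / 4 ≤ (inner ℝ (N x) μ : ℝ) := by
    intro x hx μ hμ hd
    obtain ⟨-, h1, -, h2⟩ := hball x hx
    have h3 : ‖N x - μ‖ < 1 / 2 := by
      rw [← dist_eq_norm]
      linarith [dist_triangle_right (N x) μ (N x₀)]
    have h4 := norm_sub_sq_real (N x) μ
    rw [h.norm_N x h2, hμ] at h4
    nlinarith [norm_nonneg (N x - μ)]
  filter_upwards [hclose e₁ hN₁, hclose (e₁ + e₂) hN12, hsmall e₁ e₁ hN₁ hN₁,
    hsmall (e₁ + e₂) e₂ hN12 hN₂] with s hs1 hs2 hs3 hs4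
  have hν₁ : ‖ν₁ s‖ = 1 := norm_smul_inv_norm (hne e₁ hN₁ s)
  have hν : ‖ν s‖ = 1 := norm_smul_inv_norm (hne (e₁ + e₂) hN12 s)
  -- The first line of curvature is followed until its normal is parallel to `N(x₀) + s e₁`.
  obtain ⟨α, A, κ, hα', hα0, hA0, hαU⟩ := hgeo x₀ ⟨hxK, Metric.mem_ball_self hρ⟩ e₁ he₁ hN₁
  have hα := hα'.mono hερ
  have h0 : (0 : ℝ) ∈ Ioo (-ε) ε := ⟨by linarith, hε0⟩
  have hαball : ∀ t ∈ Ioo (-ε) ε, dist (α t) x₀ < ε := fun t ht => by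
    rw [← hα0]; exact (hα.dist_le ht).trans_lt (abs_lt.2 ht)
  have hαmem : ∀ t ∈ Ioo (-ε) ε, α t ∈ Metric.ball x₀ δ := fun t ht =>
    (hαball t ht).trans_le (by linarith)
  have hα0U : α 0 ∈ U := by rw [hα0]; exact hx₀
  have hαpr : HasDerivAt (fun s => n (α s)) (k • A 0) 0 := by
    have := h.hasDerivAt_normal hα0U (hα.eventually_mem h0) (hα.hasDerivAt 0 h0)
    rwa [hα0, hA0, hk, ← hA0] at this
  have hnα : ∀ t ∈ Ioo (-ε) ε, n (α t) = N (α t) := fun t ht =>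
    h.eq_n _ ⟨hα.mem t ht, (hball _ (hαmem t ht)).2.2.2⟩
  have hAe₂ : inner ℝ (A 0) e₂ = 0 := by rw [hA0, he]
  have hne₂ : inner ℝ (n (α 0)) e₂ = 0 := by rw [hnα 0 h0, hα0, hN₂]
  obtain ⟨t₁, ht₁, hnt₁⟩ := hα.exists_normal_eq hr hK hP hε0 hαpr he₂ hAe₂ hne₂ hc
    (fun t ht => by
      obtain ⟨h1, -, -, h2⟩ := hball _ (hαmem t ht)
      rw [hα.curvature_eq hK h ht h2]
      refine h1 _ (hα.norm_velocity t ht) ?_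
      rw [← hnα t ht]; exact hα.inner_normal hK ht) hν₁
    (by
      simp only [ν₁, inner_smul_right, inner_add_right, real_inner_comm (N x₀), hN₂,
        real_inner_comm e₁, he]
      simp)
    (fun t ht => by rw [hnα t ht]; exact hinner _ (hαmem t ht) _ hν₁ hs1)
    (by rw [hA0]; exact hs3)
  have hz₁U := (hball _ (hαmem t₁ ht₁)).2.2.2
  obtain ⟨hAt₁, hnt₁'⟩ := hα.inner_binormal hr hK hP hαpr hAe₂ hne₂ ht₁
  obtain ⟨k₂, hk₂⟩ := hα.fderiv_binormal hr hK hP h hαpr he₂ hAe₂ hne₂ ht₁ hz₁U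
  have hAn := hα.inner_normal hK ht₁
  -- The second one is followed until its normal is parallel to `N(x₀) + s e₁ + s e₂`.
  obtain ⟨β, B, κ', hβ', hβ0, hB0, hβU⟩ := hgeo (α t₁)
    ⟨hα.mem t₁ ht₁, (hαball t₁ ht₁).trans_le hερ⟩ e₂ he₂ (by rw [← hnα t₁ ht₁]; exact hnt₁')
  have hβ := hβ'.mono hερ
  have hβmem : ∀ t ∈ Ioo (-ε) ε, β t ∈ Metric.ball x₀ δ := fun t ht => by
    have h1 := (hβ.dist_le ht).trans_lt (abs_lt.2 ht)
    rw [hβ0] at h1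
    rw [Metric.mem_ball]
    linarith [dist_triangle (β t) (α t₁) x₀, hαball t₁ ht₁]
  have hβ0U : β 0 ∈ U := by rw [hβ0]; exact hz₁U
  have hβpr : HasDerivAt (fun s => n (β s)) (k₂ • B 0) 0 := by
    have := h.hasDerivAt_normal hβ0U (hβ.eventually_mem h0) (hβ.hasDerivAt 0 h0)
    rwa [hβ0, hB0, hk₂, ← hB0] at this
  have hnβ : ∀ t ∈ Ioo (-ε) ε, n (β t) = N (β t) := fun t ht =>
    h.eq_n _ ⟨hβ.mem t ht, (hball _ (hβmem t ht)).2.2.2⟩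
  have hBw : inner ℝ (B 0) (A t₁) = 0 := by rw [hB0, real_inner_comm]; exact hAt₁
  have hnw : inner ℝ (n (β 0)) (A t₁) = 0 := by rw [hβ0]; exact hAn
  have hw := hα.norm_velocity t₁ ht₁
  have hwν₁ : inner ℝ (A t₁) (N x₀ + s • e₁) = 0 := by
    rw [hnt₁] at hAn
    simp only [ν₁, inner_smul_left] at hAn
    rw [real_inner_comm]
    exact (mul_eq_zero.1 hAn).resolve_left (by
      simpa using hne e₁ hN₁ s)
  have hwν : inner ℝ (A t₁) (ν s) = 0 := by
    have : N x₀ + s • (e₁ + e₂) = (N x₀ + s • e₁) + s • e₂ := by rw [smul_add, add_assoc]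
    simp only [ν]
    rw [this, inner_smul_right, inner_add_right, hwν₁, inner_smul_right, hAt₁]
    simp
  obtain ⟨t₂, ht₂, hnt₂⟩ := hβ.exists_normal_eq hr hK hP hε0 hβpr hw hBw hnw hc
    (fun t ht => by
      obtain ⟨h1, -, -, h2⟩ := hball _ (hβmem t ht)
      rw [hβ.curvature_eq hK h ht h2]
      refine h1 _ (hβ.norm_velocity t ht) ?_
      rw [← hnβ t ht]; exact hβ.inner_normal hK ht) hν hwν
    (fun t ht => by rw [hnβ t ht]; exact hinner _ (hβmem t ht) _ hν hs2)
    (by rw [hB0]; exact hs4)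
  have hz := hball _ (hβmem t₂ ht₂)
  obtain ⟨m, hm⟩ := hβ.fderiv_binormal hr hK hP h hβpr hw hBw hnw ht₂ hz.2.2.2
  refine ⟨β t₂, ⟨hβ.mem t₂ ht₂, hz.2.2.1⟩, hz.2.2.2, by rw [← hnβ t₂ ht₂, hnt₂], m, ?_⟩
  have hexp := eq_sum_of_orthonormal he₁ he₂ (h.norm_N x₀ hx₀) he
    (by rw [real_inner_comm]; exact hN₁) (by rw [real_inner_comm]; exact hN₂) (A t₁)
  have h1 : inner ℝ e₂ (A t₁) = 0 := by rw [real_inner_comm]; exact hAt₁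
  have h2 : inner ℝ (N x₀) (A t₁) = - s * inner ℝ e₁ (A t₁) := by
    rw [inner_add_right, inner_smul_right, real_inner_comm, real_inner_comm e₁] at hwν₁
    linarith
  have hAexp : A t₁ = (inner ℝ e₁ (A t₁) : ℝ) • (e₁ - s • N x₀) := by
    rw [h1, h2] at hexp
    exact hexp.trans (by module)
  have hq : (inner ℝ e₁ (A t₁) : ℝ) ≠ 0 := fun h0 => by
    rw [h0, zero_smul] at hAexp
    rw [hAexp, norm_zero] at hw
    exact zero_ne_one hw
  rw [hAexp, map_smul, smul_comm] at hm
  exact smul_right_injective E3 hq hm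

/-- Elliptic points are umbilic: otherwise there would be two non-orthogonal principal directions
with different curvatures at a nearby point. -/
theorem umbilic_of_isEllipticAt (hr : r ≠ 0) (hK : HasNormalCharts K n)
    (hP : ParallelTangents K n r) (h : NormalChart K n U f N) {σ : ℝ} {x₀ : E3} (hx₀ : x₀ ∈ U)
    (hxK : x₀ ∈ K) (hell : IsEllipticAt N σ x₀) :
    ∃ k : ℝ, ∀ v, inner ℝ (N x₀) v = 0 → fderiv ℝ N x₀ v = k • v := by
  obtain ⟨e₁, e₂, k₁, k₂, he₁, he₂, he, hN₁, hN₂, hk₁, hk₂⟩ := h.exists_principal hx₀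
  obtain ⟨V, hV, hVU, hinj⟩ := h.eventually_injOn_of_isEllipticAt hx₀ hell
  have hNself := h.inner_self hx₀
  let Ψ : ℝ × E3 → ℝ := fun p => inner ℝ (fderiv ℝ N p.2 (e₁ - p.1 • N x₀)) e₁ -
    inner ℝ (fderiv ℝ N p.2 (e₂ - p.1 • N x₀)) e₂
  have hΨ : ContinuousAt Ψ (0, x₀) := by
    have h1 : ContinuousAt (fun p : ℝ × E3 => fderiv ℝ N p.2) (0, x₀) :=
      ContinuousAt.comp (g := fun x => fderiv ℝ N x) (f := Prod.snd)
        (h.continuousOn_fderiv.continuousAt (h.isOpen.mem_nhds hx₀)) continuousAt_snd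
    have h2 : ∀ e : E3, ContinuousAt (fun p : ℝ × E3 => e - p.1 • N x₀) (0, x₀) := fun e => by
      fun_prop
    exact ((h1.clm_apply (h2 e₁)).inner continuousAt_const).sub
      ((h1.clm_apply (h2 e₂)).inner continuousAt_const)
  have hΨ0 : Ψ (0, x₀) = k₁ - k₂ := by
    simp only [Ψ, zero_smul, sub_zero, hk₁, hk₂, inner_smul_left, real_inner_self_eq_norm_sq, he₁,
      he₂]
    simp
  have hk : k₁ = k₂ := by
    by_contra hne
    have hΨne : ∀ᶠ p in 𝓝 ((0 : ℝ), x₀), Ψ p ≠ 0 :=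
      hΨ.eventually_ne (by rw [hΨ0]; exact sub_ne_zero.2 hne)
    rw [nhds_prod_eq] at hΨne
    obtain ⟨pa, ha, pb, hb, hab⟩ := Filter.eventually_prod_iff.1 hΨne
    have hW : V ∩ {x | pb x} ∈ 𝓝 x₀ := inter_mem hV hb
    have he' : inner ℝ e₂ e₁ = (0 : ℝ) := by rw [real_inner_comm]; exact he
    have hev := ((h.exists_principal_of_normal hr hK hP hx₀ hxK hell he₁ he₂ he hN₁ hN₂ hk₁
      hW).and (h.exists_principal_of_normal hr hK hP hx₀ hxK hell he₂ he₁ he' hN₂ hN₁ hk₂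
      hW)).and ha
    have hfreq : ∃ᶠ s : ℝ in 𝓝 0, s ≠ 0 :=
      (eventually_mem_nhdsWithin (s := ({0}ᶜ : Set ℝ)) (a := 0)).frequently.filter_mono
        nhdsWithin_le_nhds
    obtain ⟨s, hs0, ⟨⟨z, hz, hzU, hNz, m₁, hm₁⟩, z', hz', -, hNz', m₂, hm₂⟩, hsa⟩ :=
      (hfreq.and_eventually hev).exists
    have hzz : z = z' := hinj z ⟨hz.1, hz.2.1⟩ z' ⟨hz'.1, hz'.2.1⟩ (by
      rw [hNz, hNz', add_comm e₁ e₂])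
    subst hzz
    have hNzperp : ∀ a b : E3, ‖a‖ = 1 → inner ℝ a b = 0 → inner ℝ (N x₀) a = 0 →
        inner ℝ (N x₀) b = 0 → inner ℝ (N x₀ + s • (a + b)) (a - s • N x₀) = 0 := by
      intro a b ha hab hNa hNb
      simp only [inner_add_left, inner_sub_right, inner_smul_left, inner_smul_right, hNself, hNa,
        real_inner_self_eq_norm_sq, ha, real_inner_comm (N x₀) a, real_inner_comm (N x₀) b, hNb,
        real_inner_comm a b, hab, conj_trivial]
      ring
    have hp₁ : inner ℝ (N z) (e₁ - s • N x₀) = 0 := by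
      rw [hNz, inner_smul_left, hNzperp e₁ e₂ he₁ he hN₁ hN₂, mul_zero]
    have hp₂ : inner ℝ (N z) (e₂ - s • N x₀) = 0 := by
      rw [hNz', inner_smul_left, hNzperp e₂ e₁ he₂ he' hN₂ hN₁, mul_zero]
    have hsymm := h.fderiv_symm hzU hp₁ hp₂
    rw [hm₁, hm₂, inner_smul_left, inner_smul_right, conj_trivial] at hsymm
    have hprod : inner ℝ (e₁ - s • N x₀) (e₂ - s • N x₀) = s * s := by
      simp only [inner_sub_left, inner_sub_right, inner_smul_left, inner_smul_right, hNself, hN₂,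
        real_inner_comm (N x₀) e₁, hN₁, he, conj_trivial]
      ring
    rw [hprod] at hsymm
    have hm : m₁ = m₂ := mul_right_cancel₀ (mul_ne_zero hs0 hs0) hsymm
    refine hab hsa hz.2.2 ?_
    simp only [Ψ, hm₁, hm₂, hm, inner_smul_left, inner_sub_left, hN₁, hN₂,
      real_inner_self_eq_norm_sq, he₁, he₂]
    simp
  refine ⟨k₁, fun v hv => ?_⟩
  have hexp := eq_sum_of_orthonormal he₁ he₂ (h.norm_N x₀ hx₀) he
    (by rw [real_inner_comm]; exact hN₁) (by rw [real_inner_comm]; exact hN₂) v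
  rw [hv, zero_smul, add_zero] at hexp
  rw [hexp, map_add, map_smul, map_smul, hk₁, hk₂, ← hk, smul_add, smul_comm k₁, smul_comm k₁]

end NormalChart

end

section

variable {K U : Set E3} {n N : E3 → E3} {f : E3 → ℝ} {r : ℝ}

/-! ### Graph coordinates and umbilic regions -/

namespace NormalChart

/-- The surface is, near `x₀`, a graph over its tangent plane at `x₀`. -/
theorem exists_graph (h : NormalChart K n U f N) {x₀ : E3} (hx₀ : x₀ ∈ U)
    (hxK : x₀ ∈ K) {e₁ e₂ : E3} (he₁ : ‖e₁‖ = 1) (he₂ : ‖e₂‖ = 1) (he : inner ℝ e₁ e₂ = 0)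
    (hN₁ : inner ℝ (N x₀) e₁ = 0) (hN₂ : inner ℝ (N x₀) e₂ = 0) {V : Set E3} (hV : V ∈ 𝓝 x₀) :
    ∃ (δ : ℝ) (φ : ℝ × ℝ → E3), 0 < δ ∧
      (∀ p : ℝ × ℝ, p.1 ∈ Ioo (-δ) δ → p.2 ∈ Ioo (-δ) δ → φ p ∈ K ∧ φ p ∈ U ∧ φ p ∈ V ∧
        inner ℝ e₁ (φ p - x₀) = p.1 ∧ inner ℝ e₂ (φ p - x₀) = p.2 ∧ DifferentiableAt ℝ φ p) ∧
      ∀ᶠ z in 𝓝[K] x₀, ∃ p : ℝ × ℝ, p.1 ∈ Ioo (-δ) δ ∧ p.2 ∈ Ioo (-δ) δ ∧ φ p = z := by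
  obtain ⟨c, hc0, hc⟩ := h.fderiv_f x₀ hx₀
  have hUx := h.isOpen.mem_nhds hx₀
  let A : E3 → E3 := fun x =>
    (inner ℝ e₁ (x - x₀) : ℝ) • e₁ + (inner ℝ e₂ (x - x₀) : ℝ) • e₂ + f x • N x₀
  let A' : E3 →L[ℝ] E3 :=
    (innerSL ℝ e₁).smulRight e₁ + (innerSL ℝ e₂).smulRight e₂ + (fderiv ℝ f x₀).smulRight (N x₀)
  have hAc : ContDiffAt ℝ 1 A x₀ := by
    have h1 : ∀ e : E3, ContDiffAt ℝ 1 (fun x => (inner ℝ e (x - x₀) : ℝ) • e) x₀ := fun e =>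
      (((innerSL ℝ e).contDiff.comp (contDiff_id.sub contDiff_const)).smul
        contDiff_const).contDiffAt
    exact ((h1 e₁).add (h1 e₂)).add
      (((h.contDiff_f.contDiffAt hUx).of_le (by norm_num)).smul contDiffAt_const)
  have hd : HasFDerivAt A A' x₀ := by
    have h1 : ∀ e : E3, HasFDerivAt (fun x => (inner ℝ e (x - x₀) : ℝ) • e)
        ((innerSL ℝ e).smulRight e) x₀ := fun e =>
      (((innerSL ℝ e).hasFDerivAt).comp x₀ ((hasFDerivAt_id x₀).sub_const x₀)).smul_const e
    exact ((h1 e₁).add (h1 e₂)).add ((h.hasFDerivAt_f hx₀).smul_const (N x₀))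
  have hA'v : ∀ v, A' v = (inner ℝ e₁ v : ℝ) • e₁ + (inner ℝ e₂ v : ℝ) • e₂ +
      (c * inner ℝ (N x₀) v : ℝ) • N x₀ := fun v => by rw [← hc]; rfl
  have hcoord : ∀ a b d : ℝ, ∀ y : E3, y = a • e₁ + b • e₂ + d • N x₀ →
      inner ℝ e₁ y = a ∧ inner ℝ e₂ y = b ∧ inner ℝ (N x₀) y = d := by
    rintro a b d y rfl
    simp [inner_add_right, inner_smul_right, he₁, he₂, he, hN₁, hN₂, h.norm_N x₀ hx₀,
      real_inner_comm e₁ e₂, real_inner_comm (N x₀) e₁, real_inner_comm (N x₀) e₂]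
  have hker : LinearMap.ker A'.toLinearMap = ⊥ := by
    rw [LinearMap.ker_eq_bot']
    intro v hv
    obtain ⟨h1, h2, h3⟩ := hcoord _ _ _ 0 ((hA'v v).symm.trans hv).symm
    rw [inner_zero_right] at h1 h2 h3
    have h4 := (mul_eq_zero.1 h3.symm).resolve_left hc0
    rw [eq_sum_of_orthonormal he₁ he₂ (h.norm_N x₀ hx₀) he (by rw [real_inner_comm]; exact hN₁)
      (by rw [real_inner_comm]; exact hN₂) v, ← h1, ← h2, h4]
    simp
  let e : E3 ≃L[ℝ] E3 := (LinearEquiv.ofInjectiveEndo _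
    (LinearMap.ker_eq_bot.1 hker)).toContinuousLinearEquiv
  have hde : HasFDerivAt A (e : E3 →L[ℝ] E3) x₀ := hd.congr_fderiv (by ext v; rfl)
  let Φ := hAc.toOpenPartialHomeomorph A hde one_ne_zero
  have hΦ : ⇑Φ = A := hAc.toOpenPartialHomeomorph_coe hde one_ne_zero
  have hx₀Φ : x₀ ∈ Φ.source := hAc.mem_toOpenPartialHomeomorph_source hde one_ne_zero
  have hA0 : A x₀ = 0 := by simp [A, h.f_eq_zero hx₀ hxK]
  have h0t : (0 : E3) ∈ Φ.target := by
    rw [← hA0, ← hΦ]; exact Φ.map_source hx₀Φ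
  have hΦ0 : Φ.symm 0 = x₀ := by
    rw [← hA0, ← hΦ]; exact Φ.left_inv hx₀Φ
  have hinv : ContDiffAt ℝ 1 Φ.symm 0 := by
    have := hAc.to_localInverse hde one_ne_zero
    rwa [hA0] at this
  have hinvd : ∀ᶠ y in 𝓝 (0 : E3), DifferentiableAt ℝ Φ.symm y := by
    filter_upwards [hinv.eventually (by simp)] with y hy using hy.differentiableAt one_ne_zero
  have hmem : ∀ᶠ y in 𝓝 (0 : E3), Φ.symm y ∈ U ∩ V := by
    refine hinv.continuousAt.eventually ?_
    rw [hΦ0]; exact inter_mem hUx hV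
  let ℓ : ℝ × ℝ → E3 := fun p => p.1 • e₁ + p.2 • e₂
  have hℓ : Differentiable ℝ ℓ := by fun_prop
  have hℓ0 : Tendsto ℓ (𝓝 (0, 0)) (𝓝 0) := by
    have := hℓ.continuous.tendsto (0, 0)
    simpa [ℓ] using this
  have hev := hℓ0.eventually (hinvd.and (hmem.and (Φ.open_target.eventually_mem h0t)))
  obtain ⟨δ, hδ, hδsub⟩ := Metric.eventually_nhds_iff_ball.1 hev
  have hballp : ∀ p : ℝ × ℝ, p.1 ∈ Ioo (-δ) δ → p.2 ∈ Ioo (-δ) δ → p ∈ Metric.ball (0, 0) δ := by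
    intro p h1 h2
    rw [← ball_prod_same]
    exact ⟨by rw [mem_ball_zero_iff]; exact abs_lt.2 h1, by
      rw [mem_ball_zero_iff]; exact abs_lt.2 h2⟩
  refine ⟨δ, fun p => Φ.symm (ℓ p), hδ, fun p h1 h2 => ?_, ?_⟩
  · obtain ⟨hdiff, hUV, htar⟩ := hδsub p (hballp p h1 h2)
    have hA : A (Φ.symm (ℓ p)) = ℓ p := by rw [← hΦ]; exact Φ.right_inv htar
    obtain ⟨ha, hb, hf⟩ := hcoord _ _ _ (ℓ p) hA.symm
    obtain ⟨ha', hb', hf'⟩ := hcoord p.1 p.2 0 (ℓ p) (by simp [ℓ])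
    exact ⟨h.mem_of_f_eq_zero hUV.1 (hf.symm.trans hf'), hUV.1, hUV.2, ha.symm.trans ha',
      hb.symm.trans hb', hdiff.comp p (hℓ p)⟩
  · have hcont : Tendsto A (𝓝 x₀) (𝓝 0) := by
      rw [← hA0]; exact hAc.continuousAt
    have hcoordc : ∀ e : E3, ∀ᶠ z in 𝓝 x₀, (inner ℝ e (z - x₀) : ℝ) ∈ Ioo (-δ) δ := by
      intro e
      have h1 : Tendsto (fun z => (inner ℝ e (z - x₀) : ℝ)) (𝓝 x₀) (𝓝 0) := by
        have : Continuous fun z => (inner ℝ e (z - x₀) : ℝ) := by fun_prop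
        simpa using this.tendsto x₀
      exact h1.eventually (Ioo_mem_nhds (by linarith) hδ)
    filter_upwards [self_mem_nhdsWithin, nhdsWithin_le_nhds (hcoordc e₁),
      nhdsWithin_le_nhds (hcoordc e₂), nhdsWithin_le_nhds hUx,
      nhdsWithin_le_nhds (Φ.open_source.mem_nhds hx₀Φ)] with z hzK h1 h2 hzU hzs
    refine ⟨(inner ℝ e₁ (z - x₀), inner ℝ e₂ (z - x₀)), h1, h2, ?_⟩
    have h3 : ℓ (inner ℝ e₁ (z - x₀), inner ℝ e₂ (z - x₀)) = Φ z := by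
      rw [hΦ]
      simp [A, ℓ, h.f_eq_zero hzU hzK]
    rw [h3]
    exact Φ.left_inv hzs

/-- A function whose differential vanishes on tangent vectors is locally constant on the surface. -/
theorem eventually_eq_of_fderiv_tangent {F : Type*} [NormedAddCommGroup F] [NormedSpace ℝ F]
    (h : NormalChart K n U f N) {x₀ : E3} (hx₀ : x₀ ∈ U) (hxK : x₀ ∈ K) {g : E3 → F}
    (hg : ∀ᶠ z in 𝓝[K] x₀, DifferentiableAt ℝ g z ∧
      ∀ v, inner ℝ (N z) v = 0 → fderiv ℝ g z v = 0) :
    ∀ᶠ z in 𝓝[K] x₀, g z = g x₀ := by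
  obtain ⟨e₁, e₂, -, -, he₁, he₂, he, hN₁, hN₂, -, -⟩ := h.exists_principal hx₀
  obtain ⟨V, hV, hVg⟩ := mem_nhdsWithin_iff_exists_mem_nhds_inter.1 hg
  obtain ⟨δ, φ, hδ, hφ, hcov⟩ := h.exists_graph hx₀ hxK he₁ he₂ he hN₁ hN₂ hV
  have h0 : (0 : ℝ) ∈ Ioo (-δ) δ := ⟨by linarith, hδ⟩
  have hcurve : ∀ (q : ℝ → ℝ × ℝ) (t : ℝ), DifferentiableAt ℝ q t →
      (∀ s ∈ Ioo (-δ) δ, (q s).1 ∈ Ioo (-δ) δ ∧ (q s).2 ∈ Ioo (-δ) δ) → t ∈ Ioo (-δ) δ →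
      HasDerivAt (fun s => g (φ (q s))) 0 t := by
    intro q t hq hmem ht
    obtain ⟨hK, hU, hV', -, -, hd⟩ := hφ (q t) (hmem t ht).1 (hmem t ht).2
    have hc : HasDerivAt (fun s => φ (q s)) _ t := (hd.comp t hq).hasDerivAt
    have htan := h.inner_velocity hU (by
      filter_upwards [isOpen_Ioo.mem_nhds ht] with s hs
      exact (hφ (q s) (hmem s hs).1 (hmem s hs).2).1) hc
    obtain ⟨hgd, hg0⟩ := hVg ⟨hV', hK⟩
    have := hgd.hasFDerivAt.comp_hasDerivAt t hc
    rwa [hg0 _ htan] at this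
  have hconst : ∀ p : ℝ × ℝ, p.1 ∈ Ioo (-δ) δ → p.2 ∈ Ioo (-δ) δ → g (φ p) = g (φ (0, 0)) := by
    intro p h1 h2
    have hu := eq_of_hasDerivAt_zero_Ioo (g := fun s => g (φ (s, p.2)))
      (fun s hs => hcurve (fun s => (s, p.2)) s (by fun_prop) (fun _ hs => ⟨hs, h2⟩) hs) h1
    have hv := eq_of_hasDerivAt_zero_Ioo (g := fun s => g (φ ((0 : ℝ), s)))
      (fun s hs => hcurve (fun s => ((0 : ℝ), s)) s (by fun_prop) (fun _ hs => ⟨h0, hs⟩) hs) h2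
    exact hu.trans hv
  obtain ⟨p₀, hp1, hp2, hp₀⟩ := hcov.self_of_nhdsWithin hxK
  filter_upwards [hcov] with z ⟨p, h1, h2, hp⟩
  rw [← hp, ← hp₀, hconst p h1 h2, hconst p₀ hp1 hp2]

/-- In an umbilic region the principal curvature is locally constant. In graph coordinates `(u, v)`
the two tangential components of the normal depend on `u` only and on `v` only, respectively, and
their derivatives both equal the curvature. -/
theorem eventually_umbilic_const (h : NormalChart K n U f N) {x₀ : E3} (hx₀ : x₀ ∈ U) (hxK : x₀ ∈ K)
    (humb : ∀ᶠ z in 𝓝[K] x₀, ∃ k : ℝ, ∀ v, inner ℝ (N z) v = 0 → fderiv ℝ N z v = k • v) :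
    ∃ k : ℝ, ∀ᶠ z in 𝓝[K] x₀, ∀ v, inner ℝ (N z) v = 0 → fderiv ℝ N z v = k • v := by
  obtain ⟨e₁, e₂, -, -, he₁, he₂, he, hN₁, hN₂, -, -⟩ := h.exists_principal hx₀
  obtain ⟨V, hV, hVk⟩ := mem_nhdsWithin_iff_exists_mem_nhds_inter.1 humb
  obtain ⟨δ, φ, hδ, hφ, hcov⟩ := h.exists_graph hx₀ hxK he₁ he₂ he hN₁ hN₂ hV
  have h0 : (0 : ℝ) ∈ Ioo (-δ) δ := ⟨by linarith, hδ⟩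
  have hk : ∀ z, ∃ k : ℝ, z ∈ V ∩ K → ∀ v, inner ℝ (N z) v = 0 → fderiv ℝ N z v = k • v := by
    intro z
    by_cases hz : z ∈ V ∩ K
    · obtain ⟨k, hk⟩ := hVk hz
      exact ⟨k, fun _ => hk⟩
    · exact ⟨0, fun hz' => absurd hz' hz⟩
  choose k hk using hk
  -- Along a coordinate line the derivative of a component of the normal is `k` times that of `φ`.
  have hcurve : ∀ (q : ℝ → ℝ × ℝ) (q' : ℝ × ℝ) (t : ℝ), HasDerivAt q q' t →
      (∀ s ∈ Ioo (-δ) δ, (q s).1 ∈ Ioo (-δ) δ ∧ (q s).2 ∈ Ioo (-δ) δ) → t ∈ Ioo (-δ) δ →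
      HasDerivAt (fun s => (inner ℝ e₁ (N (φ (q s))) : ℝ)) (k (φ (q t)) * q'.1) t ∧
      HasDerivAt (fun s => (inner ℝ e₂ (N (φ (q s))) : ℝ)) (k (φ (q t)) * q'.2) t := by
    intro q q' t hq hmem ht
    obtain ⟨hK, hU, hV', -, -, hd⟩ := hφ (q t) (hmem t ht).1 (hmem t ht).2
    have hc : HasDerivAt (fun s => φ (q s)) (fderiv ℝ φ (q t) q') t :=
      hd.hasFDerivAt.comp_hasDerivAt t hq
    have hev : ∀ᶠ s in 𝓝 t, s ∈ Ioo (-δ) δ := isOpen_Ioo.mem_nhds ht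
    have htan := h.inner_velocity hU (by
      filter_upwards [hev] with s hs
      exact (hφ (q s) (hmem s hs).1 (hmem s hs).2).1) hc
    have hNd : HasDerivAt (fun s => N (φ (q s))) _ t := (h.hasFDerivAt_N hU).comp_hasDerivAt t hc
    rw [hk _ ⟨hV', hK⟩ _ htan] at hNd
    have hcomp : ∀ (e : E3) (a : ℝ → ℝ) (a' : ℝ), HasDerivAt a a' t →
        (∀ s ∈ Ioo (-δ) δ, inner ℝ e (φ (q s) - x₀) = a s) →
        HasDerivAt (fun s => (inner ℝ e (N (φ (q s))) : ℝ)) (k (φ (q t)) * a') t := by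
      intro e a a' ha hea
      have h1 := (hasDerivAt_const t e).inner ℝ (hc.sub_const x₀)
      rw [inner_zero_left, add_zero] at h1
      have h2 := h1.unique (ha.congr_of_eventuallyEq (by
        filter_upwards [hev] with s hs using hea s hs))
      have h3 := (hasDerivAt_const t e).inner ℝ hNd
      rwa [inner_zero_left, add_zero, inner_smul_right, h2] at h3
    exact ⟨hcomp e₁ _ _ hq.fst fun s hs => (hφ (q s) (hmem s hs).1 (hmem s hs).2).2.2.2.1,
      hcomp e₂ _ _ hq.snd fun s hs => (hφ (q s) (hmem s hs).1 (hmem s hs).2).2.2.2.2.1⟩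
  have hU : ∀ b ∈ Ioo (-δ) δ, ∀ t ∈ Ioo (-δ) δ,
      HasDerivAt (fun s => (inner ℝ e₁ (N (φ (s, b))) : ℝ)) (k (φ (t, b))) t ∧
      HasDerivAt (fun s => (inner ℝ e₂ (N (φ (s, b))) : ℝ)) 0 t := by
    intro b hb t ht
    have := hcurve (fun s => (s, b)) (1, 0) t ((hasDerivAt_id t).prodMk (hasDerivAt_const t b))
      (fun _ hs => ⟨hs, hb⟩) ht
    simpa using this
  have hV' : ∀ a ∈ Ioo (-δ) δ, ∀ t ∈ Ioo (-δ) δ,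
      HasDerivAt (fun s => (inner ℝ e₁ (N (φ (a, s))) : ℝ)) 0 t ∧
      HasDerivAt (fun s => (inner ℝ e₂ (N (φ (a, s))) : ℝ)) (k (φ (a, t))) t := by
    intro a ha t ht
    have := hcurve (fun s => (a, s)) (0, 1) t ((hasDerivAt_const t a).prodMk (hasDerivAt_id t))
      (fun _ hs => ⟨ha, hs⟩) ht
    simpa using this
  have hku : ∀ a ∈ Ioo (-δ) δ, ∀ b ∈ Ioo (-δ) δ, k (φ (a, b)) = k (φ (a, 0)) := by
    intro a ha b hb
    refine (hU b hb a ha).1.unique ((hU 0 h0 a ha).1.congr_of_eventuallyEq ?_)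
    filter_upwards [isOpen_Ioo.mem_nhds ha] with s hs
    exact eq_of_hasDerivAt_zero_Ioo (g := fun τ => (inner ℝ e₁ (N (φ (s, τ))) : ℝ))
      (fun τ hτ => (hV' s hs τ hτ).1) hb
  have hkv : ∀ a ∈ Ioo (-δ) δ, ∀ b ∈ Ioo (-δ) δ, k (φ (a, b)) = k (φ (0, b)) := by
    intro a ha b hb
    refine (hV' a ha b hb).2.unique ((hV' 0 h0 b hb).2.congr_of_eventuallyEq ?_)
    filter_upwards [isOpen_Ioo.mem_nhds hb] with s hs
    exact eq_of_hasDerivAt_zero_Ioo (g := fun τ => (inner ℝ e₂ (N (φ (τ, s))) : ℝ))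
      (fun τ hτ => (hU s hs τ hτ).2) ha
  refine ⟨k (φ (0, 0)), ?_⟩
  filter_upwards [hcov] with z ⟨p, h1, h2, hp⟩ v hv
  have hkz : k z = k (φ (0, 0)) := by
    rw [← hp, ← hkv p.1 h1 0 h0, ← hku p.1 h1 p.2 h2]
  rw [← hkz]
  refine hk z ⟨?_, ?_⟩ v hv
  · rw [← hp]; exact (hφ p h1 h2).2.2.1
  · rw [← hp]; exact (hφ p h1 h2).1

end NormalChart

/-! ### Surfaces with an affine Gauss map -/

/-- `A` is the shape operator at `x`: it gives the derivative of the normal along curves. -/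
def HasShape (K : Set E3) (n : E3 → E3) (A : E3 →L[ℝ] E3) (x : E3) : Prop :=
  ∀ (c : ℝ → E3) (v : E3), c 0 = x → (∀ᶠ t in 𝓝 (0 : ℝ), c t ∈ K) → HasDerivAt c v 0 →
    HasDerivAt (fun t => n (c t)) (A v) 0

theorem NormalChart.hasShape_iff (h : NormalChart K n U f N) {x : E3} (hx : x ∈ U) (hxK : x ∈ K)
    (A : E3 →L[ℝ] E3) :
    HasShape K n A x ↔ ∀ v, inner ℝ (N x) v = 0 → fderiv ℝ N x v = A v := by
  constructor
  · intro hA v hv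
    by_cases hv0 : v = 0
    · simp [hv0]
    obtain ⟨γ, T, κ, ε, hε, hγ, hγ0, hT0⟩ := h.exists_curve hx hxK (norm_smul_inv_norm (𝕜 := ℝ) hv0)
      (by rw [inner_smul_right, hv, mul_zero])
    have h0 : (0 : ℝ) ∈ Ioo (-ε) ε := ⟨by linarith, hε⟩
    have h1 := h.hasDerivAt_normal (by rwa [hγ0]) (hγ.eventually_mem h0) (hγ.hasDerivAt 0 h0)
    have h2 := h1.unique (hA γ _ hγ0 (hγ.eventually_mem h0) (hγ.hasDerivAt 0 h0))
    rw [hγ0, hT0, map_smul, map_smul] at h2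
    exact smul_right_injective E3 (inv_ne_zero (norm_ne_zero_iff.2 hv0)) h2
  · rintro hA c v rfl hc hd
    rw [← hA v (h.inner_velocity hx hc hd)]
    exact h.hasDerivAt_normal hx hc hd

theorem IsPreconnected.forall_of_locally {K : Set E3} (hK : IsPreconnected K) {p : E3 → Prop}
    (hne : ∃ x ∈ K, p x) (hopen : ∀ x ∈ K, p x → ∀ᶠ z in 𝓝[K] x, p z)
    (hclosed : ∀ x ∈ K, (∃ᶠ z in 𝓝[K] x, p z) → p x) : ∀ x ∈ K, p x := by
  have := isPreconnected_iff_preconnectedSpace.1 hK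
  have hclopen : IsClopen {x : K | p x} := by
    constructor
    · rw [isClosed_iff_frequently]
      rintro ⟨x, hx⟩ hfreq
      refine hclosed x hx ?_
      rw [nhdsWithin_eq_map_subtype_coe hx, frequently_map]
      exact hfreq
    · rw [isOpen_iff_eventually]
      rintro ⟨x, hx⟩ hpx
      have := hopen x hx hpx
      rwa [nhdsWithin_eq_map_subtype_coe hx, eventually_map] at this
  obtain ⟨x, hx, hpx⟩ := hne
  have huniv := hclopen.eq_univ ⟨⟨x, hx⟩, hpx⟩
  intro y hy
  have : (⟨y, hy⟩ : K) ∈ {x : K | p x} := huniv ▸ mem_univ _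
  exact this

theorem eq_zero_of_frequently {F : Type*} [NormedAddCommGroup F] {g : E3 → F} {x : E3}
    (hg : ContinuousAt g x) (hfreq : ∃ᶠ z in 𝓝 x, g z = 0) : g x = 0 := by
  by_contra hne
  exact hfreq (hg.eventually_ne hne)

/-- The locus where the Gauss map is `x ↦ A x + w` to first order is closed, so it is the whole
surface as soon as it is nonempty and open. -/
theorem forall_gauss_eq (hK : HasNormalCharts K n) (hconn : IsPreconnected K) {A : E3 →L[ℝ] E3}
    {w : E3} (hne : ∃ x ∈ K, n x = A x + w ∧ HasShape K n A x)
    (hopen : ∀ x ∈ K, n x = A x + w → HasShape K n A x →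
      ∀ᶠ z in 𝓝[K] x, n z = A z + w ∧ HasShape K n A z) :
    ∀ x ∈ K, n x = A x + w ∧ HasShape K n A x := by
  refine hconn.forall_of_locally (p := fun x => n x = A x + w ∧ HasShape K n A x) hne
    (fun x hx hp => hopen x hx hp.1 hp.2) fun x hx hfreq => ?_
  obtain ⟨U, f, N, h, hxU⟩ := hK x hx
  have hUx := h.isOpen.mem_nhds hxU
  have hfreq' : ∃ᶠ z in 𝓝 x, (z ∈ U ∧ z ∈ K) ∧ n z = A z + w ∧ HasShape K n A z := by
    rw [frequently_nhdsWithin_iff] at hfreq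
    refine (hfreq.and_eventually hUx).mono fun z hz => ⟨⟨hz.2, hz.1.2⟩, hz.1.1⟩
  have hNc := (h.differentiableAt_N hxU).continuousAt
  constructor
  · have h1 : N x - (A x + w) = 0 := by
      refine eq_zero_of_frequently (g := fun z => N z - (A z + w)) (hNc.sub (by fun_prop))
        (hfreq'.mono fun z hz => ?_)
      rw [← h.eq_n z ⟨hz.1.2, hz.1.1⟩, hz.2.1, sub_self]
    rw [h.eq_n x ⟨hx, hxU⟩]
    exact sub_eq_zero.1 h1
  · rw [h.hasShape_iff hxU hx]
    intro v hv
    let Q : E3 → E3 := fun z => v - (inner ℝ (N z) v : ℝ) • N z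
    have hQ : ContinuousAt Q x := by
      have h1 : ContinuousAt (fun z => (inner ℝ (N z) v : ℝ)) x := hNc.inner continuousAt_const
      exact continuousAt_const.sub (h1.smul hNc)
    have hQx : Q x = v := by simp only [Q, hv, zero_smul, sub_zero]
    have h1 : fderiv ℝ N x (Q x) - A (Q x) = 0 := by
      refine eq_zero_of_frequently (g := fun z => fderiv ℝ N z (Q z) - A (Q z)) ?_
        (hfreq'.mono fun z hz => ?_)
      · exact ((h.continuousOn_fderiv.continuousAt hUx).clm_apply hQ).sub
          (A.continuous.continuousAt.comp hQ)
      · rw [sub_eq_zero]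
        refine (h.hasShape_iff hz.1.1 hz.1.2 A).1 hz.2.2 _ ?_
        simp only [Q, inner_sub_right, inner_smul_right, h.inner_self hz.1.1]
        ring
    rw [hQx] at h1
    exact sub_eq_zero.1 h1

/-- If the shape operator is `A` near `x₀`, then the Gauss map is `x ↦ A x + w` near `x₀`. -/
theorem NormalChart.eventually_gauss_eq (h : NormalChart K n U f N) {x₀ : E3} (hx₀ : x₀ ∈ U)
    (hxK : x₀ ∈ K) {A : E3 →L[ℝ] E3} (hA : ∀ᶠ z in 𝓝[K] x₀, HasShape K n A z) {w : E3}
    (hw : n x₀ = A x₀ + w) : ∀ᶠ z in 𝓝[K] x₀, n z = A z + w := by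
  have hUx : ∀ᶠ z in 𝓝[K] x₀, z ∈ U := nhdsWithin_le_nhds (h.isOpen.mem_nhds hx₀)
  have h1 := h.eventually_eq_of_fderiv_tangent hx₀ hxK (g := fun z => N z - A z) (by
    filter_upwards [hA, hUx, self_mem_nhdsWithin] with z hz hzU hzK
    have hd : HasFDerivAt (fun z => N z - A z) (fderiv ℝ N z - A) z :=
      (h.hasFDerivAt_N hzU).sub A.hasFDerivAt
    refine ⟨hd.differentiableAt, fun v hv => ?_⟩
    rw [hd.fderiv]
    exact sub_eq_zero.2 ((h.hasShape_iff hzU hzK A).1 hz v hv))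
  filter_upwards [h1, hUx, self_mem_nhdsWithin] with z hz hzU hzK
  rw [h.eq_n z ⟨hzK, hzU⟩]
  rw [h.eq_n x₀ ⟨hxK, hx₀⟩] at hw
  rw [hw] at hz
  rw [← sub_eq_iff_eq_add', hz]
  abel

/-- A surface with an elliptic point has an affine Gauss map `x ↦ k x + w`, with `k ≠ 0`. -/
theorem exists_gauss_eq_of_isEllipticAt (hr : r ≠ 0) (hK : HasNormalCharts K n)
    (hconn : IsPreconnected K) (hP : ParallelTangents K n r) (h : NormalChart K n U f N) {σ : ℝ}
    {x₀ : E3} (hx₀ : x₀ ∈ U) (hxK : x₀ ∈ K) (hell : IsEllipticAt N σ x₀) :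
    ∃ (k : ℝ) (w : E3), k ≠ 0 ∧ ∀ x ∈ K, n x = k • x + w := by
  have hlocal : ∀ {U : Set E3} {f : E3 → ℝ} {N : E3 → E3} {σ : ℝ} {x : E3},
      NormalChart K n U f N → x ∈ U → x ∈ K → IsEllipticAt N σ x →
      ∃ k : ℝ, ∀ᶠ z in 𝓝[K] x, HasShape K n (k • ContinuousLinearMap.id ℝ E3) z := by
    intro U f N σ x h hxU hxK hell
    have hUx : ∀ᶠ z in 𝓝 x, z ∈ U := h.isOpen.mem_nhds hxU
    obtain ⟨k, hk⟩ := h.eventually_umbilic_const hxU hxK (by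
      filter_upwards [nhdsWithin_le_nhds (h.eventually_isEllipticAt hxU hell),
        nhdsWithin_le_nhds hUx, self_mem_nhdsWithin] with z hz hzU hzK
      exact h.umbilic_of_isEllipticAt hr hK hP hzU hzK hz)
    refine ⟨k, ?_⟩
    filter_upwards [hk, nhdsWithin_le_nhds hUx, self_mem_nhdsWithin] with z hz hzU hzK
    rw [h.hasShape_iff hzU hzK]
    simpa using hz
  obtain ⟨k, hk⟩ := hlocal h hx₀ hxK hell
  have hkx := hk.self_of_nhdsWithin hxK
  obtain ⟨e, -, -, -, he, -, -, hNe, -⟩ := h.exists_principal hx₀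
  have he0 : e ≠ 0 := fun h0 => by simp [h0] at he
  have hk0 : k ≠ 0 := by
    rintro rfl
    have h1 := hell e he0 hNe
    rw [(h.hasShape_iff hx₀ hxK _).1 hkx e hNe] at h1
    simp at h1
  refine ⟨k, n x₀ - k • x₀, hk0, fun x hx => (forall_gauss_eq hK hconn
    (A := k • ContinuousLinearMap.id ℝ E3) ⟨x₀, hxK, by simp, hkx⟩ ?_ x hx).1⟩
  intro x hx hnx hsx
  obtain ⟨U', f', N', h', hxU'⟩ := hK x hx
  have hsx' := (h'.hasShape_iff hxU' hx _).1 hsx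
  have hell' : IsEllipticAt N' k x := by
    intro v hv0 hv
    rw [hsx' v hv]
    simp only [smul_apply, ContinuousLinearMap.id_apply, inner_smul_left,
      conj_trivial, real_inner_self_eq_norm_sq]
    have : 0 < ‖v‖ := norm_pos_iff.2 hv0
    have : 0 < k * k := mul_self_pos.2 hk0
    rw [← mul_assoc]
    positivity
  obtain ⟨k', hk'⟩ := hlocal h' hxU' hx hell'
  obtain ⟨e', -, -, -, he', -, -, hNe', -⟩ := h'.exists_principal hxU'
  have he0' : e' ≠ 0 := fun h0 => by simp [h0] at he'
  have hkk : k' = k := by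
    have h1 := (h'.hasShape_iff hxU' hx _).1 (hk'.self_of_nhdsWithin hx) e' hNe'
    rw [hsx' e' hNe'] at h1
    exact (smul_left_injective ℝ he0' h1).symm
  rw [hkk] at hk'
  exact (h'.eventually_gauss_eq hxU' hx hk' hnx).and hk'

end

section

variable {K U : Set E3} {n N : E3 → E3} {f : E3 → ℝ} {r : ℝ}

/-! ### Surfaces that contain a direction of lines -/

/-- For a unit vector `d`, the orthogonal projection along the axis direction `d`; the identity for
`d = 0`. -/
noncomputable def axisProj (d : E3) : E3 →L[ℝ] E3 :=
  ContinuousLinearMap.id ℝ E3 - (innerSL ℝ d).smulRight d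

theorem axisProj_apply (d x : E3) : axisProj d x = x - (inner ℝ d x : ℝ) • d := rfl

theorem axisProj_of_inner_eq_zero {d x : E3} (h : inner ℝ d x = 0) : axisProj d x = x := by
  rw [axisProj_apply, h, zero_smul, sub_zero]

theorem inner_axis_eq_zero (hK : HasNormalCharts K n) {d : E3}
    (hline : ∀ x ∈ K, ∀ t : ℝ, x + t • d ∈ K) {x : E3} (hx : x ∈ K) : inner ℝ (n x) d = 0 := by
  obtain ⟨U, f, N, h, hxU⟩ := hK x hx
  have hd : HasDerivAt (fun t : ℝ => x + t • d) d 0 := by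
    simpa using ((hasDerivAt_id (0 : ℝ)).smul_const d).const_add x
  have := h.inner_velocity (by simpa using hxU) (Eventually.of_forall fun t => hline x hx t) hd
  rw [h.eq_n x ⟨hx, hxU⟩]
  simpa using this

/-- The lines of the surface are asymptotic and principal: the shape operator kills them. -/
theorem NormalChart.fderiv_axis (hK : HasNormalCharts K n) (h : NormalChart K n U f N) {d : E3}
    (hline : ∀ x ∈ K, ∀ t : ℝ, x + t • d ∈ K) {x : E3} (hxU : x ∈ U) (hx : x ∈ K) :
    fderiv ℝ N x d = 0 := by
  have hNd : inner ℝ (N x) d = 0 := by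
    rw [← h.eq_n x ⟨hx, hxU⟩]; exact inner_axis_eq_zero hK hline hx
  have h1 := eq_inner_smul_of_forall_inner_eq_zero (h.norm_N x hxU) (b := fderiv ℝ N x d)
    fun v hv hxv => by
      obtain ⟨γ, T, κ, ε, hε, hγ, rfl, rfl⟩ := h.exists_curve hxU hx hv hxv
      have h0 : (0 : ℝ) ∈ Ioo (-ε) ε := ⟨by linarith, hε⟩
      have h2 := (h.hasDerivAt_normal hxU (hγ.eventually_mem h0) (hγ.hasDerivAt 0 h0)).inner ℝ
        (hasDerivAt_const (0 : ℝ) d)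
      have h3 : (fun s => (inner ℝ (n (γ s)) d : ℝ)) =ᶠ[𝓝 0] fun _ => 0 := by
        filter_upwards [hγ.eventually_mem h0] with s hs using inner_axis_eq_zero hK hline hs
      have h4 := h2.unique ((hasDerivAt_const (0 : ℝ) (0 : ℝ)).congr_of_eventuallyEq h3)
      rw [inner_zero_right, zero_add] at h4
      rw [h.fderiv_symm hxU hNd hxv, real_inner_comm]
      exact h4
  rw [h1, h.inner_fderiv hxU, zero_smul]

theorem normal_add_axis (hK : HasNormalCharts K n) {d : E3}
    (hline : ∀ x ∈ K, ∀ t : ℝ, x + t • d ∈ K) {x : E3} (hx : x ∈ K) (t : ℝ) :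
    n (x + t • d) = n x := by
  have hd : ∀ s : ℝ, HasDerivAt (fun t : ℝ => n (x + t • d)) 0 s := by
    intro s
    obtain ⟨U, f, N, h, hxU⟩ := hK _ (hline x hx s)
    have hd : HasDerivAt (fun t : ℝ => x + t • d) d s := by
      simpa using ((hasDerivAt_id s).smul_const d).const_add x
    have := h.hasDerivAt_normal hxU (Eventually.of_forall fun t => hline x hx t) hd
    rwa [h.fderiv_axis hK hline hxU (hline x hx s)] at this
  have := is_const_of_deriv_eq_zero (fun s => (hd s).differentiableAt) (fun s => (hd s).deriv) t 0
  simpa using this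

theorem HasShape.add_axis (hK : HasNormalCharts K n) {d : E3}
    (hline : ∀ x ∈ K, ∀ t : ℝ, x + t • d ∈ K) {A : E3 →L[ℝ] E3} {x : E3} (h : HasShape K n A x)
    (t : ℝ) : HasShape K n A (x + t • d) := by
  intro c v hc0 hc hd
  have h1 := h (fun s => c s + (-t) • d) v (by simp [hc0])
    (by filter_upwards [hc] with s hs using hline _ hs _) (hd.add_const _)
  refine h1.congr_of_eventuallyEq ?_
  filter_upwards [hc] with s hs using (normal_add_axis hK hline hs _).symm

theorem exists_hasShape_axisProj (hK : HasNormalCharts K n) {d : E3} (hd : ‖d‖ = 1)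
    (hline : ∀ x ∈ K, ∀ t : ℝ, x + t • d ∈ K) {x : E3} (hx : x ∈ K) :
    ∃ k : ℝ, HasShape K n (k • axisProj d) x := by
  obtain ⟨U, f, N, h, hxU⟩ := hK x hx
  have hNd : inner ℝ (N x) d = 0 := by
    rw [← h.eq_n x ⟨hx, hxU⟩]; exact inner_axis_eq_zero hK hline hx
  obtain ⟨e, he, hde, hNe⟩ := exists_unit_orthogonal d (N x)
  have hexp := eq_sum_of_orthonormal hd he (h.norm_N x hxU) hde
    (by rw [real_inner_comm]; exact hNd) (by rw [real_inner_comm]; exact hNe)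
  have hax := h.fderiv_axis hK hline hxU hx
  obtain ⟨k, hk⟩ : ∃ k : ℝ, fderiv ℝ N x e = k • e := by
    have h1 := hexp (fderiv ℝ N x e)
    rw [← h.fderiv_symm hxU hNd hNe, hax, h.inner_fderiv hxU, inner_zero_left] at h1
    rw [zero_smul, zero_smul, zero_add, add_zero] at h1
    exact ⟨_, h1⟩
  refine ⟨k, (h.hasShape_iff hxU hx _).2 fun v hv => ?_⟩
  have h2 := hexp v
  rw [hv, zero_smul, add_zero] at h2
  have h3 : axisProj d v = (inner ℝ e v : ℝ) • e := by
    rw [axisProj_apply, sub_eq_iff_eq_add']; exact h2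
  rw [smul_apply, h3]
  nth_rewrite 1 [h2]
  rw [map_add, map_smul, map_smul, hax, hk, smul_zero, zero_add, smul_comm]

/-- Along a geodesic that is oblique to the axis, a helix, the parallel transport of the unit
tangent of the projected curve determines the curvature of the cross section, which is therefore
constant. The direction `3/5 d + 4/5 e` is merely a unit vector oblique to the axis. -/
theorem hasShape_along_helix (hr : r ≠ 0) (hK : HasNormalCharts K n) (hP : ParallelTangents K n r)
    {d : E3} (hd : ‖d‖ = 1) (hline : ∀ x ∈ K, ∀ t : ℝ, x + t • d ∈ K) {γ T : ℝ → E3} {κ : ℝ → ℝ}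
    {ε : ℝ} (h : NormalGeodesic K n γ T κ ε) (hT : inner ℝ d (T 0) = 3 / 5) {k : ℝ}
    (hk : HasShape K n (k • axisProj d) (γ 0)) {t : ℝ} (ht : t ∈ Ioo (-ε) ε) :
    HasShape K n (k • axisProj d) (γ t) := by
  have h0 : (0 : ℝ) ∈ Ioo (-ε) ε := by constructor <;> linarith [ht.1, ht.2]
  obtain ⟨u, σ, μ, hu⟩ := hP ε γ T κ h
  have hnd : ∀ s ∈ Ioo (-ε) ε, inner ℝ d (n (γ s)) = 0 := fun s hs => by
    rw [real_inner_comm]; exact inner_axis_eq_zero hK hline (h.mem s hs)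
  have hTd : ∀ s ∈ Ioo (-ε) ε, inner ℝ d (T s) = 3 / 5 := by
    intro s hs
    rw [← hT]
    refine eq_of_hasDerivAt_zero_Ioo (g := fun s => (inner ℝ d (T s) : ℝ)) (fun τ hτ => ?_) hs
    refine ((hasDerivAt_const τ d).inner ℝ (h.hasDerivAt_velocity τ hτ)).congr_deriv ?_
    rw [inner_smul_right, hnd τ hτ]; simp
  have hud : ∀ s ∈ Ioo (-ε) ε, inner ℝ d (u s) = (inner ℝ d (u 0) : ℝ) := by
    intro s hs
    refine eq_of_hasDerivAt_zero_Ioo (g := fun s => (inner ℝ d (u s) : ℝ)) (fun τ hτ => ?_) hs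
    refine ((hasDerivAt_const τ d).inner ℝ (hu τ hτ).2.2.2.1).congr_deriv ?_
    rw [inner_smul_right, hnd τ hτ]; simp
  have huT : ∀ s ∈ Ioo (-ε) ε, inner ℝ (T s) (u s) = (inner ℝ (T 0) (u 0) : ℝ) := by
    intro s hs
    refine eq_of_hasDerivAt_zero_Ioo (g := fun s => (inner ℝ (T s) (u s) : ℝ)) (fun τ hτ => ?_) hs
    obtain ⟨-, -, hnu, hdu, -⟩ := hu τ hτ
    refine ((h.hasDerivAt_velocity τ hτ).inner ℝ hdu).congr_deriv ?_
    rw [inner_smul_right, inner_smul_left, hnu, real_inner_comm, h.inner_normal hK hτ]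
    simp
  -- The two components of `σ u = T - r l P T`, whose ratio is constant, determine `l`.
  have hcomp : ∀ s ∈ Ioo (-ε) ε, ∀ l : ℝ, HasShape K n (l • axisProj d) (γ s) →
      σ s * inner ℝ d (u 0) = 3 / 5 ∧ σ s * inner ℝ (T 0) (u 0) = 1 - r * l * (16 / 25) := by
    intro s hs l hl
    have hshift : HasDerivAt (fun τ => γ (τ + s)) (T s) 0 := by
      have h1 : HasDerivAt γ (T s) (0 + s) := by rw [zero_add]; exact h.hasDerivAt s hs
      exact h1.comp_add_const 0 s
    have htend : Tendsto (fun τ => τ + s) (𝓝 0) (𝓝 s) := by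
      have : Continuous fun τ => τ + s := by fun_prop
      simpa using this.tendsto 0
    have hm := hl (fun τ => γ (τ + s)) (T s) (by simp) (htend.eventually (h.eventually_mem hs))
      hshift
    have h2 : HasDerivAt (fun τ => γ τ - r • n (γ τ)) (σ s • u s) (0 + s) := by
      rw [zero_add]; exact (hu s hs).2.2.2.2
    have h3 := (h2.comp_add_const 0 s).unique (hshift.sub (hm.const_smul r))
    rw [smul_apply, axisProj_apply, hTd s hs] at h3
    have hdd : inner ℝ d d = (1 : ℝ) := by rw [real_inner_self_eq_norm_sq, hd, one_pow]
    have hTT : inner ℝ (T s) (T s) = (1 : ℝ) := by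
      rw [real_inner_self_eq_norm_sq, h.norm_velocity s hs, one_pow]
    constructor
    · have := congrArg (fun z => (inner ℝ d z : ℝ)) h3
      simp only [inner_sub_right, inner_smul_right, hTd s hs, hdd, hud s hs] at this
      rw [this]; ring
    · have := congrArg (fun z => (inner ℝ (T s) z : ℝ)) h3
      simp only [inner_sub_right, inner_smul_right, hTT, real_inner_comm d (T s), hTd s hs,
        huT s hs] at this
      rw [this]; ring
  obtain ⟨l, hl⟩ := exists_hasShape_axisProj hK hd hline (h.mem t ht)
  obtain ⟨h1, h2⟩ := hcomp t ht l hl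
  obtain ⟨h3, h4⟩ := hcomp 0 h0 k hk
  have hp : (inner ℝ d (u 0) : ℝ) ≠ 0 := fun hp => by rw [hp, mul_zero] at h1; norm_num at h1
  have hσ : σ t = σ 0 := mul_right_cancel₀ hp (h1.trans h3.symm)
  rw [hσ, h4] at h2
  have hlk : l = k := by
    have h5 : r * l = r * k := by linarith
    exact mul_left_cancel₀ hr h5
  rwa [hlk] at hl

/-- The Gauss map of a surface that contains a direction of lines is `x ↦ k P x + w`, where `P` is
the projection along the lines. -/
theorem exists_gauss_eq_of_line (hr : r ≠ 0) (hK : HasNormalCharts K n)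
    (hconn : IsConnected K) (hP : ParallelTangents K n r) {d : E3} (hd : ‖d‖ = 1)
    (hline : ∀ x ∈ K, ∀ t : ℝ, x + t • d ∈ K) :
    ∃ (k : ℝ) (w : E3), ∀ x ∈ K, n x = k • axisProj d x + w := by
  obtain ⟨x₀, hx₀⟩ := hconn.nonempty
  obtain ⟨k, hk⟩ := exists_hasShape_axisProj hK hd hline hx₀
  refine ⟨k, n x₀ - k • axisProj d x₀, fun x hx => (forall_gauss_eq hK hconn.isPreconnected
    (A := k • axisProj d) ⟨x₀, hx₀, by simp, hk⟩ ?_ x hx).1⟩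
  intro x hx hnx hsx
  obtain ⟨U, f, N, h, hxU⟩ := hK x hx
  have hNd : inner ℝ (N x) d = 0 := by
    rw [← h.eq_n x ⟨hx, hxU⟩]; exact inner_axis_eq_zero hK hline hx
  obtain ⟨e, he, hde, hNe⟩ := exists_unit_orthogonal d (N x)
  have hed : inner ℝ e d = (0 : ℝ) := by rw [real_inner_comm]; exact hde
  suffices hev : ∀ᶠ z in 𝓝[K] x, HasShape K n (k • axisProj d) z from
    (h.eventually_gauss_eq hxU hx hev hnx).and hev
  set v : E3 := (3 / 5 : ℝ) • d + (4 / 5 : ℝ) • e with hv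
  have hv1 : ‖v‖ = 1 := by
    rw [norm_eq_sqrt_real_inner, Real.sqrt_eq_one, hv]
    simp only [inner_add_left, inner_add_right, inner_smul_left, inner_smul_right, hed, hde,
      real_inner_self_eq_norm_sq, hd, he, conj_trivial]
    norm_num
  have hNv : inner ℝ (N x) v = 0 := by simp [hv, inner_add_right, inner_smul_right, hNd, hNe]
  have hdv : inner ℝ d v = 3 / 5 := by simp [hv, inner_add_right, inner_smul_right, hd, hde]
  have hev : inner ℝ e v = 4 / 5 := by simp [hv, inner_add_right, inner_smul_right, he, hed]
  obtain ⟨γ, T, κ, ε, hε, hγ, hγ0, hT0⟩ := h.exists_curve hxU hx hv1 hNv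
  have h0 : (0 : ℝ) ∈ Ioo (-ε) ε := ⟨by linarith, hε⟩
  -- The translates of the helix in the direction `d` cover a neighbourhood of `x` in `K`.
  obtain ⟨δ, φ, hδ, hφ, hcov⟩ := h.exists_graph hxU hx he hd hed hNe hNd univ_mem
  obtain ⟨O, hO, hOcov⟩ := mem_nhdsWithin_iff_exists_mem_nhds_inter.1 hcov
  obtain ⟨η, hη, hηO⟩ := Metric.mem_nhds_iff.1 hO
  have hinj : ∀ z ∈ Metric.ball x η ∩ K, ∀ z' ∈ Metric.ball x η ∩ K,
      inner ℝ e (z - x) = (inner ℝ e (z' - x) : ℝ) →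
      inner ℝ d (z - x) = (inner ℝ d (z' - x) : ℝ) → z = z' := by
    intro z hz z' hz' h1 h2
    obtain ⟨p, hp1, hp2, rfl⟩ := hOcov ⟨hηO hz.1, hz.2⟩
    obtain ⟨p', hp1', hp2', rfl⟩ := hOcov ⟨hηO hz'.1, hz'.2⟩
    have h3 := hφ p hp1 hp2
    have h4 := hφ p' hp1' hp2'
    rw [h3.2.2.2.1, h4.2.2.2.1] at h1
    rw [h3.2.2.2.2.1, h4.2.2.2.2.1] at h2
    rw [Prod.ext h1 h2]
  let g : ℝ → ℝ := fun t => inner ℝ e (γ t - x)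
  have hg : ∀ t ∈ Ioo (-ε) ε, HasDerivAt g (inner ℝ e (T t)) t := by
    intro t ht
    have := (hasDerivAt_const t e).inner ℝ ((hγ.hasDerivAt t ht).sub_const x)
    rwa [inner_zero_left, add_zero] at this
  have hgs : HasStrictDerivAt g (inner ℝ e (T 0)) 0 := by
    refine hasStrictDerivAt_of_hasDerivAt_of_continuousAt
      (f' := fun t => inner ℝ e (T t)) ?_ ?_
    · filter_upwards [isOpen_Ioo.mem_nhds h0] with t ht using hg t ht
    · exact continuousAt_const.inner (hγ.hasDerivAt_velocity 0 h0).continuousAt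
  have hmap := hgs.map_nhds_eq (by rw [hT0, hev]; norm_num)
  have hg0 : g 0 = 0 := by simp [g, hγ0]
  rw [hg0] at hmap
  have hsmall : Ioo (-ε) ε ∩ Metric.ball 0 (η / 4) ∈ 𝓝 (0 : ℝ) :=
    inter_mem (isOpen_Ioo.mem_nhds h0) (Metric.ball_mem_nhds _ (by positivity))
  have himg : g '' (Ioo (-ε) ε ∩ Metric.ball 0 (η / 4)) ∈ 𝓝 (0 : ℝ) := by
    rw [← hmap]; exact image_mem_map hsmall
  have htend : Tendsto (fun z => (inner ℝ e (z - x) : ℝ)) (𝓝 x) (𝓝 0) := by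
    have : Continuous fun z => (inner ℝ e (z - x) : ℝ) := by fun_prop
    simpa using this.tendsto x
  filter_upwards [nhdsWithin_le_nhds (htend.eventually himg), self_mem_nhdsWithin,
    nhdsWithin_le_nhds (Metric.ball_mem_nhds x (show 0 < η / 4 by positivity))]
    with z ⟨t, ⟨ht, htη⟩, hgt⟩ hzK hzx
  have hdist : dist (γ t) x < η / 4 := by
    have h1 := hγ.dist_le ht
    rw [hγ0] at h1
    rw [mem_ball_zero_iff, Real.norm_eq_abs] at htη
    linarith
  have hz : z = γ t + (inner ℝ d (z - γ t) : ℝ) • d := by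
    refine hinj z ⟨Metric.ball_subset_ball (by linarith) hzx, hzK⟩ _
      ⟨?_, hline _ (hγ.mem t ht) _⟩ ?_ ?_
    · have h1 : ‖(inner ℝ d (z - γ t) : ℝ) • d‖ ≤ dist z (γ t) := by
        rw [norm_smul, hd, mul_one, dist_eq_norm]
        simpa [hd] using abs_real_inner_le_norm d (z - γ t)
      rw [Metric.mem_ball] at hzx ⊢
      have h2 : dist (γ t + (inner ℝ d (z - γ t) : ℝ) • d) (γ t) ≤ dist z (γ t) := by
        rw [dist_eq_norm, add_sub_cancel_left]; exact h1
      have h3 := dist_triangle_right z (γ t) x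
      have h4 := dist_triangle (γ t + (inner ℝ d (z - γ t) : ℝ) • d) (γ t) x
      linarith
    · rw [add_sub_right_comm, inner_add_right, inner_smul_right, hed, mul_zero, add_zero]
      exact hgt.symm
    · rw [add_sub_right_comm, inner_add_right, inner_smul_right, real_inner_self_eq_norm_sq, hd,
        ← sub_add_sub_cancel z (γ t) x, inner_add_right]
      ring
  rw [hz]
  exact (hasShape_along_helix hr hK hP hd hline hγ (by rw [hT0, hdv]) (by rw [hγ0]; exact hsx)
    ht).add_axis hK hline _

end

/-! ### Lines and elliptic points of convex surfaces -/

/-- The recession cone of a convex set. -/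
def recessionCone (B : Set E3) : Set E3 := {d | ∀ x ∈ B, ∀ t : ℝ, 0 ≤ t → x + t • d ∈ B}

theorem mem_recessionCone_of_ray {B : Set E3} (hB : IsClosed B) (hconv : Convex ℝ B) {b d : E3}
    (hray : ∀ t : ℝ, 0 ≤ t → b + t • d ∈ B) : d ∈ recessionCone B := by
  intro x hx t ht
  have htend : Tendsto (fun s : ℝ => x + t • d + s • (b - x)) (𝓝[>] 0) (𝓝 (x + t • d)) := by
    have : Continuous fun s : ℝ => x + t • d + s • (b - x) := by fun_prop
    have := this.tendsto 0
    rw [zero_smul, add_zero] at this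
    exact this.mono_left nhdsWithin_le_nhds
  refine hB.mem_of_tendsto htend ?_
  filter_upwards [Ioo_mem_nhdsGT (show (0 : ℝ) < 1 by norm_num)] with s hs
  have hmem := hconv hx (hray (t / s) (div_nonneg ht hs.1.le)) (by linarith [hs.2] : 0 ≤ 1 - s)
    hs.1.le (by ring)
  convert hmem using 1
  rw [smul_add, smul_smul, mul_div_cancel₀ _ hs.1.ne']
  module

theorem isClosed_recessionCone {B : Set E3} (hB : IsClosed B) : IsClosed (recessionCone B) := by
  have : recessionCone B = ⋂ x ∈ B, ⋂ t : ℝ, ⋂ _ : 0 ≤ t, {d | x + t • d ∈ B} := by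
    ext d; simp [recessionCone]
  rw [this]
  exact isClosed_biInter fun x _ => isClosed_iInter fun t => isClosed_iInter fun _ =>
    hB.preimage (by fun_prop)

theorem smul_mem_recessionCone {B : Set E3} {d : E3} (hd : d ∈ recessionCone B) {s : ℝ}
    (hs : 0 ≤ s) : s • d ∈ recessionCone B := fun x hx t ht => by
  rw [smul_smul]; exact hd x hx _ (mul_nonneg ht hs)

theorem add_mem_recessionCone {B : Set E3} {d e : E3} (hd : d ∈ recessionCone B)
    (he : e ∈ recessionCone B) : d + e ∈ recessionCone B := fun x hx t ht => by
  rw [smul_add, ← add_assoc]; exact he _ (hd x hx t ht) t ht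

/-- A linear functional that is positive on the nonzero vectors of a pointed recession cone. -/
theorem exists_pos_on_recessionCone {B : Set E3} (hB : IsClosed B)
    (hpointed : ∀ d ∈ recessionCone B, -d ∈ recessionCone B → d = 0) :
    ∃ u : E3, ∀ d ∈ recessionCone B, d ≠ 0 → 0 < (inner ℝ u d : ℝ) := by
  have hK : IsCompact (recessionCone B ∩ Metric.sphere 0 1) :=
    (isCompact_sphere 0 1).inter_left (isClosed_recessionCone hB)
  have hsep : ∀ d ∈ recessionCone B ∩ Metric.sphere 0 1, ∃ u : E3,
      (∀ a ∈ recessionCone B, 0 ≤ (inner ℝ u a : ℝ)) ∧ 0 < (inner ℝ u d : ℝ) := by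
    intro d hd
    have hnd : -d ∉ recessionCone B := fun h => by
      have := hd.2
      simp [hpointed d hd.1 h] at this
    have hconv : Convex ℝ (recessionCone B) := fun a ha b hb s t hs ht _ =>
      add_mem_recessionCone (smul_mem_recessionCone ha hs) (smul_mem_recessionCone hb ht)
    obtain ⟨g, s, hg, hgd⟩ :=
      geometric_hahn_banach_closed_point hconv (isClosed_recessionCone hB) hnd
    have hs : 0 < s := by
      have := hg _ (smul_mem_recessionCone hd.1 le_rfl)
      rwa [zero_smul, map_zero] at this
    refine ⟨(InnerProductSpace.toDual ℝ E3).symm (-g), fun a ha => ?_, ?_⟩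
    · rw [InnerProductSpace.toDual_symm_apply, neg_apply, neg_nonneg]
      by_contra! hpos
      have := hg _ (smul_mem_recessionCone ha (div_pos hs hpos).le)
      rw [map_smul, smul_eq_mul, div_mul_cancel₀ _ hpos.ne'] at this
      exact lt_irrefl _ this
    · rw [InnerProductSpace.toDual_symm_apply, neg_apply, ← map_neg]
      exact hs.trans hgd
  obtain ⟨u, -, hu⟩ := hK.induction_on (p := fun s => ∃ u : E3,
      (∀ a ∈ recessionCone B, 0 ≤ (inner ℝ u a : ℝ)) ∧
      ∀ d ∈ recessionCone B ∩ s, 0 < (inner ℝ u d : ℝ))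
    ⟨0, fun _ _ => by simp, fun d hd => absurd hd.2 (notMem_empty d)⟩
    (fun s t hst ⟨u, hu, hut⟩ => ⟨u, hu, fun d hd => hut d ⟨hd.1, hst hd.2⟩⟩)
    (fun s t ⟨u, hu, hus⟩ ⟨v, hv, hvt⟩ => ⟨u + v, fun a ha => by
      rw [inner_add_left]; exact add_nonneg (hu a ha) (hv a ha), fun d hd => by
      rw [inner_add_left]
      rcases hd.2 with h | h
      · exact add_pos_of_pos_of_nonneg (hus d ⟨hd.1, h⟩) (hv d hd.1)
      · exact add_pos_of_nonneg_of_pos (hu d hd.1) (hvt d ⟨hd.1, h⟩)⟩)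
    (fun d hd => by
      obtain ⟨u, hu, hud⟩ := hsep d hd
      exact ⟨{y | 0 < (inner ℝ u y : ℝ)}, mem_nhdsWithin_of_mem_nhds
        ((isOpen_lt continuous_const (by fun_prop)).mem_nhds hud), u, hu, fun a ha => ha.2⟩)
  refine ⟨u, fun d hd hd0 => ?_⟩
  have hnorm : 0 < ‖d‖ := norm_pos_iff.2 hd0
  have h1 := hu (‖d‖⁻¹ • d) (by
    have h2 := smul_mem_recessionCone hd (inv_nonneg.2 hnorm.le)
    exact ⟨h2, h2, by rw [mem_sphere_zero_iff_norm]; exact norm_smul_inv_norm hd0⟩)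
  rw [inner_smul_right] at h1
  exact (mul_pos_iff_of_pos_left (inv_pos.2 hnorm)).1 h1

/-- A functional that is positive on the recession cone cuts off bounded caps. -/
theorem isBounded_cap {B : Set E3} (hB : IsClosed B) (hconv : Convex ℝ B) {u : E3}
    (hu : ∀ d ∈ recessionCone B, d ≠ 0 → 0 < (inner ℝ u d : ℝ)) {b : E3} (hb : b ∈ B) (c : ℝ) :
    ∃ M : ℝ, ∀ y ∈ B, inner ℝ u (y - b) ≤ c → ‖y - b‖ ≤ M := by
  by_contra! hunb
  choose y hyB hyc hyM using fun m : ℕ => hunb ((m : ℝ) + 1)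
  have hpos : ∀ m, 0 < ‖y m - b‖ := fun m => lt_trans (by positivity) (hyM m)
  obtain ⟨d, hd, φ, hφ, hlim⟩ := (isCompact_sphere (0 : E3) 1).tendsto_subseq
    (x := fun m => ‖y m - b‖⁻¹ • (y m - b)) fun m => by
      rw [mem_sphere_zero_iff_norm]; exact norm_smul_inv_norm (norm_pos_iff.1 (hpos m))
  have hd0 : d ≠ 0 := fun h0 => by simp [h0] at hd
  have hφt : Tendsto (fun m => ((φ m : ℕ) : ℝ) + 1) atTop atTop :=
    tendsto_atTop_add_const_right _ _ (tendsto_natCast_atTop_atTop.comp hφ.tendsto_atTop)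
  have hrec : d ∈ recessionCone B := by
    refine mem_recessionCone_of_ray hB hconv (b := b) fun t ht => ?_
    have h1 : Tendsto (fun m => b + t • (‖y (φ m) - b‖⁻¹ • (y (φ m) - b))) atTop (𝓝 (b + t • d)) :=
      tendsto_const_nhds.add (hlim.const_smul t)
    refine hB.mem_of_tendsto h1 ?_
    filter_upwards [hφt.eventually_ge_atTop t] with m hm
    have h2 : t * ‖y (φ m) - b‖⁻¹ ≤ 1 := by
      rw [← div_eq_mul_inv, div_le_one (hpos _)]
      exact hm.trans (hyM _).le
    rw [smul_smul]
    exact hconv.add_smul_sub_mem hb (hyB _) ⟨mul_nonneg ht (inv_nonneg.2 (norm_nonneg _)), h2⟩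
  have h3 : Tendsto (fun m => (inner ℝ u (‖y (φ m) - b‖⁻¹ • (y (φ m) - b)) : ℝ)) atTop
      (𝓝 (inner ℝ u d)) := tendsto_const_nhds.inner hlim
  have h4 : Tendsto (fun m => |c| / (((φ m : ℕ) : ℝ) + 1)) atTop (𝓝 0) :=
    tendsto_const_nhds.div_atTop hφt
  have h5 : (inner ℝ u d : ℝ) ≤ 0 := by
    refine le_of_tendsto_of_tendsto' h3 h4 fun m => ?_
    rw [inner_smul_right, ← div_eq_inv_mul]
    calc inner ℝ u (y (φ m) - b) / ‖y (φ m) - b‖ ≤ |c| / ‖y (φ m) - b‖ := by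
          gcongr; exact (hyc _).trans (le_abs_self c)
      _ ≤ |c| / (((φ m : ℕ) : ℝ) + 1) := by
          gcongr; exact (hyM _).le
  exact absurd (hu d hrec hd0) (not_lt.2 h5)

/-- A closed convex set without lines touches the boundary of a ball that contains it locally: a
large ball through the tip of a cap. -/
theorem exists_frontier_isLocalMax_dist {B : Set E3} (hB : IsClosed B) (hconv : Convex ℝ B)
    (hne : B.Nonempty) (hpointed : ∀ d ∈ recessionCone B, -d ∈ recessionCone B → d = 0) :
    ∃ p ∈ frontier B, ∃ a : E3, ∀ᶠ y in 𝓝[B] p, dist y a ≤ dist p a := by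
  obtain ⟨u, hu⟩ := exists_pos_on_recessionCone hB hpointed
  obtain ⟨b, hb⟩ := hne
  obtain ⟨M, hM⟩ := isBounded_cap hB hconv hu hb 1
  let C : Set E3 := B ∩ {y | inner ℝ u (y - b) ≤ (1 : ℝ)}
  have hCc : IsCompact C := by
    refine (isCompact_closedBall b M).of_isClosed_subset (hB.inter ?_) fun y hy => ?_
    · exact isClosed_le (by fun_prop) continuous_const
    · rw [mem_closedBall_iff_norm]; exact hM y hy.1 hy.2
  have hbC : b ∈ C := ⟨hb, by simp⟩
  -- The centre is so far away that `b` is farther from it than all of the rim of the cap.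
  let a : E3 := b + (M ^ 2 + 1) • u
  obtain ⟨p, hpC, hmax⟩ := hCc.exists_isMaxOn ⟨b, hbC⟩
    (f := fun y => dist y a) (by fun_prop)
  have hmax' : ∀ y ∈ C, dist y a ≤ dist p a := fun y hy => hmax hy
  have hsq : ∀ y, dist y a ^ 2 = ‖y - b‖ ^ 2 - 2 * (M ^ 2 + 1) * inner ℝ u (y - b) +
      ((M ^ 2 + 1) * ‖u‖) ^ 2 := by
    intro y
    have h1 : y - a = (y - b) - (M ^ 2 + 1) • u := by simp only [a]; abel
    rw [dist_eq_norm, h1, norm_sub_sq_real, inner_smul_right, norm_smul, Real.norm_of_nonneg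
      (by positivity), real_inner_comm]
    ring
  have hlt : (inner ℝ u (p - b) : ℝ) < 1 := by
    by_contra! hge
    have h1 := hmax' b hbC
    have h2 : dist b a ^ 2 ≤ dist p a ^ 2 := by gcongr
    rw [hsq, hsq] at h2
    have h3 := hM p hpC.1 hpC.2
    have h4 : ‖p - b‖ ^ 2 ≤ M ^ 2 := by gcongr
    simp only [sub_self, norm_zero, inner_zero_right] at h2
    nlinarith
  have hev : ∀ᶠ y in 𝓝 p, (inner ℝ u (y - b) : ℝ) < 1 :=
    (by fun_prop : Continuous fun y => (inner ℝ u (y - b) : ℝ)).continuousAt.eventually_lt_const hlt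
  have hlocal : ∀ᶠ y in 𝓝[B] p, dist y a ≤ dist p a := by
    filter_upwards [self_mem_nhdsWithin, nhdsWithin_le_nhds hev] with y hy hyu
    exact hmax' y ⟨hy, hyu.le⟩
  refine ⟨p, ⟨subset_closure hpC.1, fun hint => ?_⟩, a, hlocal⟩
  -- `dist · a` has no interior local maximum: compare with `p ± s v` and add.
  rw [nhdsWithin_eq_nhds.2 (mem_interior_iff_mem_nhds.1 hint)] at hlocal
  obtain ⟨v, hv⟩ := exists_ne (0 : E3)
  have hpm : ∀ ε : ℝ, ∀ᶠ s : ℝ in 𝓝 0, dist (p + (ε * s) • v) a ≤ dist p a := by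
    intro ε
    have : Tendsto (fun s : ℝ => p + (ε * s) • v) (𝓝 0) (𝓝 p) := by
      have : Continuous fun s : ℝ => p + (ε * s) • v := by fun_prop
      simpa using this.tendsto 0
    exact this.eventually hlocal
  have hfreq : ∃ᶠ s : ℝ in 𝓝 0, s ≠ 0 :=
    (eventually_mem_nhdsWithin (s := ({0}ᶜ : Set ℝ)) (a := 0)).frequently.filter_mono
      nhdsWithin_le_nhds
  obtain ⟨s, hs0, h1, h2⟩ := (hfreq.and_eventually ((hpm 1).and (hpm (-1)))).exists
  have h1' : dist (p + (1 * s) • v) a ^ 2 ≤ dist p a ^ 2 := by gcongr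
  have h2' : dist (p + (-1 * s) • v) a ^ 2 ≤ dist p a ^ 2 := by gcongr
  have hrw : ∀ ε : ℝ, dist (p + (ε * s) • v) a ^ 2 = dist p a ^ 2 +
      2 * (ε * s) * inner ℝ (p - a) v + (ε * s) ^ 2 * ‖v‖ ^ 2 := by
    intro ε
    rw [dist_eq_norm, add_sub_right_comm, norm_add_sq_real, inner_smul_right, norm_smul,
      Real.norm_eq_abs, mul_pow, sq_abs, ← dist_eq_norm]
    ring
  rw [hrw] at h1' h2'
  have h3 : 0 < s ^ 2 * ‖v‖ ^ 2 := by
    have := norm_pos_iff.2 hv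
    positivity
  nlinarith

/-- A surface is elliptic where it touches a sphere from inside. -/
theorem NormalChart.isEllipticAt_of_isLocalMax_dist {K U : Set E3} {n N : E3 → E3} {f : E3 → ℝ}
    (hK : HasNormalCharts K n) (h : NormalChart K n U f N) {p a : E3} (hpU : p ∈ U) (hp : p ∈ K)
    (hmax : ∀ᶠ y in 𝓝[K] p, dist y a ≤ dist p a) : IsEllipticAt N (inner ℝ (p - a) (N p)) p := by
  have hunit : ∀ v : E3, ‖v‖ = 1 → inner ℝ (N p) v = 0 →
      1 ≤ inner ℝ (p - a) (N p) * inner ℝ (fderiv ℝ N p v) v := by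
    intro v hv hNv
    obtain ⟨γ, T, κ, ε, hε, hγ, rfl, rfl⟩ := h.exists_curve hpU hp hv hNv
    have h0 : (0 : ℝ) ∈ Ioo (-ε) ε := ⟨by linarith, hε⟩
    let g : ℝ → ℝ := fun t => inner ℝ (γ t - a) (γ t - a)
    have hg : ∀ t ∈ Ioo (-ε) ε, HasDerivAt g (2 * inner ℝ (γ t - a) (T t)) t := by
      intro t ht
      have h1 := (hγ.hasDerivAt t ht).sub_const a
      refine (h1.inner ℝ h1).congr_deriv ?_
      rw [real_inner_comm (T t)]; ring
    have hdg : deriv g =ᶠ[𝓝 0] fun t => 2 * inner ℝ (γ t - a) (T t) := by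
      filter_upwards [isOpen_Ioo.mem_nhds h0] with t ht using (hg t ht).deriv
    have hdd : HasDerivAt (deriv g) (2 * (inner ℝ (γ 0 - a) (-(κ 0) • n (γ 0)) + 1)) 0 := by
      have h1 := ((hγ.hasDerivAt 0 h0).sub_const a).inner ℝ (hγ.hasDerivAt_velocity 0 h0)
      rw [real_inner_self_eq_norm_sq, hγ.norm_velocity 0 h0, one_pow] at h1
      exact (h1.const_mul 2).congr_of_eventuallyEq hdg
    have hgmax : IsLocalMax g 0 := by
      have h1 : Tendsto γ (𝓝 0) (𝓝[K] (γ 0)) :=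
        tendsto_nhdsWithin_iff.2 ⟨(hγ.hasDerivAt 0 h0).continuousAt, hγ.eventually_mem h0⟩
      filter_upwards [h1.eventually hmax] with t ht
      simp only [g, real_inner_self_eq_norm_sq, ← dist_eq_norm]
      gcongr
    by_contra! hlt
    have hκ := hγ.curvature_eq hK h h0 hpU
    have hpos : 0 < deriv (deriv g) 0 := by
      rw [hdd.deriv, inner_smul_right, h.eq_n _ ⟨hp, hpU⟩, hκ]
      nlinarith
    have hmin : IsLocalMin g 0 :=
      isLocalMin_of_deriv_deriv_pos hpos hgmax.deriv_eq_zero (hg 0 h0).continuousAt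
    have hconst : g =ᶠ[𝓝 0] fun _ => g 0 := by
      filter_upwards [hgmax, hmin] with t h1 h2 using le_antisymm h1 h2
    rw [(hconst.deriv.deriv).eq_of_nhds] at hpos
    simp at hpos
  intro v hv0 hNv
  have h1 := hunit (‖v‖⁻¹ • v) (norm_smul_inv_norm hv0) (by rw [inner_smul_right, hNv, mul_zero])
  rw [map_smul, inner_smul_left, inner_smul_right, conj_trivial] at h1
  have h2 : 0 < ‖v‖⁻¹ * ‖v‖⁻¹ := by
    have := norm_pos_iff.2 hv0
    positivity
  refine (mul_pos_iff_of_pos_left h2).1 ?_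
  linarith

/-- The Gauss map of a convex surface along which the normal displacement preserves geodesics is
`x ↦ k P x + w`, where `P` is either the identity or the projection along a direction of lines. -/
theorem exists_gauss_eq {K : Set E3} {n : E3 → E3} {r : ℝ} (hr : r ≠ 0) (hK : HasNormalCharts K n)
    (hconn : IsConnected K) (hP : ParallelTangents K n r) {B : Set E3} (hB : IsClosed B)
    (hconv : Convex ℝ B) (hKB : K = frontier B) :
    ∃ (d : E3) (k : ℝ) (w : E3), (d = 0 ∧ k ≠ 0 ∨ ‖d‖ = 1) ∧
      (∀ x ∈ K, n x = k • axisProj d x + w) ∧ ∀ x ∈ K, inner ℝ (n x) d = 0 := by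
  have hKsub : K ⊆ B := by rw [hKB]; exact hB.frontier_subset
  by_cases hpointed : ∀ d ∈ recessionCone B, -d ∈ recessionCone B → d = 0
  · obtain ⟨p, hp, a, hmax⟩ := exists_frontier_isLocalMax_dist hB hconv
      (hconn.nonempty.mono hKsub) hpointed
    rw [← hKB] at hp
    obtain ⟨U, f, N, h, hpU⟩ := hK p hp
    have hell := h.isEllipticAt_of_isLocalMax_dist hK hpU hp
      (hmax.filter_mono (nhdsWithin_mono p hKsub))
    obtain ⟨k, w, hk, hkw⟩ := exists_gauss_eq_of_isEllipticAt hr hK hconn.isPreconnected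
      hP h hpU hp hell
    refine ⟨0, k, w, Or.inl ⟨rfl, hk⟩, fun x hx => ?_, fun x _ => inner_zero_right _⟩
    rw [hkw x hx, axisProj_of_inner_eq_zero (inner_zero_left x)]
  · push Not at hpointed
    obtain ⟨d, hd, hd', hd0⟩ := hpointed
    set e := ‖d‖⁻¹ • d with he
    have he1 : ‖e‖ = 1 := norm_smul_inv_norm hd0
    have hline : ∀ x ∈ B, ∀ t : ℝ, x + t • e ∈ B := by
      intro x hx t
      rcases le_total 0 t with ht | ht
      · exact smul_mem_recessionCone hd (inv_nonneg.2 (norm_nonneg d)) x hx t ht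
      · have := smul_mem_recessionCone hd' (inv_nonneg.2 (norm_nonneg d)) x hx (-t) (by linarith)
        rwa [smul_neg, smul_neg, neg_smul, neg_neg] at this
    have hlineK : ∀ x ∈ K, ∀ t : ℝ, x + t • e ∈ K := by
      intro x hx t
      have hpre : (Homeomorph.addRight (t • e)) ⁻¹' B = B := by
        ext y
        refine ⟨fun hy => ?_, fun hy => hline y hy t⟩
        have := hline _ hy (-t)
        simpa using this
      have h1 := (Homeomorph.addRight (t • e)).preimage_frontier B
      rw [hpre] at h1
      rw [hKB] at hx ⊢
      rw [← h1] at hx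
      exact hx
    obtain ⟨k, w, hkw⟩ := exists_gauss_eq_of_line hr hK hconn hP he1 hlineK
    exact ⟨e, k, w, Or.inr he1, hkw, fun x hx => inner_axis_eq_zero hK hlineK hx⟩

/-! ### Frontiers that lie in a separating surface -/

/-- If the frontier of `B` lies in `S`, and `S` is the common boundary of two connected sets that
make up its complement, then the frontier of `B` is all of `S`. -/
theorem subset_frontier_of_separates {X : Type*} [TopologicalSpace X] {B S V W : Set X}
    (hB : IsClosed B) (hint : (interior B).Nonempty) (hne : (frontier B).Nonempty)
    (hsub : frontier B ⊆ S) (hcov : Sᶜ ⊆ V ∪ W) (hV : IsPreconnected V) (hW : IsPreconnected W)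
    (hVd : V ⊆ Sᶜ) (hWd : W ⊆ Sᶜ) (hVcl : S ⊆ closure V) (hWcl : S ⊆ closure W) :
    S ⊆ frontier B := by
  have hside : ∀ A, IsPreconnected A → A ⊆ Sᶜ → A ⊆ interior B ∨ A ⊆ Bᶜ := by
    intro A hA hAd
    refine hA.subset_or_subset isOpen_interior hB.isOpen_compl ?_ fun x hx => ?_
    · exact disjoint_compl_right_iff_subset.2 interior_subset
    · by_contra hcon
      rw [mem_union, not_or, mem_compl_iff, not_not] at hcon
      exact hAd hx (hsub ⟨subset_closure hcon.2, hcon.1⟩)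
  have hmixed : ∀ A A', A ⊆ interior B → A' ⊆ Bᶜ → S ⊆ closure A → S ⊆ closure A' →
      S ⊆ frontier B := by
    intro A A' hA hA' hcl hcl' x hx
    rw [frontier_eq_closure_inter_closure]
    exact ⟨closure_mono (hA.trans interior_subset) (hcl hx), closure_mono hA' (hcl' hx)⟩
  rcases hside V hV hVd with h1 | h1 <;> rcases hside W hW hWd with h2 | h2
  · have huniv : B = univ := by
      refine eq_univ_of_forall fun x => ?_
      by_cases hx : x ∈ S
      · exact hB.closure_subset_iff.2 (h1.trans interior_subset) (hVcl hx)
      · exact (hcov hx).elim (fun h => interior_subset (h1 h)) fun h => interior_subset (h2 h)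
    rw [huniv, frontier_univ] at hne
    exact absurd hne not_nonempty_empty
  · exact hmixed V W h1 h2 hVcl hWcl
  · exact hmixed W V h2 h1 hWcl hVcl
  · obtain ⟨x, hx⟩ := hint
    have hxS : x ∈ S := by
      by_contra hx'
      exact (hcov hx').elim (fun h => h1 h (interior_subset hx)) fun h => h2 h (interior_subset hx)
    obtain ⟨y, hy, hyV⟩ := mem_closure_iff.1 (hVcl hxS) _ isOpen_interior hx
    exact absurd (interior_subset hy) (h1 hyV)

/-- A closed set with non-empty interior whose boundary is non-empty and lies in a plane has this
whole plane as its boundary. -/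
theorem frontier_eq_plane_of_subset {B : Set E3} {w : E3} {c : ℝ} (hw : w ≠ 0) (hB : IsClosed B)
    (hint : (interior B).Nonempty) (hne : (frontier B).Nonempty)
    (hsub : frontier B ⊆ {x | inner ℝ w x = c}) : frontier B = {x | inner ℝ w x = c} := by
  have hww : 0 < (inner ℝ w w : ℝ) := real_inner_self_pos.2 hw
  have hlin : IsLinearMap ℝ fun x : E3 => (inner ℝ w x : ℝ) := (innerSL ℝ w).toLinearMap.isLinear
  have hcl : ∀ x, inner ℝ w x = c → ∀ σ : ℝ,
      Tendsto (fun t : ℝ => x + (t * σ) • w) (𝓝[>] 0) (𝓝 x) := by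
    intro x _ σ
    have : Continuous fun t : ℝ => x + (t * σ) • w := by fun_prop
    have := this.tendsto 0
    rw [zero_mul, zero_smul, add_zero] at this
    exact this.mono_left nhdsWithin_le_nhds
  refine hsub.antisymm (subset_frontier_of_separates (V := {x | inner ℝ w x < c})
    (W := {x | c < inner ℝ w x}) hB hint hne hsub (fun x hx => lt_or_gt_of_ne hx)
    (convex_halfSpace_lt hlin c).isPreconnected (convex_halfSpace_gt hlin c).isPreconnected
    (fun x hx => ne_of_lt hx) (fun x hx => ne_of_gt hx) (fun x hx => ?_) fun x hx => ?_)
  · refine mem_closure_of_tendsto (hcl x hx (-1)) ?_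
    filter_upwards [self_mem_nhdsWithin] with t ht
    rw [mem_ofPred_eq] at hx
    rw [inner_add_right, inner_smul_right, hx]
    nlinarith [mul_pos ht hww]
  · refine mem_closure_of_tendsto (hcl x hx 1) ?_
    filter_upwards [self_mem_nhdsWithin] with t ht
    rw [mem_ofPred_eq] at hx
    rw [inner_add_right, inner_smul_right, hx]
    nlinarith [mul_pos ht hww]

/-- A connected boundary of a convex set that contains a plane is that plane. -/
theorem frontier_eq_plane_of_superset {B : Set E3} {w : E3} {c : ℝ} (hw : w ≠ 0) (hB : IsClosed B)
    (hconv : Convex ℝ B) (hconn : IsPreconnected (frontier B))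
    (hsup : {x | inner ℝ w x = c} ⊆ frontier B) : frontier B = {x | inner ℝ w x = c} := by
  refine Subset.antisymm (fun y hy => ?_) hsup
  by_contra hyc
  rw [mem_ofPred_eq] at hyc
  set a : ℝ := inner ℝ w y with ha
  have hac : a - c ≠ 0 := sub_ne_zero.2 hyc
  have hww : (inner ℝ w w : ℝ) ≠ 0 := (real_inner_self_pos.2 hw).ne'
  have hh : inner ℝ w ((c / inner ℝ w w) • w) = c := by
    rw [inner_smul_right, div_mul_cancel₀ _ hww]
  -- The open slab between the plane and the point `y` is interior.
  have hslab : {x : E3 | (inner ℝ w x - c) / (a - c) ∈ Ioo (0 : ℝ) 1} ⊆ interior B := by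
    refine interior_maximal (fun x hx => ?_) ?_
    · set l := (inner ℝ w x - c) / (a - c) with hl
      have hl1 : 1 - l ≠ 0 := by linarith [hx.2]
      have hlx : (inner ℝ w x : ℝ) = c + l * (a - c) := by
        rw [hl, div_mul_cancel₀ _ hac]; ring
      have hz : (1 - l)⁻¹ • (x - l • y) ∈ B := by
        refine hB.frontier_subset (hsup ?_)
        rw [mem_ofPred_eq, inner_smul_right, inner_sub_right, inner_smul_right, hlx, ← ha]
        field_simp
        ring
      have := hconv hz (hB.frontier_subset hy) (by linarith [hx.2] : 0 ≤ 1 - l) hx.1.le (by ring)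
      rwa [smul_inv_smul₀ hl1, sub_add_cancel] at this
    · exact isOpen_Ioo.preimage (by fun_prop)
  have hord := (hconn.image (fun x => (inner ℝ w x : ℝ)) (by fun_prop)).ordConnected
  have hmid : (a + c) / 2 ∈ (fun x => (inner ℝ w x : ℝ)) '' frontier B := by
    refine hord.uIcc_subset ⟨y, hy, rfl⟩ ⟨_, hsup hh, hh⟩ ?_
    change (a + c) / 2 ∈ uIcc a c
    rw [mem_uIcc]
    rcases le_total a c with h | h
    · exact Or.inl ⟨by linarith, by linarith⟩
    · exact Or.inr ⟨by linarith, by linarith⟩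
  obtain ⟨z, hz, hzm⟩ := hmid
  refine hz.2 (hslab ?_)
  have : (inner ℝ w z - c) / (a - c) = 1 / 2 := by
    rw [show (inner ℝ w z : ℝ) = (a + c) / 2 from hzm]
    field_simp
    ring
  rw [mem_ofPred_eq, this]
  norm_num

/-! ### Spheres and round cylinders -/

theorem inner_axisProj {d : E3} (hd : d = 0 ∨ ‖d‖ = 1) (x : E3) :
    inner ℝ d (axisProj d x) = 0 := by
  rw [axisProj_apply, inner_sub_right, inner_smul_right, real_inner_self_eq_norm_sq]
  rcases hd with rfl | hd
  · simp
  · rw [hd]; ring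

theorem axisProj_axisProj {d : E3} (hd : d = 0 ∨ ‖d‖ = 1) (x : E3) :
    axisProj d (axisProj d x) = axisProj d x :=
  axisProj_of_inner_eq_zero (inner_axisProj hd x)

theorem mem_roundCylinder {p d : E3} {R : ℝ} {x : E3} :
    x ∈ roundCylinder p d R ↔ ‖axisProj d (x - p)‖ = R := Iff.rfl

theorem roundCylinder_zero (p : E3) (R : ℝ) : roundCylinder p 0 R = Metric.sphere p R := by
  ext x
  rw [mem_roundCylinder, axisProj_of_inner_eq_zero (inner_zero_left _), mem_sphere_iff_norm]

theorem isPreconnected_axisProj_ne_zero (d : E3) : IsPreconnected {y : E3 | axisProj d y ≠ 0} := by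
  have hcodim : 1 < Module.rank ℝ (E3 ⧸ (axisProj d).toLinearMap.ker) := by
    rw [(axisProj d).toLinearMap.quotKerEquivRange.rank_eq, ← Module.finrank_eq_rank]
    obtain ⟨e₁, he₁, hd₁, -⟩ := exists_unit_orthogonal d d
    obtain ⟨e₂, he₂, hd₂, he⟩ := exists_unit_orthogonal d e₁
    have hli : LinearIndependent ℝ ![e₁, e₂] := by
      refine (linearIndependent_fin2).2 ⟨fun h => ?_, fun a h => ?_⟩
      · simp at h; simp [h] at he₂
      · have : (inner ℝ e₁ e₁ : ℝ) = 0 := by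
          simp at h
          nth_rewrite 2 [← h]
          rw [inner_smul_right, he, mul_zero]
        rw [inner_self_eq_zero] at this
        simp [this] at he₁
    have hspan : Submodule.span ℝ (range ![e₁, e₂]) ≤ (axisProj d).toLinearMap.range := by
      rw [Submodule.span_le]
      rintro _ ⟨i, rfl⟩
      fin_cases i
      · exact ⟨e₁, axisProj_of_inner_eq_zero hd₁⟩
      · exact ⟨e₂, axisProj_of_inner_eq_zero hd₂⟩
    have h2 := Submodule.finrank_mono hspan
    rw [finrank_span_eq_card hli, Fintype.card_fin] at h2
    exact_mod_cast h2
  exact (isConnected_compl_of_one_lt_codim hcodim).isPreconnected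

theorem axisProj_add_smul {d : E3} (hd : d = 0 ∨ ‖d‖ = 1) (z : E3) (a : ℝ) :
    axisProj d (z + a • axisProj d z) = (1 + a) • axisProj d z := by
  rw [map_add, map_smul, axisProj_axisProj hd, add_smul, one_smul]

theorem norm_axisProj_add {d z : E3} {a : ℝ} (hd : d = 0 ∨ ‖d‖ = 1) :
    ‖axisProj d (z + a • axisProj d z)‖ = |1 + a| * ‖axisProj d z‖ := by
  rw [axisProj_add_smul hd, norm_smul, Real.norm_eq_abs]

theorem isPreconnected_exterior {p d : E3} {R : ℝ} (hd : d = 0 ∨ ‖d‖ = 1) (hR : 0 < R) :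
    IsPreconnected {x : E3 | R < ‖axisProj d (x - p)‖} := by
  have himage : {x : E3 | R < ‖axisProj d (x - p)‖} =
      (fun y => p + (y + (R / ‖axisProj d y‖) • axisProj d y)) '' {y | axisProj d y ≠ 0} := by
    ext x
    constructor
    · intro hx
      rw [mem_ofPred_eq] at hx
      set z := x - p with hz
      have hz0 : ‖axisProj d z‖ ≠ 0 := (hR.trans hx).ne'
      have h1 : 0 < 1 + -(R / ‖axisProj d z‖) := by
        have := (div_lt_one (hR.trans hx)).2 hx
        linarith
      have hy : axisProj d (z + (-(R / ‖axisProj d z‖)) • axisProj d z) =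
          (1 + -(R / ‖axisProj d z‖)) • axisProj d z := axisProj_add_smul hd _ _
      refine ⟨z + (-(R / ‖axisProj d z‖)) • axisProj d z, ?_, ?_⟩
      · rw [mem_ofPred_eq, hy]
        exact smul_ne_zero h1.ne' (norm_ne_zero_iff.1 hz0)
      · beta_reduce
        rw [hy, norm_smul, Real.norm_of_nonneg h1.le, smul_smul]
        have : R / ((1 + -(R / ‖axisProj d z‖)) * ‖axisProj d z‖) * (1 + -(R / ‖axisProj d z‖)) =
            R / ‖axisProj d z‖ := by
          rw [div_mul_eq_mul_div, mul_comm R, mul_div_mul_left _ _ h1.ne']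
        rw [this, neg_smul, neg_add_cancel_right, hz, add_sub_cancel]
    · rintro ⟨y, hy, rfl⟩
      have hy0 : 0 < ‖axisProj d y‖ := norm_pos_iff.2 hy
      rw [mem_ofPred_eq, add_sub_cancel_left, norm_axisProj_add hd, abs_of_pos (by positivity),
        add_mul, div_mul_cancel₀ _ hy0.ne']
      linarith
  rw [himage]
  refine (isPreconnected_axisProj_ne_zero d).image _ ?_
  refine continuousOn_const.add (continuousOn_id.add (ContinuousOn.fun_smul ?_ ?_))
  · exact continuousOn_const.div (axisProj d).continuous.norm.continuousOn
      fun y hy => norm_ne_zero_iff.2 hy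
  · exact (axisProj d).continuous.continuousOn

/-- A closed set with non-empty interior whose boundary lies in a sphere or a round cylinder has
this whole surface as its boundary. -/
theorem frontier_eq_roundCylinder_of_subset {B : Set E3} {p d : E3} {R : ℝ}
    (hd : d = 0 ∨ ‖d‖ = 1) (hR : 0 < R) (hB : IsClosed B) (hint : (interior B).Nonempty)
    (hne : (frontier B).Nonempty) (hsub : frontier B ⊆ roundCylinder p d R) :
    frontier B = roundCylinder p d R := by
  have hcl : ∀ x ∈ roundCylinder p d R, ∀ σ : ℝ,
      Tendsto (fun t : ℝ => x + (t * σ) • axisProj d (x - p)) (𝓝[>] 0) (𝓝 x) := by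
    intro x _ σ
    have : Continuous fun t : ℝ => x + (t * σ) • axisProj d (x - p) := by fun_prop
    have := this.tendsto 0
    rw [zero_mul, zero_smul, add_zero] at this
    exact this.mono_left nhdsWithin_le_nhds
  have hnorm : ∀ x ∈ roundCylinder p d R, ∀ t : ℝ,
      ‖axisProj d (x + t • axisProj d (x - p) - p)‖ = |1 + t| * R := by
    intro x hx t
    rw [add_sub_right_comm, norm_axisProj_add hd, mem_roundCylinder.1 hx]
  have hin : IsPreconnected {x : E3 | ‖axisProj d (x - p)‖ < R} := by
    have : {x : E3 | ‖axisProj d (x - p)‖ < R} = axisProj d ⁻¹' Metric.ball (axisProj d p) R := by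
      ext x; rw [mem_preimage, mem_ball_iff_norm, ← map_sub]; rfl
    rw [this]
    exact ((convex_ball _ _).linear_preimage (axisProj d).toLinearMap).isPreconnected
  refine hsub.antisymm (subset_frontier_of_separates (V := {x | ‖axisProj d (x - p)‖ < R})
    (W := {x | R < ‖axisProj d (x - p)‖}) hB hint hne hsub (fun x hx => lt_or_gt_of_ne hx)
    hin (isPreconnected_exterior hd hR)
    (fun x hx => ne_of_lt hx) (fun x hx => ne_of_gt hx) (fun x hx => ?_) fun x hx => ?_)
  · refine mem_closure_of_tendsto (hcl x hx (-1)) ?_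
    filter_upwards [Ioo_mem_nhdsGT (show (0 : ℝ) < 1 by norm_num)] with t ht
    rw [hnorm x hx, abs_of_pos (by linarith [ht.2])]
    nlinarith [mul_pos ht.1 hR]
  · refine mem_closure_of_tendsto (hcl x hx 1) ?_
    filter_upwards [self_mem_nhdsWithin] with t ht
    rw [mem_Ioi] at ht
    rw [hnorm x hx, abs_of_pos (by linarith)]
    nlinarith [mul_pos ht hR]

/-- The boundary of a convex set that contains a sphere or a round cylinder is this surface. -/
theorem frontier_eq_roundCylinder_of_superset {B : Set E3} {p d : E3} {R : ℝ}
    (hd : d = 0 ∨ ‖d‖ = 1) (hR : 0 < R) (hB : IsClosed B) (hconv : Convex ℝ B)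
    (hsup : roundCylinder p d R ⊆ frontier B) : frontier B = roundCylinder p d R := by
  -- Every point of the solid sphere or cylinder lies on a chord of the surface.
  have hsolid : ∀ x, ‖axisProj d (x - p)‖ ≤ R → x ∈ B := by
    intro x hx
    set z := axisProj d (x - p) with hz
    obtain ⟨m, hm, hdm, hzm⟩ : ∃ m : E3, ‖m‖ = 1 ∧ axisProj d m = m ∧ z = ‖z‖ • m := by
      rcases eq_or_ne z 0 with h0 | h0
      · obtain ⟨m, hm, hdm, -⟩ := exists_unit_orthogonal d d
        exact ⟨m, hm, axisProj_of_inner_eq_zero hdm, by rw [h0, norm_zero, zero_smul]⟩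
      · exact ⟨‖z‖⁻¹ • z, norm_smul_inv_norm h0, by rw [map_smul, hz, axisProj_axisProj hd],
          by rw [smul_inv_smul₀ (norm_ne_zero_iff.2 h0)]⟩
    have hmem : ∀ a : ℝ, |‖z‖ + a| = R → x + a • m ∈ B := by
      intro a ha
      refine hB.frontier_subset (hsup ?_)
      rw [mem_roundCylinder, add_sub_right_comm, map_add, map_smul, hdm, ← hz]
      nth_rewrite 1 [hzm]
      rw [← add_smul, norm_smul, hm, mul_one, Real.norm_eq_abs, ha]
    have h1 := hmem (R - ‖z‖) (by rw [add_sub_cancel, abs_of_pos hR])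
    have h2 := hmem (-(R + ‖z‖)) (by
      rw [show ‖z‖ + -(R + ‖z‖) = -R by ring, abs_neg, abs_of_pos hR])
    have h3 := hconv h1 h2 (a := (R + ‖z‖) / (2 * R)) (b := (R - ‖z‖) / (2 * R))
      (by positivity) (div_nonneg (by linarith) (by linarith)) (by field_simp; ring)
    convert h3 using 1
    have h4 : (R + ‖z‖) / (2 * R) + (R - ‖z‖) / (2 * R) = 1 := by field_simp; ring
    have h5 : (R + ‖z‖) / (2 * R) * (R - ‖z‖) + (R - ‖z‖) / (2 * R) * -(R + ‖z‖) = 0 := by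
      field_simp; ring
    calc x = (1 : ℝ) • x + (0 : ℝ) • m := by rw [one_smul, zero_smul, add_zero]
      _ = _ := by rw [← h4, ← h5]; module
  have hinner : {x | ‖axisProj d (x - p)‖ < R} ⊆ interior B :=
    interior_maximal (fun x hx => hsolid x (le_of_lt hx))
      (isOpen_lt (by fun_prop) continuous_const)
  refine Subset.antisymm (fun y hy => ?_) hsup
  rcases lt_trichotomy ‖axisProj d (y - p)‖ R with h | h | h
  · exact absurd (hinner h) hy.2
  · exact h
  -- Otherwise a point of the surface would be interior, between `y` and a point of the axis.
  · exfalso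
    set z := axisProj d (y - p) with hz
    have hz0 : 0 < ‖z‖ := hR.trans h
    have hax : y - z ∈ interior B := by
      refine hinner ?_
      rw [mem_ofPred_eq, sub_right_comm, map_sub, hz, axisProj_axisProj hd, sub_self, norm_zero]
      exact hR
    have hlt : R / ‖z‖ < 1 := (div_lt_one hz0).2 h
    have h1 := hconv.combo_interior_self_mem_interior hax (hB.frontier_subset hy)
      (a := 1 - R / ‖z‖) (b := R / ‖z‖) (by linarith) (by positivity) (by ring)
    refine (hsup (?_ : _ ∈ roundCylinder p d R)).2 h1
    have h2 : (1 - R / ‖z‖) • (y - z) + (R / ‖z‖) • y - p = (y - p) + (-(1 - R / ‖z‖)) • z := by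
      module
    rw [mem_roundCylinder, h2, hz, norm_axisProj_add hd, ← hz,
      show 1 + -(1 - R / ‖z‖) = R / ‖z‖ by ring, abs_of_pos (by positivity),
      div_mul_cancel₀ _ hz0.ne']

/-! ### Identification of the two surfaces -/

/-- The normal displacement cannot collapse the cross section: `r k = 1` would make the projection
singular along the tangent direction orthogonal to the axis. -/
theorem one_sub_mul_ne_zero {K : Set E3} {n : E3 → E3} {d w : E3} {r k : ℝ}
    (hK : HasNormalCharts K n) (hne : K.Nonempty) (hP : ParallelTangents K n r)
    (hn : ∀ x ∈ K, n x = k • axisProj d x + w) : 1 - r * k ≠ 0 := by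
  intro h0
  obtain ⟨x, hx⟩ := hne
  obtain ⟨U, f, N, h, hxU⟩ := hK x hx
  obtain ⟨e, he, hde, hNe⟩ := exists_unit_orthogonal d (N x)
  obtain ⟨γ, T, κ, ε, hε, hγ, rfl, rfl⟩ := h.exists_curve hxU hx he hNe
  have h0' : (0 : ℝ) ∈ Ioo (-ε) ε := ⟨by linarith, hε⟩
  obtain ⟨u, σ, μ, hu⟩ := hP ε γ T κ hγ
  obtain ⟨hu1, hσ, -, -, hd⟩ := hu 0 h0'
  have h1 := hγ.hasDerivAt 0 h0'
  have h2 : HasDerivAt (fun s => γ s - r • (k • axisProj d (γ s) + w))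
      (T 0 - r • (k • axisProj d (T 0))) 0 :=
    h1.sub ((((axisProj d).hasFDerivAt.comp_hasDerivAt 0 h1).const_smul k
      |>.add_const w).const_smul r)
  have h3 := hd.unique (h2.congr_of_eventuallyEq (by
    filter_upwards [hγ.eventually_mem h0'] with s hs
    rw [hn _ hs]))
  have h4 : T 0 - (r * k) • T 0 = (1 - r * k) • T 0 := by rw [sub_smul, one_smul]
  rw [axisProj_of_inner_eq_zero hde, smul_smul, h4, h0, zero_smul] at h3
  rcases smul_eq_zero.1 h3 with h | h
  · exact hσ h
  · rw [h, norm_zero] at hu1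
    exact zero_ne_one hu1

/-- A connected surface with constant unit normal lies in a plane. -/
theorem exists_subset_plane {K : Set E3} {n : E3 → E3} {w : E3} (hK : HasNormalCharts K n)
    (hconn : IsConnected K) (hn : ∀ x ∈ K, n x = w) : ∃ c : ℝ, ∀ x ∈ K, inner ℝ w x = c := by
  obtain ⟨x₀, hx₀⟩ := hconn.nonempty
  refine ⟨inner ℝ w x₀, hconn.isPreconnected.forall_of_locally ⟨x₀, hx₀, rfl⟩ (fun x hx hp => ?_)
    fun x hx hfreq => ?_⟩
  · obtain ⟨U, f, N, h, hxU⟩ := hK x hx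
    rw [← hp]
    refine h.eventually_eq_of_fderiv_tangent hxU hx (g := fun z => (inner ℝ w z : ℝ)) ?_
    filter_upwards [self_mem_nhdsWithin, mem_nhdsWithin_of_mem_nhds (h.isOpen.mem_nhds hxU)]
      with z hz hzU
    have hd : HasFDerivAt (fun z => (inner ℝ w z : ℝ)) (innerSL ℝ w) z :=
      (innerSL ℝ w).hasFDerivAt
    refine ⟨hd.differentiableAt, fun v hv => ?_⟩
    rwa [hd.fderiv, innerSL_apply_apply, ← hn z hz, h.eq_n z ⟨hz, hzU⟩]
  · by_contra hne
    have : ∀ᶠ z in 𝓝[K] x, (inner ℝ w z : ℝ) ≠ inner ℝ w x₀ :=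
      mem_nhdsWithin_of_mem_nhds ((isOpen_ne_fun (by fun_prop) continuous_const).mem_nhds hne)
    exact hfreq this

/-- If the projection preserves geodesics, then the two surfaces are concentric spheres (`d = 0`)
or coaxial cylinders (`‖d‖ = 1`). -/
theorem exists_roundCylinder {K K₀ : Set E3} {r : ℝ} (hr : 0 < r) (hK₀ : IsConvexC2Surface K₀)
    (hK : IsConvexC2Surface K) (hdist : IsRegularConstantDistance K K₀ r)
    (hplane : ¬ IsAffinePlane K₀) (hproj : ProjPreservesGeodesics K K₀) :
    ∃ (p d : E3) (R₀ R₁ : ℝ), (d = 0 ∨ ‖d‖ = 1) ∧ 0 < R₀ ∧ 0 < R₁ ∧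
      K₀ = roundCylinder p d R₀ ∧ K = roundCylinder p d R₁ := by
  have hK₀c := hK₀.complete.isClosed
  have hcharts := hasNormalCharts_projNormal hr hK.c2 hK₀c hdist
  have hP := parallelTangents_projNormal hr hK.c2 hK₀c hdist hproj
  obtain ⟨B, hB, hconv, hint, hKB⟩ := hK.convex
  obtain ⟨B₀, hB₀, hconv₀, -, hKB₀⟩ := hK₀.convex
  obtain ⟨d, k, w, hdk, hn, hnd⟩ := exists_gauss_eq hr.ne' hcharts hK.connected hP hB hconv hKB
  have hd : d = 0 ∨ ‖d‖ = 1 := hdk.imp_left And.left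
  obtain ⟨x₀, hx₀⟩ := hK.connected.nonempty
  have hnorm : ∀ x ∈ K, ‖k • axisProj d x + w‖ = 1 := fun x hx => by
    rw [← hn x hx]; exact norm_projNormal hr hdist hx
  have hmem : ∀ x ∈ K, x - r • (k • axisProj d x + w) ∈ K₀ := fun x hx => by
    rw [← hn x hx, surfaceProj_eq hr]; exact (surfaceProj_mem hdist hx).1
  have hne : (frontier B).Nonempty := hKB ▸ hK.connected.nonempty
  rcases eq_or_ne k 0 with rfl | hk
  · exfalso
    simp only [zero_smul, zero_add] at hn hnorm hmem
    have hw0 : w ≠ 0 := fun h => by simpa [h] using hnorm x₀ hx₀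
    obtain ⟨c, hc⟩ := exists_subset_plane hcharts hK.connected hn
    have hKeq := frontier_eq_plane_of_subset hw0 hB hint hne (by rw [← hKB]; exact hc)
    have hww : (inner ℝ w w : ℝ) = 1 := by rw [real_inner_self_eq_norm_sq, hnorm x₀ hx₀, one_pow]
    have hsup : {x : E3 | inner ℝ w x = c - r} ⊆ frontier B₀ := by
      intro y hy
      have hy' : y + r • w ∈ K := by
        rw [hKB, hKeq, mem_ofPred_eq, inner_add_right, inner_smul_right, hww, hy]; ring
      have := hmem _ hy'
      rwa [add_sub_cancel_right, hKB₀] at this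
    have hK₀eq := frontier_eq_plane_of_superset hw0 hB₀ hconv₀
      (hKB₀ ▸ hK₀.connected.isPreconnected) hsup
    refine hplane ⟨(c - r) • w, w, hw0, ?_⟩
    rw [hKB₀, hK₀eq]
    ext x
    rw [mem_ofPred_eq, mem_ofPred_eq, inner_sub_right, inner_smul_right, hww, mul_one, sub_eq_zero]
  · set p : E3 := -(k⁻¹ • w) with hp
    have hwd : axisProj d w = w := by
      refine axisProj_of_inner_eq_zero ?_
      have h1 := hnd x₀ hx₀
      rwa [hn x₀ hx₀, real_inner_comm, inner_add_right, inner_smul_right, inner_axisProj hd,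
        mul_zero, zero_add] at h1
    have hgauss : ∀ x, k • axisProj d x + w = k • axisProj d (x - p) := by
      intro x
      rw [hp, sub_neg_eq_add, map_add, map_smul, hwd, smul_add, smul_inv_smul₀ hk]
    simp only [hgauss] at hnorm hmem
    have hk' : 0 < |k| := abs_pos.2 hk
    have hKsub : frontier B ⊆ roundCylinder p d |k|⁻¹ := by
      rw [← hKB]
      intro x hx
      have := hnorm x hx
      rw [norm_smul, Real.norm_eq_abs] at this
      exact eq_inv_of_mul_eq_one_right this
    have hKeq := frontier_eq_roundCylinder_of_subset hd (inv_pos.2 hk') hB hint hne hKsub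
    have hrk := one_sub_mul_ne_zero hcharts ⟨x₀, hx₀⟩ hP hn
    have hR₀ : 0 < |1 - r * k| * |k|⁻¹ := mul_pos (abs_pos.2 hrk) (inv_pos.2 hk')
    refine ⟨p, d, |1 - r * k| * |k|⁻¹, |k|⁻¹, hd, hR₀, inv_pos.2 hk', ?_, hKB.trans hKeq⟩
    rw [hKB₀]
    refine frontier_eq_roundCylinder_of_superset hd hR₀ hB₀ hconv₀ fun y hy => ?_
    -- The projection is `x ↦ x - r k P (x - p)`; here is the point of `K` over `y`.
    set a : ℝ := (1 - r * k)⁻¹ - 1 with ha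
    have ha1 : 1 + a = (1 - r * k)⁻¹ := by rw [ha]; ring
    have hx : y + a • axisProj d (y - p) ∈ K := by
      rw [hKB, hKeq, mem_roundCylinder, add_sub_right_comm, norm_axisProj_add hd, ha1,
        mem_roundCylinder.1 hy, abs_inv, inv_mul_cancel_left₀ (abs_pos.2 hrk).ne']
    have := hmem _ hx
    rw [← hKB₀]
    convert this using 1
    rw [add_sub_right_comm y _ p, axisProj_add_smul hd, ha1, smul_smul, smul_smul, add_sub_assoc,
      ← sub_smul]
    have : a - r * k * (1 - r * k)⁻¹ = 0 := by rw [ha]; field_simp; ring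
    rw [this, zero_smul, add_zero]

/-! ### The projection between concentric spheres and coaxial cylinders -/

/-- The linear map that fixes the axis direction `d` and scales its orthogonal complement by `ρ`;
for `d = 0` it is the homothety with factor `ρ`. -/
noncomputable def axisStretch (d : E3) (ρ : ℝ) : E3 →L[ℝ] E3 :=
  ContinuousLinearMap.id ℝ E3 + (ρ - 1) • axisProj d

theorem axisStretch_apply (d : E3) (ρ : ℝ) (x : E3) :
    axisStretch d ρ x = x + (ρ - 1) • axisProj d x := rfl

theorem axisProj_axisStretch {d : E3} (hd : d = 0 ∨ ‖d‖ = 1) (ρ : ℝ) (x : E3) :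
    axisProj d (axisStretch d ρ x) = ρ • axisProj d x := by
  rw [axisStretch_apply, axisProj_add_smul hd, add_sub_cancel]

theorem axisStretch_inv_axisStretch {d : E3} (hd : d = 0 ∨ ‖d‖ = 1) {ρ : ℝ} (hρ : ρ ≠ 0) (x : E3) :
    axisStretch d ρ⁻¹ (axisStretch d ρ x) = x := by
  rw [axisStretch_apply d ρ⁻¹, axisProj_axisStretch hd, axisStretch_apply, add_assoc, smul_smul,
    ← add_smul, sub_one_mul, inv_mul_cancel₀ hρ, sub_add_sub_cancel, sub_self, zero_smul, add_zero]

theorem inner_axisStretch {d a : E3} (ρ : ℝ) (ha : inner ℝ d a = 0) (x : E3) :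
    (inner ℝ a (axisStretch d ρ x) : ℝ) = ρ * inner ℝ a x := by
  rw [axisStretch_apply, axisProj_apply, inner_add_right, inner_smul_right, inner_sub_right,
    inner_smul_right, real_inner_comm, real_inner_comm d a, ha]
  ring

theorem axisStretch_of_inner_eq_zero {d a : E3} (ρ : ℝ) (ha : inner ℝ d a = 0) :
    axisStretch d ρ a = ρ • a := by
  rw [axisStretch_apply, axisProj_of_inner_eq_zero ha, sub_smul, one_smul, add_sub_cancel]

theorem norm_axisProj_le {d : E3} (hd : d = 0 ∨ ‖d‖ = 1) (x : E3) : ‖axisProj d x‖ ≤ ‖x‖ := by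
  refine le_of_sq_le_sq ?_ (norm_nonneg _)
  rw [axisProj_apply, norm_sub_sq_real, inner_smul_right, norm_smul, mul_pow, real_inner_comm,
    Real.norm_eq_abs, sq_abs]
  rcases hd with rfl | hd
  · simp
  · rw [hd]; nlinarith [sq_nonneg (inner ℝ d x : ℝ)]

theorem axisStretch_mem_roundCylinder {p d x : E3} {R ρ : ℝ} (hd : d = 0 ∨ ‖d‖ = 1) (hρ : 0 < ρ)
    (hx : x ∈ roundCylinder p d R) : p + axisStretch d ρ (x - p) ∈ roundCylinder p d (ρ * R) := by
  rw [mem_roundCylinder, add_sub_cancel_left, axisProj_axisStretch hd, norm_smul,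
    mem_roundCylinder.1 hx, Real.norm_of_nonneg hρ.le]

theorem surfaceProj_roundCylinder {p d : E3} {r R₀ R₁ : ℝ} (hd : d = 0 ∨ ‖d‖ = 1) (hR₀ : 0 < R₀)
    (hR₁ : 0 < R₁)
    (hdist : IsRegularConstantDistance (roundCylinder p d R₁) (roundCylinder p d R₀) r)
    {x : E3} (hx : x ∈ roundCylinder p d R₁) :
    surfaceProj (roundCylinder p d R₀) x = p + axisStretch d (R₀ / R₁) (x - p) := by
  refine (hdist x hx).2.unique (surfaceProj_mem hdist hx) ⟨?_, fun y hy => ?_⟩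
  · have := axisStretch_mem_roundCylinder hd (div_pos hR₀ hR₁) hx
    rwa [div_mul_cancel₀ _ hR₁.ne'] at this
  · have h1 : x - (p + axisStretch d (R₀ / R₁) (x - p)) =
        -((R₀ / R₁ - 1) • axisProj d (x - p)) := by
      rw [axisStretch_apply]; abel
    have h2 : axisProj d (x - y) = axisProj d (x - p) - axisProj d (y - p) := by
      rw [← map_sub, sub_sub_sub_cancel_right]
    calc dist x (p + axisStretch d (R₀ / R₁) (x - p)) = |R₁ - R₀| := by
          rw [dist_eq_norm, h1, norm_neg, norm_smul, mem_roundCylinder.1 hx, Real.norm_eq_abs,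
            ← abs_of_pos hR₁, ← abs_mul, abs_of_pos hR₁, abs_sub_comm R₁, sub_one_mul,
            div_mul_cancel₀ _ hR₁.ne']
      _ ≤ ‖axisProj d (x - y)‖ := by
          rw [h2, ← mem_roundCylinder.1 hx, ← mem_roundCylinder.1 hy]
          exact abs_norm_sub_norm_le _ _
      _ ≤ dist x y := by rw [dist_eq_norm]; exact norm_axisProj_le hd _

theorem isTangentVector_axis {p d x : E3} {R : ℝ} (hd : d = 0 ∨ ‖d‖ = 1)
    (hx : x ∈ roundCylinder p d R) : IsTangentVector (roundCylinder p d R) x d := by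
  have hdd : axisProj d d = 0 := by
    rw [axisProj_apply, real_inner_self_eq_norm_sq]
    rcases hd with rfl | hd
    · simp
    · rw [hd, one_pow, one_smul, sub_self]
  refine ⟨fun t => x + t • d, by simp, Eventually.of_forall fun t => ?_, ?_⟩
  · rw [mem_roundCylinder, add_sub_right_comm, map_add, map_smul, hdd, smul_zero, add_zero]
    exact hx
  · simpa using ((hasDerivAt_id (0 : ℝ)).smul_const d).const_add x

theorem IsTangentVector.axisStretch {p d x v : E3} {R ρ : ℝ} (hd : d = 0 ∨ ‖d‖ = 1) (hρ : 0 < ρ)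
    (hv : IsTangentVector (roundCylinder p d R) x v) :
    IsTangentVector (roundCylinder p d (ρ * R)) (p + axisStretch d ρ (x - p))
      (axisStretch d ρ v) := by
  obtain ⟨c, hc0, hc, hcd⟩ := hv
  refine ⟨fun t => p + _root_.axisStretch d ρ (c t - p), by beta_reduce; rw [hc0], ?_, ?_⟩
  · filter_upwards [hc] with t ht using axisStretch_mem_roundCylinder hd hρ ht
  · exact ((_root_.axisStretch d ρ).hasFDerivAt.comp_hasDerivAt 0 (hcd.sub_const p)).const_add p

/-- Stretching maps a unit speed geodesic to a curve of constant speed, since the acceleration is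
orthogonal to the velocity and to the axis. -/
theorem exists_speed_axisStretch {p d : E3} {R ρ : ℝ} {γ : ℝ → E3} {J : Set ℝ}
    (hd : d = 0 ∨ ‖d‖ = 1) (hρ : 0 < ρ) (hJ : IsOpen J) (hJc : J.OrdConnected)
    (hγ : IsUnitSpeedGeodesicOn (roundCylinder p d R) γ J) :
    ∃ v : ℝ, 0 < v ∧ ∀ t ∈ J, ‖axisStretch d ρ (deriv γ t)‖ = v := by
  rcases J.eq_empty_or_nonempty with rfl | ⟨t₀, ht₀⟩
  · exact ⟨1, one_pos, fun t ht => absurd ht (notMem_empty t)⟩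
  have hsq : ∀ t ∈ J, HasDerivAt (fun t => (inner ℝ (axisStretch d ρ (deriv γ t))
      (axisStretch d ρ (deriv γ t)) : ℝ)) 0 t := by
    intro t ht
    have h1 := (axisStretch d ρ).hasFDerivAt.comp_hasDerivAt t (hγ.hasDerivAt_deriv hJ ht)
    have h2 := h1.inner ℝ h1
    have hda : inner ℝ d (deriv (deriv γ) t) = (0 : ℝ) := by
      rw [real_inner_comm]
      exact hγ.normal t ht d (isTangentVector_axis hd (hγ.mem t ht))
    have h3 : (inner ℝ (axisStretch d ρ (deriv (deriv γ) t)) (axisStretch d ρ (deriv γ t)) : ℝ) =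
        0 := by
      rw [axisStretch_of_inner_eq_zero ρ hda, inner_smul_left, inner_axisStretch ρ hda,
        hγ.normal t ht _ (hγ.isTangentVector hJ ht), mul_zero, mul_zero]
    rwa [Function.comp_apply, real_inner_comm, h3, add_zero] at h2
  have hconst : ∀ t ∈ J, ‖axisStretch d ρ (deriv γ t)‖ = ‖axisStretch d ρ (deriv γ t₀)‖ := by
    intro t ht
    have := hJ.is_const_of_deriv_eq_zero hJc.isPreconnected
      (fun s hs => (hsq s hs).differentiableAt.differentiableWithinAt)
      (fun s hs => (hsq s hs).deriv) ht ht₀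
    rw [norm_eq_sqrt_real_inner, norm_eq_sqrt_real_inner, this]
  refine ⟨_, norm_pos_iff.2 fun h0 => ?_, hconst⟩
  have h1 := axisStretch_inv_axisStretch hd hρ.ne' (deriv γ t₀)
  rw [h0, map_zero] at h1
  have h2 := hγ.unit_speed t₀ ht₀
  rw [← h1, norm_zero] at h2
  exact zero_ne_one h2

/-- Stretching maps unit speed geodesics to geodesics of constant speed `v`. -/
theorem IsUnitSpeedGeodesicOn.axisStretch {p d : E3} {R ρ v : ℝ} {γ : ℝ → E3} {J : Set ℝ}
    (hd : d = 0 ∨ ‖d‖ = 1) (hρ : 0 < ρ) (hJ : IsOpen J) (hv0 : 0 < v)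
    (hv : ∀ t ∈ J, ‖axisStretch d ρ (deriv γ t)‖ = v)
    (hγ : IsUnitSpeedGeodesicOn (roundCylinder p d R) γ J) :
    IsUnitSpeedGeodesicOn (roundCylinder p d (ρ * R))
      (fun t => p + axisStretch d ρ (γ (v⁻¹ * t) - p)) ((fun t => v⁻¹ * t) ⁻¹' J) := by
  set A := _root_.axisStretch d ρ with hA
  have hlin : ∀ t : ℝ, HasDerivAt (fun t => v⁻¹ * t) v⁻¹ t := fun t => by
    simpa using (hasDerivAt_id t).const_mul v⁻¹
  have hopen : IsOpen ((fun t => v⁻¹ * t) ⁻¹' J) := hJ.preimage (by fun_prop)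
  have he1 : ∀ t, v⁻¹ * t ∈ J → HasDerivAt (fun t => p + A (γ (v⁻¹ * t) - p))
      (v⁻¹ • A (deriv γ (v⁻¹ * t))) t := by
    intro t ht
    have h1 := (HasDerivAt.scomp t (hγ.hasDerivAt hJ ht) (hlin t)).sub_const p
    have h2 := (A.hasFDerivAt.comp_hasDerivAt t h1).const_add p
    rwa [map_smul] at h2
  have he2 : ∀ t, v⁻¹ * t ∈ J → deriv (deriv fun t => p + A (γ (v⁻¹ * t) - p)) t =
      (v⁻¹ * v⁻¹) • A (deriv (deriv γ) (v⁻¹ * t)) := by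
    intro t ht
    have h1 := HasDerivAt.scomp t (hγ.hasDerivAt_deriv hJ ht) (hlin t)
    have h2 := (A.hasFDerivAt.comp_hasDerivAt t h1).const_smul v⁻¹
    rw [map_smul, smul_smul] at h2
    refine (h2.congr_of_eventuallyEq ?_).deriv
    filter_upwards [hopen.mem_nhds ht] with s hs using (he1 s hs).deriv
  refine ⟨?_, fun t ht => axisStretch_mem_roundCylinder hd hρ (hγ.mem _ ht), fun t ht => ?_,
    fun t ht w hw => ?_⟩
  · have h1 : ContDiffOn ℝ 2 (fun t => γ (v⁻¹ * t)) ((fun t => v⁻¹ * t) ⁻¹' J) :=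
      hγ.contDiffOn.comp (by fun_prop) (mapsTo_preimage _ _)
    exact contDiffOn_const.add (A.contDiff.comp_contDiffOn (h1.sub contDiffOn_const))
  · rw [(he1 t ht).deriv, norm_smul, hv _ ht, norm_inv, Real.norm_of_nonneg hv0.le,
      inv_mul_cancel₀ hv0.ne']
  · have hda : inner ℝ d (deriv (deriv γ) (v⁻¹ * t)) = (0 : ℝ) := by
      rw [real_inner_comm]
      exact hγ.normal _ ht d (isTangentVector_axis hd (hγ.mem _ ht))
    -- The inverse stretching carries `w` back to a tangent vector of the first surface.
    have hw' := hw.axisStretch hd (inv_pos.2 hρ)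
    rw [add_sub_cancel_left, hA, axisStretch_inv_axisStretch hd hρ.ne', add_sub_cancel,
      inv_mul_cancel_left₀ hρ.ne'] at hw'
    have h1 := hγ.normal _ ht _ hw'
    rw [inner_axisStretch _ hda] at h1
    have h2 := (mul_eq_zero.1 h1).resolve_left (inv_ne_zero hρ.ne')
    rw [he2 t ht, inner_smul_left, hA, axisStretch_of_inner_eq_zero ρ hda, inner_smul_left, h2,
      mul_zero, mul_zero]

/-- The projection between concentric spheres or coaxial round cylinders preserves geodesics. -/
theorem projPreservesGeodesics_roundCylinder {p d : E3} {r R₀ R₁ : ℝ} (hd : d = 0 ∨ ‖d‖ = 1)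
    (hR₀ : 0 < R₀) (hR₁ : 0 < R₁)
    (hdist : IsRegularConstantDistance (roundCylinder p d R₁) (roundCylinder p d R₀) r) :
    ProjPreservesGeodesics (roundCylinder p d R₁) (roundCylinder p d R₀) := by
  rintro I c hI - ⟨J, γ, s, hJ, hJc, hγ, hs, hs0, hsJ, hc⟩
  have hρ := div_pos hR₀ hR₁
  obtain ⟨v, hv0, hv⟩ := exists_speed_axisStretch hd hρ hJ hJc hγ
  have hη := hγ.axisStretch hd hρ hJ hv0 hv
  rw [div_mul_cancel₀ _ hR₁.ne'] at hη
  have hcancel : ∀ t, v⁻¹ * (v * s t) = s t := fun t => inv_mul_cancel_left₀ hv0.ne' _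
  refine ⟨_, _, fun t => v * s t, hJ.preimage (by fun_prop),
    hJc.preimage_mono (monotone_id.const_mul (inv_nonneg.2 hv0.le)), hη,
    contDiffOn_const.mul hs, fun t ht => ?_, fun t ht => ?_, fun t ht => ?_⟩
  · have := (hs.contDiffAt (hI.mem_nhds ht)).differentiableAt one_ne_zero
    rw [deriv_const_mul _ this]
    exact mul_ne_zero hv0.ne' (hs0 t ht)
  · change v⁻¹ * (v * s t) ∈ J
    rw [hcancel]
    exact hsJ ht
  · beta_reduce
    rw [Function.comp_apply, hcancel, hc ht, Function.comp_apply]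
    exact surfaceProj_roundCylinder hd hR₀ hR₁ hdist (hγ.mem _ (hsJ ht))

theorem mainTheorem2 (K₀ Kᵣ : Set E3) (r : ℝ) (hr : 0 < r)
    (hK₀ : IsConvexC2Surface K₀) (hKᵣ : IsConvexC2Surface Kᵣ)
    (hdist : IsRegularConstantDistance Kᵣ K₀ r)
    (hplane : ¬ IsAffinePlane K₀) :
    ProjPreservesGeodesics Kᵣ K₀ ↔
      ((∃ (p : E3) (R₀ R₁ : ℝ), 0 < R₀ ∧ 0 < R₁ ∧
          K₀ = Metric.sphere p R₀ ∧ Kᵣ = Metric.sphere p R₁) ∨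
        (∃ (p u : E3) (R₀ R₁ : ℝ), ‖u‖ = 1 ∧ 0 < R₀ ∧ 0 < R₁ ∧
          K₀ = roundCylinder p u R₀ ∧ Kᵣ = roundCylinder p u R₁)) := by
  constructor
  · intro hproj
    obtain ⟨p, d, R₀, R₁, rfl | hd, hR₀, hR₁, h₀, h₁⟩ :=
      exists_roundCylinder hr hK₀ hKᵣ hdist hplane hproj
    · rw [roundCylinder_zero] at h₀ h₁
      exact Or.inl ⟨p, R₀, R₁, hR₀, hR₁, h₀, h₁⟩
    · exact Or.inr ⟨p, d, R₀, R₁, hd, hR₀, hR₁, h₀, h₁⟩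
  · rintro (⟨p, R₀, R₁, hR₀, hR₁, rfl, rfl⟩ | ⟨p, d, R₀, R₁, hd, hR₀, hR₁, rfl, rfl⟩)
    · rw [← roundCylinder_zero, ← roundCylinder_zero] at hdist ⊢
      exact projPreservesGeodesics_roundCylinder (Or.inl rfl) hR₀ hR₁ hdist
    · exact projPreservesGeodesics_roundCylinder (Or.inr hd) hR₀ hR₁ hdist
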